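/- Let $F$ be a germ of holomorphic diffeomorphism of $(\mathbb C^2,0)$ and let $\Gamma$ be an irreducible formal curve at $0$, i.e. a nonzero principal prime ideal of $\mathbb C[[x,y]]$. Suppose that $\Gamma$ is invariant by $F$ ($h\circ F\in\Gamma$ for all $h\in\Gamma$) and hyperbolic attracting: for an irreducible parametrization $\gamma(s)\in\mathbb C[[s]]^2$ of $\Gamma$ one has $F\circ\gamma=\gamma\circ\theta$ with $\theta\in\mathbb C[[s]]$, $\theta(0)=0$ and $0<|\theta'(0)|<1$. (A parametrization of $\Gamma$ is a nonzero $\gamma$ with $\gamma(0)=0$ such that $h\in\Gamma\iff h\circ\gamma=0$; it is irreducible if it is not $\sigma\circ\tau$ with $\sigma$ another parametrization and $\tau\in\mathbb C[[s]]$ of order at least $2$.) Then $\Gamma$ is convergent: it is generated by the Taylor series of a holomorphic function $h$ defined near $0$. Moreover, every neighbourhood of $0$ contains an open neighbourhood $V$ of $0$, on which $F$ and $h$ are holomorphic, such that the representative $C=\{p\in V: h(p)=0\}$ of $\Gamma$ satisfies: 1. $C$ is a stable set of $F$: $F(C)\subset C$, and $F^n(p)\to 0$ for every $p\in C$. 2.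 $C\setminus\{0\}$ is a stable manifold of $F$, i.e. a stable set that is a locally closed complex submanifold (here of pure dimension one); if $\Gamma$ is non-singular, then $C$ itself is a stable manifold of $F$. 3. $C$ contains the germ of every orbit of $F$ asymptotic to $\Gamma$: if the orbit of $p$ is asymptotic to $\Gamma$, then $F^n(p)\in C$ for all sufficiently large $n$. Here an orbit $O=\{F^n(p)\}_{n\ge0}$ is asymptotic to $\Gamma$ if $0\notin O$, $F^n(p)\to0$, and $O$ has as its sequence of iterated tangents the sequence of infinitely near points of $\Gamma$. That is: put $q_0=0$, $\Gamma_0=\Gamma$, $O_0=O$, and for $n\ge 1$ let $\pi_n$ be the blow-up at $q_{n-1}$, let $q_n\in\pi_n^{-1}(q_{n-1})$ be the point given by the tangent line of $\Gamma_{n-1}$, let $\Gamma_n$ be the strict transform of $\Gamma_{n-1}$ at $q_n$ (the irreducible formal curve at $q_n$, different from the exceptional divisor $\pi_n^{-1}(q_{n-1})$, that contains $g\circ\pi_n$ for all $g\in\Gamma_{n-1}$), and let $O_n=\pi_n^{-1}(O_{n-1})$; the condition is that $\overline{O_n}\cap\pi_n^{-1}(q_{n-1})=\{q_n\}$ for every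 $n\ge1$. -/

import Mathlib

open Filter Topology

noncomputable section

namespace FormalCurve

/-! ### Germs of diffeomorphisms of `(ℂ², 0)` and Taylor series -/

/-- `F` represents a germ of holomorphic diffeomorphism of `(ℂ², 0)`. Only the values of `F` near
the origin matter; outside a neighbourhood of `0` they are arbitrary. -/
def IsDiffeoGerm (F : ℂ × ℂ → ℂ × ℂ) : Prop :=
  AnalyticAt ℂ F 0 ∧ F 0 = 0 ∧ Function.Bijective (fderiv ℂ F 0)

/-- The ring `ℂ[[x, y]]`. The variable of index `0` is `x`, the one of index `1` is `y`. -/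
abbrev Series2 : Type := MvPowerSeries (Fin 2) ℂ

/-- The variable `x`. -/
def X₀ : Series2 := MvPowerSeries.X 0

/-- The variable `y`. -/
def X₁ : Series2 := MvPowerSeries.X 1

/-- The Taylor series at the origin of a function `f(x, y)`: the coefficient of `x ^ i * y ^ j` is
`(∂ₓ ^ i ∂ᵧ ^ j f)(0, 0) / (i! j!)`. -/
def taylor (f : ℂ × ℂ → ℂ) : Series2 := fun n =>
  iteratedDeriv (n 0) (fun x : ℂ => iteratedDeriv (n 1) (fun y : ℂ => f (x, y)) 0) 0 /
    ((n 0).factorial * (n 1).factorial : ℂ)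

/-- The Taylor series of the two components of `F`. -/
def taylorMap (F : ℂ × ℂ → ℂ × ℂ) : Fin 2 → Series2 :=
  ![taylor fun p => (F p).1, taylor fun p => (F p).2]

/-! ### Formal curves, invariance, inner eigenvalue -/

/-- An irreducible formal curve at `0 ∈ ℂ²`: a nonzero principal prime ideal of `ℂ[[x, y]]`. -/
def IsFormalCurve (Γ : Ideal Series2) : Prop :=
  ∃ f : Series2, Prime f ∧ Γ = Ideal.span {f}

/-- The curve is non-singular (of multiplicity one): a generator has nonzero linear part. -/
def IsNonsingular (Γ : Ideal Series2) : Prop :=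
  ∃ f : Series2, Γ = Ideal.span {f} ∧ MvPowerSeries.constantCoeff f = 0 ∧
    ∃ i : Fin 2, MvPowerSeries.coeff (Finsupp.single i 1) f ≠ 0

/-- `Γ` is invariant by `F`: `h ∘ F ∈ Γ` for every `h ∈ Γ`. -/
def IsInvariant (F : ℂ × ℂ → ℂ × ℂ) (Γ : Ideal Series2) : Prop :=
  ∀ h ∈ Γ, MvPowerSeries.subst (taylorMap F) h ∈ Γ

/-- The composition `h ∘ γ` of `h ∈ ℂ[[x, y]]` with a formal arc `γ`. -/
def evalArc (γ : Fin 2 → PowerSeries ℂ) (h : Series2) : PowerSeries ℂ :=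
  MvPowerSeries.subst (τ := Unit) γ h

/-- `γ(s) = (γ₁(s), γ₂(s))` is a parametrization of `Γ`. -/
def IsParametrization (Γ : Ideal Series2) (γ : Fin 2 → PowerSeries ℂ) : Prop :=
  γ ≠ 0 ∧ (∀ i, PowerSeries.constantCoeff (γ i) = 0) ∧ ∀ h : Series2, h ∈ Γ ↔ evalArc γ h = 0

/-- `γ` is an irreducible parametrization of `Γ`: it is not of the form `σ(τ(s))` with `σ` another
parametrization of `Γ` and `τ` a series of order at least two. -/
def IsIrreducibleParametrization (Γ : Ideal Series2) (γ : Fin 2 → PowerSeries ℂ) : Prop :=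
  IsParametrization Γ γ ∧
    ∀ (σ : Fin 2 → PowerSeries ℂ) (τ : PowerSeries ℂ), IsParametrization Γ σ →
      PowerSeries.constantCoeff τ = 0 → (∀ i, γ i = PowerSeries.subst τ (σ i)) →
        PowerSeries.coeff 1 τ ≠ 0

/-- `lam` is the inner eigenvalue of the invariant curve `Γ` of `F`: one has `F ∘ γ = γ ∘ θ` with
`γ` an irreducible parametrization of `Γ`, `θ` a formal diffeomorphism in one variable (the
restriction of `F` to `Γ`), and `θ'(0) = lam`. -/
def HasInnerEigenvalue (F : ℂ × ℂ → ℂ × ℂ) (Γ : Ideal Series2) (lam : ℂ) : Prop :=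
  ∃ (γ : Fin 2 → PowerSeries ℂ) (θ : PowerSeries ℂ),
    IsIrreducibleParametrization Γ γ ∧ PowerSeries.constantCoeff θ = 0 ∧
    PowerSeries.coeff 1 θ = lam ∧ lam ≠ 0 ∧
    ∀ i, evalArc γ (taylorMap F i) = PowerSeries.subst θ (γ i)

/-- The curve `Γ` is hyperbolic attracting for `F`: its inner eigenvalue has modulus `< 1`. -/
def IsHyperbolicAttracting (F : ℂ × ℂ → ℂ × ℂ) (Γ : Ideal Series2) : Prop :=
  ∃ lam : ℂ, HasInnerEigenvalue F Γ lam ∧ ‖lam‖ < 1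

/-! ### Blow-ups

The blow-up of `ℂ²` at the origin is `{(p, ℓ) : p ∈ ℓ} ⊆ ℂ² × ℙ¹`, with exceptional divisor
`{0} × ℙ¹`. The projective line is the Riemann sphere `OnePoint ℂ`: the line through `0` spanned by
`(1, m)` is the point `m`, the line `x = 0` is the point `∞`. -/

/-- The line through `0` and `p`, for `p ≠ 0`. -/
def lineThrough (p : ℂ × ℂ) : OnePoint ℂ :=
  if p.1 = 0 then OnePoint.infty else ((p.2 / p.1 : ℂ) : OnePoint ℂ)

/-- A nonzero vector on the line `m`. -/
def lineVector : OnePoint ℂ → ℂ × ℂ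
  | none => (0, 1)
  | some m => (1, m)

/-- The inverse image in the blow-up, a subset of `ℂ² × ℙ¹`, of a set `S` of nonzero points. -/
def blowUpLift (S : Set (ℂ × ℂ)) : Set ((ℂ × ℂ) × OnePoint ℂ) :=
  (fun p => (p, lineThrough p)) '' S

/-- The points of the exceptional divisor that are in the closure of the lift of `S`. -/
def limitLines (S : Set (ℂ × ℂ)) : Set (OnePoint ℂ) :=
  {m | ((0 : ℂ × ℂ), m) ∈ closure (blowUpLift S)}

/-- The blow-up map in an affine chart of the blow-up that is centred at the point `m` of the
exceptional divisor: `(x, y) ↦ (x, x (y + m))` for finite `m`, and `(x, y) ↦ (x y, y)` for `∞`. -/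
def blowUpChart : OnePoint ℂ → ℂ × ℂ → ℂ × ℂ
  | none => fun p => (p.1 * p.2, p.2)
  | some m => fun p => (p.1, p.1 * (p.2 + m))

/-- The components of `blowUpChart m` as elements of `ℂ[[x, y]]`. -/
def blowUpSeries : OnePoint ℂ → Fin 2 → Series2
  | none => ![X₀ * X₁, X₁]
  | some m => ![X₀, X₀ * (X₁ + MvPowerSeries.C m)]

/-- The equation of the exceptional divisor in the chart centred at `m`. -/
def exceptionalEquation : OnePoint ℂ → Series2
  | none => X₁
  | some _ => X₀

/-- The line `m` is the tangent line of the curve `Γ`: `Γ` has a generator whose homogeneous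
component of lowest degree `ν` is `(a x + b y) ^ ν`, and `m` is the line `a x + b y = 0`. -/
def IsTangentLine (Γ : Ideal Series2) (m : OnePoint ℂ) : Prop :=
  ∃ (f : Series2) (ν : ℕ) (a b : ℂ), Γ = Ideal.span {f} ∧ (a, b) ≠ 0 ∧
    (∀ n : Fin 2 →₀ ℕ, n 0 + n 1 < ν → MvPowerSeries.coeff n f = 0) ∧
    (∀ n : Fin 2 →₀ ℕ, n 0 + n 1 = ν →
      MvPowerSeries.coeff n f = MvPowerSeries.coeff n
        ((MvPowerSeries.C a * X₀ + MvPowerSeries.C b * X₁) ^ ν)) ∧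
    a * (lineVector m).1 + b * (lineVector m).2 = 0

/-- `Γ'` is the strict transform of `Γ` at the point `m` of the exceptional divisor (in the chart
centred at `m`): an irreducible formal curve, different from the exceptional divisor, that contains
`h ∘ π` for every `h ∈ Γ`, where `π` is the blow-up. -/
def IsStrictTransform (Γ : Ideal Series2) (m : OnePoint ℂ) (Γ' : Ideal Series2) : Prop :=
  IsFormalCurve Γ' ∧ Γ' ≠ Ideal.span {exceptionalEquation m} ∧
    ∀ h ∈ Γ, MvPowerSeries.subst (blowUpSeries m) h ∈ Γ'

/-- `m` is the sequence of infinitely near points of `Γ`: `m 0` is the tangent line of `Γ`, `m 1`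
is the tangent line of the strict transform of `Γ` at `m 0`, and so on. -/
def IsInfinitelyNearSequence (Γ : Ideal Series2) (m : ℕ → OnePoint ℂ) : Prop :=
  ∃ G : ℕ → Ideal Series2, G 0 = Γ ∧
    ∀ n, IsTangentLine (G n) (m n) ∧ IsStrictTransform (G n) (m n) (G (n + 1))

/-- The successive inverse images of `S` under the blow-ups at the points `m 0, m 1, …`, in the
charts centred at these points. -/
def iteratedLift (m : ℕ → OnePoint ℂ) (S : Set (ℂ × ℂ)) : ℕ → Set (ℂ × ℂ)
  | 0 => S
  | n + 1 => blowUpChart (m n) ⁻¹' iteratedLift m S n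

/-- `S` has the property of iterated tangents, and `m` is its sequence of iterated tangents: at each
step, the closure of the lift of `S` meets the exceptional divisor exactly at the point `m n`. -/
def HasIteratedTangents (S : Set (ℂ × ℂ)) (m : ℕ → OnePoint ℂ) : Prop :=
  ∀ n, limitLines (iteratedLift m S n) = {m n}

/-- `S` (not containing `0`) is asymptotic to `Γ`: it has the property of iterated tangents, and its
sequence of iterated tangents is the sequence of infinitely near points of `Γ`. -/
def IsAsymptoticTo (S : Set (ℂ × ℂ)) (Γ : Ideal Series2) : Prop :=
  (0 : ℂ × ℂ) ∉ S ∧ ∃ m : ℕ → OnePoint ℂ, HasIteratedTangents S m ∧ IsInfinitelyNearSequence Γ m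

/-- The orbit of `p` is a (non-trivial) stable orbit of `F`, asymptotic to `Γ`. -/
def IsAsymptoticOrbit (F : ℂ × ℂ → ℂ × ℂ) (Γ : Ideal Series2) (p : ℂ × ℂ) : Prop :=
  Tendsto (fun n : ℕ => F^[n] p) atTop (𝓝 0) ∧
    IsAsymptoticTo (Set.range fun n : ℕ => F^[n] p) Γ

/-! ### Stable sets and stable manifolds -/

/-- `B` is a stable set of `F` in `V`: `V` is an open neighbourhood of `0` where `F` is holomorphic,
`B ⊆ V` is invariant, and the orbit of every point of `B` converges to `0`. -/
def IsStableSet (F : ℂ × ℂ → ℂ × ℂ) (V B : Set (ℂ × ℂ)) : Prop :=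
  IsOpen V ∧ (0 : ℂ × ℂ) ∈ V ∧ AnalyticOnNhd ℂ F V ∧ B ⊆ V ∧ Set.MapsTo F B B ∧
    ∀ p ∈ B, Tendsto (fun n : ℕ => F^[n] p) atTop (𝓝 0)

/-- `S` is a locally closed complex submanifold of `ℂ²` of pure dimension one: near each of its
points it is the zero set of a holomorphic function with nonzero differential at that point. -/
def IsComplexSubmanifoldDimOne (S : Set (ℂ × ℂ)) : Prop :=
  ∀ p ∈ S, ∃ (W : Set (ℂ × ℂ)) (g : ℂ × ℂ → ℂ), IsOpen W ∧ p ∈ W ∧ AnalyticOnNhd ℂ g W ∧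
    fderiv ℂ g p ≠ 0 ∧ S ∩ W = {q | g q = 0} ∩ W

/-- `S` is a one-dimensional stable manifold of `F` in `V`. -/
def IsStableCurve (F : ℂ × ℂ → ℂ × ℂ) (V S : Set (ℂ × ℂ)) : Prop :=
  IsStableSet F V S ∧ IsComplexSubmanifoldDimOne S

/-- The analytic subset `h = 0` of `V`. -/
def zeroSet (h : ℂ × ℂ → ℂ) (V : Set (ℂ × ℂ)) : Set (ℂ × ℂ) := {p ∈ V | h p = 0}

end FormalCurve

end

open Filter Topology
noncomputable section
namespace FormalCurve

/-! ### Taylor series in one variable -/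

/-! The proof has three independent ingredients.

Convergence. Let `a` be an irreducible parametrization with `F ∘ a = a ∘ η` and `η'(0) = lam`, `0 <
|lam| < 1`. Since `lam ^ n ≠ lam` for `n ≥ 2`, `η` is formally linearizable
(`exists_linearization`), so in a new parameter the arc satisfies `F(b(s)) = b(lam s)`. With `G =
F⁻¹` this is the fixed point equation `b(s) = G(b(lam s))`. On perturbations of order `N` the
operator on the right has Lipschitz constant at most `L |lam| ^ N`, where `L` is a Lipschitz
constant of `G`, so it is a contraction for large `N`. Truncations of `b` are approximate solutions;
they lead to an analytic solution, and comparing different `N` shows that its Taylor series is `b`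
(`IsDiffeoGerm.exists_taylorArc_eq`).

Equation. After a change of parameter, and possibly an exchange of the coordinates, the arc is `(t ^
ν, y(t))`, and irreducibility makes it injective (`IsPrimitiveArc.exists_injOn`). The product of `Y
- y(ζ ^ i t)` over the `ν`-th roots of unity is a convergent function `h(x, Y)` with `x = t ^ ν`. It
generates the ideal of formal equations of the arc, its zero set near `0` is the image of a disc,
its differential is nonzero on that image off `0`, and every analytic `g` that vanishes on the arc
is `O(h)`. These facts form `IsEquation`. On the arc `F` acts as a contraction `θ` of the disc, so
the zero set of `h` is stable.

Asymptotic orbits. A function that vanishes on the curve pulls back under the blow-up at the tangent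
line to the exceptional coordinate times a function that vanishes on the strict transform. The lift
of `F` multiplies the exceptional coordinate by a function whose value at the centre is `lam ^ μ`,
`μ ≥ 1`, so this coordinate decays geometrically along the lifted orbit. As the orbit can be lifted
any number of times, `h(F^n(p)) = O(ρ ^ (n K))` for every `K`, with a fixed `ρ < 1`
(`exists_decay`). On the other hand `h ∘ F⁻¹` vanishes on the curve, so it is `O(h)`, and `h`
decreases at most geometrically along orbits (`IsEquation.exists_le_comp`). Both can hold only if
`h(F^n(p)) = 0` for large `n`. -/

/-- The Taylor series at the origin of a function of one variable. -/
def taylor1 (u : ℂ → ℂ) : PowerSeries ℂ :=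
  PowerSeries.mk fun n => iteratedDeriv n u 0 / (n.factorial : ℂ)

theorem coeff_taylor1 (u : ℂ → ℂ) (n : ℕ) :
    PowerSeries.coeff n (taylor1 u) = iteratedDeriv n u 0 / (n.factorial : ℂ) := by
  simp [taylor1]

theorem taylor1_congr {u v : ℂ → ℂ} (h : u =ᶠ[𝓝 0] v) : taylor1 u = taylor1 v := by
  ext n
  rw [coeff_taylor1, coeff_taylor1, h.iteratedDeriv_eq]

theorem taylor1_add {u v : ℂ → ℂ} (hu : AnalyticAt ℂ u 0) (hv : AnalyticAt ℂ v 0) :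
    taylor1 (fun s => u s + v s) = taylor1 u + taylor1 v := by
  ext n
  rw [map_add, coeff_taylor1, coeff_taylor1, coeff_taylor1,
    iteratedDeriv_fun_add hu.contDiffAt hv.contDiffAt, add_div]

theorem taylor1_mul {u v : ℂ → ℂ} (hu : AnalyticAt ℂ u 0) (hv : AnalyticAt ℂ v 0) :
    taylor1 (fun s => u s * v s) = taylor1 u * taylor1 v := by
  ext n
  rw [PowerSeries.coeff_mul, coeff_taylor1, iteratedDeriv_fun_mul hu.contDiffAt hv.contDiffAt,
    Finset.Nat.sum_antidiagonal_eq_sum_range_succ_mk, Finset.sum_div]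
  refine Finset.sum_congr rfl fun i hi => ?_
  have hi' : i ≤ n := Nat.lt_succ_iff.mp (Finset.mem_range.mp hi)
  rw [coeff_taylor1, coeff_taylor1, Nat.cast_choose ℂ hi']
  have h1 : (n.factorial : ℂ) ≠ 0 := by exact_mod_cast n.factorial_ne_zero
  have h2 : (i.factorial : ℂ) ≠ 0 := by exact_mod_cast i.factorial_ne_zero
  have h3 : ((n - i).factorial : ℂ) ≠ 0 := by exact_mod_cast (n - i).factorial_ne_zero
  field_simp

theorem taylor1_const (c : ℂ) : taylor1 (fun _ => c) = PowerSeries.C c := by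
  ext n
  rw [coeff_taylor1, iteratedDeriv_const, PowerSeries.coeff_C]
  split_ifs with h <;> simp [h]

theorem analyticAt_var : AnalyticAt ℂ (fun s : ℂ => s) 0 := analyticAt_id

theorem taylor1_id : taylor1 (fun s => s) = PowerSeries.X := by
  ext n
  rw [coeff_taylor1, PowerSeries.coeff_X]
  rcases n with _ | _ | n
  · simp
  · simp [iteratedDeriv_one]
  · rw [iteratedDeriv_succ', iteratedDeriv_succ']
    simp

theorem taylor1_pow {u : ℂ → ℂ} (hu : AnalyticAt ℂ u 0) (k : ℕ) :
    taylor1 (fun s => u s ^ k) = taylor1 u ^ k := by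
  induction k with
  | zero => simpa using taylor1_const 1
  | succ k ih => simp only [pow_succ]; rw [taylor1_mul (hu.fun_pow k) hu, ih]

theorem taylor1_id_pow (k : ℕ) : taylor1 (fun s => s ^ k) = PowerSeries.X ^ k := by
  rw [taylor1_pow analyticAt_var, taylor1_id]

theorem taylor1_const_mul {u : ℂ → ℂ} (hu : AnalyticAt ℂ u 0) (c : ℂ) :
    taylor1 (fun s => c * u s) = PowerSeries.C c * taylor1 u := by
  rw [taylor1_mul analyticAt_const hu, taylor1_const]

theorem taylor1_sub {u v : ℂ → ℂ} (hu : AnalyticAt ℂ u 0) (hv : AnalyticAt ℂ v 0) :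
    taylor1 (fun s => u s - v s) = taylor1 u - taylor1 v := by
  have h := taylor1_add (hu.sub hv) hv
  rw [eq_sub_iff_add_eq, ← Pi.sub_def, ← h]
  simp

theorem constantCoeff_taylor1 (u : ℂ → ℂ) : PowerSeries.constantCoeff (taylor1 u) = u 0 := by
  rw [← PowerSeries.coeff_zero_eq_constantCoeff_apply, coeff_taylor1]; simp

theorem coeff_one_taylor1 (u : ℂ → ℂ) : PowerSeries.coeff 1 (taylor1 u) = deriv u 0 := by
  rw [coeff_taylor1]; simp [iteratedDeriv_one]

/-- Vanishing of the first Taylor coefficients means divisibility by a power of the variable. -/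
theorem X_pow_dvd_taylor1_iff {u : ℂ → ℂ} (hu : AnalyticAt ℂ u 0) (k : ℕ) :
    PowerSeries.X ^ k ∣ taylor1 u ↔ ∃ v, AnalyticAt ℂ v 0 ∧ ∀ᶠ s in 𝓝 0, u s = s ^ k * v s := by
  have h1 := natCast_le_analyticOrderAt hu (n := k)
  rw [natCast_le_analyticOrderAt_iff_iteratedDeriv_eq_zero hu] at h1
  simp only [sub_zero, smul_eq_mul] at h1
  rw [← h1, PowerSeries.X_pow_dvd_iff]
  refine forall₂_congr fun i _ => ?_
  rw [coeff_taylor1, div_eq_zero_iff, or_iff_left]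
  exact_mod_cast i.factorial_ne_zero

theorem taylor1_eq_zero_iff {u : ℂ → ℂ} (hu : AnalyticAt ℂ u 0) :
    taylor1 u = 0 ↔ ∀ᶠ s in 𝓝 0, u s = 0 := by
  constructor
  · intro h
    rw [← analyticOrderAt_eq_top, ENat.eq_top_iff_forall_ge]
    intro m
    rw [natCast_le_analyticOrderAt_iff_iteratedDeriv_eq_zero hu]
    intro i _
    have h2 := coeff_taylor1 u i
    rw [h, map_zero, eq_comm, div_eq_zero_iff, or_iff_left] at h2
    · exact h2
    · exact_mod_cast i.factorial_ne_zero
  · intro h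
    rw [taylor1_congr (v := fun _ => 0) h, taylor1_const, map_zero]

theorem taylor1_inj {u v : ℂ → ℂ} (hu : AnalyticAt ℂ u 0) (hv : AnalyticAt ℂ v 0) :
    taylor1 u = taylor1 v ↔ ∀ᶠ s in 𝓝 0, u s = v s := by
  rw [← sub_eq_zero, ← taylor1_sub hu hv, taylor1_eq_zero_iff (hu.fun_sub hv)]
  simp only [sub_eq_zero]

/-- An analytic function minus its value is the variable times an analytic function. -/
theorem exists_eq_add_mul {u : ℂ → ℂ} (hu : AnalyticAt ℂ u 0) :
    ∃ v, AnalyticAt ℂ v 0 ∧ ∀ᶠ s in 𝓝 0, u s = u 0 + s * v s := by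
  obtain ⟨v, hv, h⟩ := (X_pow_dvd_taylor1_iff (hu.fun_sub (analyticAt_const (v := u 0))) 1).1 (by
    rw [pow_one, PowerSeries.X_dvd_iff, constantCoeff_taylor1, sub_self])
  refine ⟨v, hv, h.mono fun s hs => ?_⟩
  have : u s - u 0 = s * v s := by simpa using hs
  rw [← this]; ring

/-! ### Taylor series in two variables -/

/-- The coefficient of `y ^ j` in `f(x, y)`, as a function of `x`. -/
def sliceCoeff (f : ℂ × ℂ → ℂ) (j : ℕ) (x : ℂ) : ℂ :=
  PowerSeries.coeff j (taylor1 fun y => f (x, y))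

/-- Reduces the two-variable Taylor series to iterated one-variable ones: first in `y` on each
vertical slice, then in `x`. -/
theorem coeff_taylor (f : ℂ × ℂ → ℂ) (n : Fin 2 →₀ ℕ) :
    MvPowerSeries.coeff n (taylor f) = PowerSeries.coeff (n 0) (taylor1 (sliceCoeff f (n 1))) := by
  rw [coeff_taylor1]
  change iteratedDeriv (n 0) (fun x : ℂ => iteratedDeriv (n 1) (fun y : ℂ => f (x, y)) 0) 0 / _ = _
  have : sliceCoeff f (n 1) =
      fun x => iteratedDeriv (n 1) (fun y : ℂ => f (x, y)) 0 / ((n 1).factorial : ℂ) := by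
    ext x; rw [sliceCoeff, coeff_taylor1]
  rw [this, iteratedDeriv_div_const, div_div, mul_comm (((n 1).factorial : ℂ))]

theorem eventually_slice {P : ℂ × ℂ → Prop} (h : ∀ᶠ p in 𝓝 (0 : ℂ × ℂ), P p) :
    ∀ᶠ x in 𝓝 (0 : ℂ), ∀ᶠ y in 𝓝 (0 : ℂ), P (x, y) := by
  have : ∀ᶠ p in 𝓝 (0 : ℂ) ×ˢ 𝓝 (0 : ℂ), P p := by rw [← nhds_prod_eq]; exact h
  exact this.curry

theorem analyticAt_slice {f : ℂ × ℂ → ℂ} (hf : AnalyticAt ℂ f 0) :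
    ∀ᶠ x in 𝓝 (0 : ℂ), AnalyticAt ℂ (fun y => f (x, y)) 0 := by
  have h := hf.eventually_analyticAt
  refine (eventually_slice h).mono fun x hx => ?_
  exact hx.self_of_nhds.comp (analyticAt_const.prod analyticAt_id)

/-- Induction on `j`, replacing `f` by its partial derivative in `y`, which is again analytic at
`0`; the two agree only on slices with `x` near `0`, which is enough for a germ. -/
theorem analyticAt_iteratedDeriv_slice (j : ℕ) : ∀ {f : ℂ × ℂ → ℂ}, AnalyticAt ℂ f 0 →
    AnalyticAt ℂ (fun x => iteratedDeriv j (fun y => f (x, y)) 0) 0 := by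
  induction j with
  | zero =>
    intro f hf
    simp only [iteratedDeriv_zero]
    exact AnalyticAt.comp (g := f) (f := fun x : ℂ => (x, (0 : ℂ))) hf
      (analyticAt_id.prod analyticAt_const)
  | succ j ih =>
    intro f hf
    have hg : AnalyticAt ℂ (fun p => fderiv ℂ f p (0, 1)) 0 :=
      ((ContinuousLinearMap.apply ℂ ℂ ((0, 1) : ℂ × ℂ)).analyticAt _).comp hf.fderiv
    refine (ih hg).congr ?_
    refine (eventually_slice hf.eventually_analyticAt).mono fun x hx => ?_
    simp only [iteratedDeriv_succ']
    refine Filter.EventuallyEq.iteratedDeriv_eq _ (hx.mono fun y hy => ?_)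
    have h1 : HasDerivAt (fun y : ℂ => (x, y)) ((0 : ℂ), (1 : ℂ)) y :=
      (hasDerivAt_const y x).prodMk (hasDerivAt_id y)
    exact (hy.differentiableAt.hasFDerivAt.comp_hasDerivAt y h1).deriv.symm

theorem analyticAt_sliceCoeff {f : ℂ × ℂ → ℂ} (hf : AnalyticAt ℂ f 0) (j : ℕ) :
    AnalyticAt ℂ (sliceCoeff f j) 0 := by
  have : sliceCoeff f j =
      fun x => iteratedDeriv j (fun y : ℂ => f (x, y)) 0 / (j.factorial : ℂ) := by
    ext x; rw [sliceCoeff, coeff_taylor1]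
  rw [this]
  exact (analyticAt_iteratedDeriv_slice j hf).div_const

theorem taylor_congr {f g : ℂ × ℂ → ℂ} (h : f =ᶠ[𝓝 0] g) : taylor f = taylor g := by
  ext n
  rw [coeff_taylor, coeff_taylor]
  congr 1
  refine taylor1_congr ((eventually_slice h).mono fun x hx => ?_)
  rw [sliceCoeff, sliceCoeff, taylor1_congr hx]

theorem taylor_add {f g : ℂ × ℂ → ℂ} (hf : AnalyticAt ℂ f 0) (hg : AnalyticAt ℂ g 0) :
    taylor (fun p => f p + g p) = taylor f + taylor g := by
  ext n
  rw [map_add, coeff_taylor, coeff_taylor, coeff_taylor, ← map_add,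
    ← taylor1_add (analyticAt_sliceCoeff hf _) (analyticAt_sliceCoeff hg _)]
  congr 1
  refine taylor1_congr ?_
  filter_upwards [analyticAt_slice hf, analyticAt_slice hg] with x h1 h2
  rw [sliceCoeff, taylor1_add h1 h2, map_add]; rfl

theorem taylor_const (c : ℂ) : taylor (fun _ => c) = MvPowerSeries.C c := by
  ext n
  rw [coeff_taylor, MvPowerSeries.coeff_C]
  have : sliceCoeff (fun _ => c) (n 1) = fun _ => if n 1 = 0 then c else 0 := by
    ext x; rw [sliceCoeff, taylor1_const, PowerSeries.coeff_C]
  rw [this, taylor1_const, PowerSeries.coeff_C]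
  have h2 : n = 0 ↔ n 0 = 0 ∧ n 1 = 0 := by
    rw [Finsupp.ext_iff]; simp [Fin.forall_fin_two]
  by_cases h0 : n 0 = 0 <;> by_cases h1 : n 1 = 0 <;> simp [h0, h1, h2]

theorem coeff_X_mul_ite (i : Fin 2) (f : Series2) (n : Fin 2 →₀ ℕ) :
    MvPowerSeries.coeff n (MvPowerSeries.X i * f) =
      if n i = 0 then 0 else MvPowerSeries.coeff (n - Finsupp.single i 1) f := by
  classical
  rw [MvPowerSeries.X, MvPowerSeries.coeff_monomial_mul, one_mul]
  simp only [Finsupp.single_le_iff, Nat.one_le_iff_ne_zero, ite_not]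

theorem coeff_X_mul_ite' (f : PowerSeries ℂ) (n : ℕ) :
    PowerSeries.coeff n (PowerSeries.X * f) =
      if n = 0 then 0 else PowerSeries.coeff (n - 1) f := by
  rcases n with _ | n
  · simp
  · simp [PowerSeries.coeff_succ_X_mul]

theorem taylor_fst_mul {f : ℂ × ℂ → ℂ} (hf : AnalyticAt ℂ f 0) :
    taylor (fun p => p.1 * f p) = X₀ * taylor f := by
  ext n
  rw [X₀, coeff_X_mul_ite, coeff_taylor, coeff_taylor]
  have : taylor1 (sliceCoeff (fun p => p.1 * f p) (n 1)) =
      PowerSeries.X * taylor1 (sliceCoeff f (n 1)) := by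
    rw [← taylor1_id, ← taylor1_mul analyticAt_var (analyticAt_sliceCoeff hf _)]
    refine taylor1_congr ?_
    filter_upwards [analyticAt_slice hf] with x h1
    rw [sliceCoeff, taylor1_const_mul h1, PowerSeries.coeff_C_mul]; rfl
  rw [this, coeff_X_mul_ite']
  simp

theorem taylor_snd_mul {f : ℂ × ℂ → ℂ} (hf : AnalyticAt ℂ f 0) :
    taylor (fun p => p.2 * f p) = X₁ * taylor f := by
  ext n
  rw [X₁, coeff_X_mul_ite, coeff_taylor, coeff_taylor]
  have : taylor1 (sliceCoeff (fun p => p.2 * f p) (n 1)) =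
      if n 1 = 0 then 0 else taylor1 (sliceCoeff f (n 1 - 1)) := by
    have h : ∀ᶠ x in 𝓝 0, sliceCoeff (fun p => p.2 * f p) (n 1) x =
        if n 1 = 0 then 0 else sliceCoeff f (n 1 - 1) x := by
      filter_upwards [analyticAt_slice hf] with x h1
      rw [sliceCoeff, taylor1_mul analyticAt_var h1, taylor1_id, coeff_X_mul_ite']; rfl
    rw [taylor1_congr h]
    split_ifs
    · rw [taylor1_const, map_zero]
    · rfl
  rw [this]
  split_ifs
  · simp
  · simp

/-- Hadamard's lemma. -/
theorem exists_eq_add_clm {f : ℂ × ℂ → ℂ} (hf : AnalyticAt ℂ f 0) :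
    ∃ M : ℂ × ℂ → (ℂ × ℂ →L[ℂ] ℂ), AnalyticAt ℂ M 0 ∧
      ∀ᶠ p in 𝓝 (0 : ℂ × ℂ), f p = f 0 + M p p := by
  obtain ⟨q, r, hr⟩ := hf
  have hrad : 0 < q.shift.radius := by
    rw [FormalMultilinearSeries.radius_shift]; exact hr.r_pos.trans_le hr.r_le
  -- Each term of positive degree of the power series is linear in its last argument; the shifted
  -- series leaves that argument free, and its sum is the required family of linear forms.
  refine ⟨q.shift.sum, (q.shift.hasFPowerSeriesOnBall hrad).analyticAt, ?_⟩
  have h1 : ∀ᶠ p in 𝓝 (0 : ℂ × ℂ), p ∈ Metric.eball (0 : ℂ × ℂ) r :=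
    Metric.eball_mem_nhds _ hr.r_pos
  have h2 : ∀ᶠ p in 𝓝 (0 : ℂ × ℂ), p ∈ Metric.eball (0 : ℂ × ℂ) q.shift.radius :=
    Metric.eball_mem_nhds _ hrad
  filter_upwards [h1, h2] with p hp1 hp2
  have e1 := hr.hasSum hp1
  have e2 := (q.shift.hasFPowerSeriesOnBall hrad).hasSum hp2
  rw [zero_add] at e1 e2
  have e3 := e2.mapL (ContinuousLinearMap.apply ℂ ℂ p)
  have e4 : HasSum (fun n => q (n + 1) fun _ => p) (q.shift.sum p p) := by
    have e7 : (fun n => q (n + 1) fun _ => p) =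
        fun n => ContinuousLinearMap.apply ℂ ℂ p ((q.shift n) fun _ => p) := by
      ext n
      simp only [FormalMultilinearSeries.shift, ContinuousLinearMap.apply_apply,
        ContinuousMultilinearMap.curryRight_apply]
      congr 1
      ext i : 1
      refine Fin.lastCases ?_ (fun i => ?_) i <;> simp
    rw [e7]
    exact e3
  have e5 := (hasSum_nat_add_iff' 1).2 e1
  rw [Finset.sum_range_one] at e5
  have e6 := e5.unique e4
  rw [← e6, hr.coeff_zero]
  ring

theorem exists_eq_add_fst_mul_add_snd_mul {f : ℂ × ℂ → ℂ} (hf : AnalyticAt ℂ f 0) :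
    ∃ f₁ f₂ : ℂ × ℂ → ℂ, AnalyticAt ℂ f₁ 0 ∧ AnalyticAt ℂ f₂ 0 ∧
      ∀ᶠ p in 𝓝 (0 : ℂ × ℂ), f p = f 0 + (p.1 * f₁ p + p.2 * f₂ p) := by
  obtain ⟨M, hM, h⟩ := exists_eq_add_clm hf
  have hMv : ∀ v : ℂ × ℂ, AnalyticAt ℂ (fun p => M p v) 0 := fun v =>
    ((ContinuousLinearMap.apply ℂ ℂ v).analyticAt _).comp hM
  refine ⟨fun p => M p (1, 0), fun p => M p (0, 1), hMv _, hMv _, h.mono fun p hp => ?_⟩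
  rw [hp]
  congr 1
  have : p = p.1 • ((1 : ℂ), (0 : ℂ)) + p.2 • ((0 : ℂ), (1 : ℂ)) := by ext <;> simp
  conv_lhs => rw [this, map_add, map_smul, map_smul, smul_eq_mul, smul_eq_mul, ← this]

/-- A map on functions that is compatible with Hadamard's lemma and kills constants vanishes. -/
theorem eq_zero_of_hadamard {σ : Type*} {D : (ℂ × ℂ → ℂ) → MvPowerSeries σ ℂ}
    {a b : MvPowerSeries σ ℂ} (ha : MvPowerSeries.constantCoeff a = 0)
    (hb : MvPowerSeries.constantCoeff b = 0)
    (hD : ∀ (f f₁ f₂ : ℂ × ℂ → ℂ), AnalyticAt ℂ f₁ 0 → AnalyticAt ℂ f₂ 0 →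
      (f =ᶠ[𝓝 0] fun p => f 0 + (p.1 * f₁ p + p.2 * f₂ p)) → D f = a * D f₁ + b * D f₂)
    {f : ℂ × ℂ → ℂ} (hf : AnalyticAt ℂ f 0) : D f = 0 := by
  -- Every use of Hadamard's lemma gains one in the order, as `a` and `b` have no constant term. The
  -- induction is over all `f` at once, because `f₁` and `f₂` are new functions.
  have key : ∀ N : ℕ, ∀ f : ℂ × ℂ → ℂ, AnalyticAt ℂ f 0 → (N : ℕ∞) ≤ (D f).order := by
    intro N
    induction N with
    | zero => intro f _; simp
    | succ N ih =>
      intro f hf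
      obtain ⟨f₁, f₂, h1, h2, h⟩ := exists_eq_add_fst_mul_add_snd_mul hf
      rw [hD f f₁ f₂ h1 h2 h]
      have aux : ∀ (c g : MvPowerSeries σ ℂ), MvPowerSeries.constantCoeff c = 0 →
          (N : ℕ∞) ≤ g.order → ((N + 1 : ℕ) : ℕ∞) ≤ (c * g).order := by
        intro c g hc hg
        refine le_trans ?_ MvPowerSeries.le_order_mul
        have := MvPowerSeries.one_le_order_iff_constCoeff_eq_zero.2 hc
        rw [Nat.cast_add, Nat.cast_one, add_comm]
        exact add_le_add this hg
      exact (le_min (aux _ _ ha (ih f₁ h1)) (aux _ _ hb (ih f₂ h2))).trans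
        MvPowerSeries.min_order_le_add
  rw [← MvPowerSeries.order_eq_top_iff, ENat.eq_top_iff_forall_ge]
  exact fun N => key N f hf

theorem taylor_hadamard {f f₁ f₂ : ℂ × ℂ → ℂ} (h1 : AnalyticAt ℂ f₁ 0) (h2 : AnalyticAt ℂ f₂ 0)
    (h : f =ᶠ[𝓝 0] fun p => f 0 + (p.1 * f₁ p + p.2 * f₂ p)) :
    taylor f = MvPowerSeries.C (f 0) + (X₀ * taylor f₁ + X₁ * taylor f₂) := by
  have h3 : AnalyticAt ℂ (fun p : ℂ × ℂ => p.1 * f₁ p) 0 := analyticAt_fst.mul h1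
  have h4 : AnalyticAt ℂ (fun p : ℂ × ℂ => p.2 * f₂ p) 0 := analyticAt_snd.mul h2
  rw [taylor_congr h, taylor_add analyticAt_const (h3.fun_add h4), taylor_add h3 h4,
    taylor_fst_mul h1, taylor_snd_mul h2, taylor_const]

theorem constantCoeff_taylor (f : ℂ × ℂ → ℂ) :
    MvPowerSeries.constantCoeff (taylor f) = f 0 := by
  rw [← MvPowerSeries.coeff_zero_eq_constantCoeff_apply, coeff_taylor]
  simp [constantCoeff_taylor1, sliceCoeff, ← Prod.zero_eq_mk]

/-- For fixed `g`, the defect of multiplicativity kills constants and is compatible with Hadamard's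
lemma, hence vanishes; this replaces a Leibniz formula in two variables. -/
theorem taylor_mul {f g : ℂ × ℂ → ℂ} (hf : AnalyticAt ℂ f 0) (hg : AnalyticAt ℂ g 0) :
    taylor (fun p => f p * g p) = taylor f * taylor g := by
  rw [← sub_eq_zero]
  refine eq_zero_of_hadamard (D := fun f => taylor (fun p => f p * g p) - taylor f * taylor g)
    (a := X₀) (b := X₁) (by simp [X₀]) (by simp [X₁]) ?_ hf
  intro f f₁ f₂ h1 h2 h
  have h3 : AnalyticAt ℂ (fun p : ℂ × ℂ => p.1 * (f₁ p * g p)) 0 := analyticAt_fst.mul (h1.mul hg)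
  have h4 : AnalyticAt ℂ (fun p : ℂ × ℂ => p.2 * (f₂ p * g p)) 0 := analyticAt_snd.mul (h2.mul hg)
  have h5 : (fun p => f p * g p) =ᶠ[𝓝 0]
      fun p => f 0 * g p + (p.1 * (f₁ p * g p) + p.2 * (f₂ p * g p)) := by
    filter_upwards [h] with p hp
    rw [hp]; ring
  have h6 : taylor (fun p => f 0 * g p) = MvPowerSeries.C (f 0) * taylor g := by
    ext n
    rw [coeff_taylor, MvPowerSeries.coeff_C_mul, coeff_taylor, ← PowerSeries.coeff_C_mul,
      ← taylor1_const_mul (analyticAt_sliceCoeff hg _)]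
    congr 1
    refine taylor1_congr ?_
    filter_upwards [analyticAt_slice hg] with x hx
    rw [sliceCoeff, taylor1_const_mul hx, PowerSeries.coeff_C_mul]; rfl
  rw [taylor_congr h5, taylor_add (analyticAt_const.fun_mul hg) (h3.fun_add h4), taylor_add h3 h4,
    taylor_fst_mul (h1.fun_mul hg), taylor_snd_mul (h2.fun_mul hg), taylor_hadamard h1 h2 h, h6]
  ring

theorem taylor_fst : taylor (fun p => p.1) = X₀ := by
  have := taylor_fst_mul (f := fun _ => 1) analyticAt_const
  rw [taylor_const, map_one, mul_one] at this
  simpa using this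

theorem taylor_snd : taylor (fun p => p.2) = X₁ := by
  have := taylor_snd_mul (f := fun _ => 1) analyticAt_const
  rw [taylor_const, map_one, mul_one] at this
  simpa using this

theorem taylor_pow {f : ℂ × ℂ → ℂ} (hf : AnalyticAt ℂ f 0) (k : ℕ) :
    taylor (fun p => f p ^ k) = taylor f ^ k := by
  induction k with
  | zero => simpa using taylor_const 1
  | succ k ih => simp only [pow_succ]; rw [taylor_mul (hf.fun_pow k) hf, ih]

theorem taylor_sub {f g : ℂ × ℂ → ℂ} (hf : AnalyticAt ℂ f 0) (hg : AnalyticAt ℂ g 0) :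
    taylor (fun p => f p - g p) = taylor f - taylor g := by
  rw [eq_sub_iff_add_eq, ← taylor_add (hf.fun_sub hg) hg]
  simp

theorem taylor_prod {ι : Type*} (s : Finset ι) {f : ι → ℂ × ℂ → ℂ}
    (hf : ∀ i, AnalyticAt ℂ (f i) 0) :
    taylor (fun p => ∏ i ∈ s, f i p) = ∏ i ∈ s, taylor (f i) := by
  classical
  induction s using Finset.induction_on with
  | empty => simpa using taylor_const 1
  | insert i s hi ih =>
    simp only [Finset.prod_insert hi]
    rw [taylor_mul (hf i) (Finset.analyticAt_fun_prod _ fun i _ => hf i), ih]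

/-! ### Taylor series of compositions -/

/-- The Taylor series of the components of an analytic arc. -/
def taylorArc (γ : ℂ → ℂ × ℂ) : Fin 2 → PowerSeries ℂ :=
  ![taylor1 fun s => (γ s).1, taylor1 fun s => (γ s).2]

theorem hasSubst_of_zero {τ : Type*} {a : Fin 2 → MvPowerSeries τ ℂ}
    (h : ∀ i, MvPowerSeries.constantCoeff (a i) = 0) : MvPowerSeries.HasSubst a :=
  MvPowerSeries.hasSubst_of_constantCoeff_zero h

theorem constantCoeff_taylorArc {γ : ℂ → ℂ × ℂ} (h0 : γ 0 = 0) (i : Fin 2) :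
    PowerSeries.constantCoeff (taylorArc γ i) = 0 := by
  fin_cases i <;> simp [taylorArc, constantCoeff_taylor1, h0]

theorem constantCoeff_taylorMap {G : ℂ × ℂ → ℂ × ℂ} (h0 : G 0 = 0) (i : Fin 2) :
    MvPowerSeries.constantCoeff (taylorMap G i) = 0 := by
  fin_cases i <;> simp [taylorMap, constantCoeff_taylor, h0]

theorem subst_hadamard {τ : Type*} {a : Fin 2 → MvPowerSeries τ ℂ} (ha : MvPowerSeries.HasSubst a)
    (c : ℂ) (f g : Series2) :
    MvPowerSeries.subst a (MvPowerSeries.C c + (X₀ * f + X₁ * g)) =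
      MvPowerSeries.C c + (a 0 * MvPowerSeries.subst a f + a 1 * MvPowerSeries.subst a g) := by
  rw [MvPowerSeries.subst_add ha, MvPowerSeries.subst_add ha, MvPowerSeries.subst_mul ha,
    MvPowerSeries.subst_mul ha, X₀, X₁, MvPowerSeries.subst_X ha, MvPowerSeries.subst_X ha,
    MvPowerSeries.subst_C]

/-- As for products: the defect is a function of `f` to which `eq_zero_of_hadamard` applies, with
the components of the arc as multipliers; they have no constant term because `γ 0 = 0`. -/
theorem taylor1_comp {f : ℂ × ℂ → ℂ} (hf : AnalyticAt ℂ f 0) {γ : ℂ → ℂ × ℂ}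
    (hγ : AnalyticAt ℂ γ 0) (h0 : γ 0 = 0) :
    taylor1 (fun s => f (γ s)) = evalArc (taylorArc γ) (taylor f) := by
  have hγ1 : AnalyticAt ℂ (fun s => (γ s).1) 0 :=
    analyticAt_fst.comp hγ
  have hγ2 : AnalyticAt ℂ (fun s => (γ s).2) 0 :=
    analyticAt_snd.comp hγ
  have hs := hasSubst_of_zero (τ := Unit) (constantCoeff_taylorArc h0)
  rw [← sub_eq_zero]
  refine eq_zero_of_hadamard (σ := Unit)
    (D := fun f => taylor1 (fun s => f (γ s)) - evalArc (taylorArc γ) (taylor f))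
    (a := taylorArc γ 0) (b := taylorArc γ 1) (constantCoeff_taylorArc h0 0)
    (constantCoeff_taylorArc h0 1) ?_ hf
  intro f f₁ f₂ h1 h2 h
  have hc : ∀ {g : ℂ × ℂ → ℂ}, AnalyticAt ℂ g 0 → AnalyticAt ℂ (fun s => g (γ s)) 0 :=
    fun hg => AnalyticAt.fun_comp (by rwa [h0]) hγ
  have h5 : (fun s => f (γ s)) =ᶠ[𝓝 0]
      fun s => f 0 + ((γ s).1 * f₁ (γ s) + (γ s).2 * f₂ (γ s)) :=
    (show Tendsto γ (𝓝 0) (𝓝 0) by simpa [h0] using hγ.continuousAt.tendsto).eventually h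
  rw [taylor1_congr h5, taylor1_add analyticAt_const
      ((hγ1.fun_mul (hc h1)).fun_add (hγ2.fun_mul (hc h2))),
    taylor1_add (hγ1.fun_mul (hc h1)) (hγ2.fun_mul (hc h2)), taylor1_mul hγ1 (hc h1),
    taylor1_mul hγ2 (hc h2), taylor1_const, taylor_hadamard h1 h2 h, evalArc, subst_hadamard hs]
  change PowerSeries.C (f 0) + (taylorArc γ 0 * _ + taylorArc γ 1 * _) -
    (PowerSeries.C (f 0) + _) = _
  unfold evalArc
  ring

theorem taylor_comp {f : ℂ × ℂ → ℂ} (hf : AnalyticAt ℂ f 0) {G : ℂ × ℂ → ℂ × ℂ}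
    (hG : AnalyticAt ℂ G 0) (h0 : G 0 = 0) :
    taylor (fun p => f (G p)) = MvPowerSeries.subst (taylorMap G) (taylor f) := by
  have hG1 : AnalyticAt ℂ (fun s => (G s).1) 0 :=
    analyticAt_fst.comp hG
  have hG2 : AnalyticAt ℂ (fun s => (G s).2) 0 :=
    analyticAt_snd.comp hG
  have hs := hasSubst_of_zero (constantCoeff_taylorMap h0)
  rw [← sub_eq_zero]
  refine eq_zero_of_hadamard
    (D := fun f => taylor (fun s => f (G s)) - MvPowerSeries.subst (taylorMap G) (taylor f))
    (a := taylorMap G 0) (b := taylorMap G 1) (constantCoeff_taylorMap h0 0)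
    (constantCoeff_taylorMap h0 1) ?_ hf
  intro f f₁ f₂ h1 h2 h
  have hc : ∀ {g : ℂ × ℂ → ℂ}, AnalyticAt ℂ g 0 → AnalyticAt ℂ (fun s => g (G s)) 0 :=
    fun hg => AnalyticAt.fun_comp (by rwa [h0]) hG
  have h5 : (fun s => f (G s)) =ᶠ[𝓝 0]
      fun s => f 0 + ((G s).1 * f₁ (G s) + (G s).2 * f₂ (G s)) :=
    (show Tendsto G (𝓝 0) (𝓝 0) by simpa [h0] using hG.continuousAt.tendsto).eventually h
  rw [taylor_congr h5, taylor_add analyticAt_const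
      ((hG1.fun_mul (hc h1)).fun_add (hG2.fun_mul (hc h2))),
    taylor_add (hG1.fun_mul (hc h1)) (hG2.fun_mul (hc h2)), taylor_mul hG1 (hc h1),
    taylor_mul hG2 (hc h2), taylor_const, taylor_hadamard h1 h2 h, subst_hadamard hs]
  change MvPowerSeries.C (f 0) + (taylorMap G 0 * _ + taylorMap G 1 * _) -
    (MvPowerSeries.C (f 0) + _) = _
  ring

/-! ### Substitution in formal power series -/

theorem hasSubst_one {a : PowerSeries ℂ} (h : PowerSeries.constantCoeff a = 0) :
    PowerSeries.HasSubst a := PowerSeries.HasSubst.of_constantCoeff_zero' h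

theorem eq_zero_of_X_pow_dvd {f : PowerSeries ℂ} (h : ∀ N, PowerSeries.X ^ N ∣ f) : f = 0 := by
  ext n
  rw [PowerSeries.X_pow_dvd_iff.1 (h (n + 1)) n (Nat.lt_succ_self n), map_zero]

/-- Substitution is continuous for the `X`-adic topology: modulo `X ^ N` the monomials in `α` and in
`β` coincide, and a coefficient of a substitution is a finite sum of coefficients of such monomials.
-/
theorem X_pow_dvd_subst_sub {σ : Type*} [Finite σ] {α β : σ → PowerSeries ℂ}
    (hα : ∀ i, PowerSeries.constantCoeff (α i) = 0)
    (hβ : ∀ i, PowerSeries.constantCoeff (β i) = 0) {N : ℕ}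
    (h : ∀ i, PowerSeries.X ^ N ∣ α i - β i) (f : MvPowerSeries σ ℂ) :
    (PowerSeries.X ^ N : PowerSeries ℂ) ∣
      MvPowerSeries.subst (τ := Unit) α f - MvPowerSeries.subst (τ := Unit) β f := by
  have sα : MvPowerSeries.HasSubst (τ := Unit) α :=
    MvPowerSeries.hasSubst_of_constantCoeff_zero hα
  have sβ : MvPowerSeries.HasSubst (τ := Unit) β :=
    MvPowerSeries.hasSubst_of_constantCoeff_zero hβ
  have hprod : ∀ d : σ →₀ ℕ, (PowerSeries.X ^ N : PowerSeries ℂ) ∣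
      (d.prod fun s e => α s ^ e) - (d.prod fun s e => β s ^ e) := by
    intro d
    rw [← Ideal.mem_span_singleton, ← Ideal.Quotient.eq, map_finsuppProd, map_finsuppProd]
    refine Finsupp.prod_congr fun i _ => ?_
    rw [map_pow, map_pow, (Ideal.Quotient.eq).2 (Ideal.mem_span_singleton.2 (h i))]
  rw [PowerSeries.X_pow_dvd_iff]
  intro m hm
  rw [map_sub, sub_eq_zero, PowerSeries.coeff, MvPowerSeries.coeff_subst sα,
    MvPowerSeries.coeff_subst sβ]
  refine finsum_congr fun d => ?_
  congr 1
  have := PowerSeries.X_pow_dvd_iff.1 (hprod d) m hm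
  rw [map_sub, sub_eq_zero] at this
  exact this

theorem X_pow_dvd_evalArc_sub {α β : Fin 2 → PowerSeries ℂ}
    (hα : ∀ i, PowerSeries.constantCoeff (α i) = 0)
    (hβ : ∀ i, PowerSeries.constantCoeff (β i) = 0) {N : ℕ}
    (h : ∀ i, PowerSeries.X ^ N ∣ α i - β i) (f : Series2) :
    PowerSeries.X ^ N ∣ evalArc α f - evalArc β f :=
  X_pow_dvd_subst_sub hα hβ h f

theorem X_pow_dvd_subst1_sub {α β : PowerSeries ℂ} (hα : PowerSeries.constantCoeff α = 0)
    (hβ : PowerSeries.constantCoeff β = 0) {N : ℕ} (h : PowerSeries.X ^ N ∣ α - β)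
    (f : PowerSeries ℂ) :
    PowerSeries.X ^ N ∣ PowerSeries.subst α f - PowerSeries.subst β f :=
  X_pow_dvd_subst_sub (σ := Unit) (fun _ => hα) (fun _ => hβ) (fun _ => h) f

theorem subst1_X {a : PowerSeries ℂ} (h : PowerSeries.constantCoeff a = 0) :
    PowerSeries.subst a (PowerSeries.X : PowerSeries ℂ) = a := PowerSeries.subst_X (hasSubst_one h)

theorem subst1_C {a : PowerSeries ℂ} (c : ℂ) :
    PowerSeries.subst a (PowerSeries.C c : PowerSeries ℂ) = PowerSeries.C c :=
  PowerSeries.subst_C c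

theorem constantCoeff_subst1 {a f : PowerSeries ℂ} (ha : PowerSeries.constantCoeff a = 0)
    (hf : PowerSeries.constantCoeff f = 0) :
    PowerSeries.constantCoeff (PowerSeries.subst a f) = 0 :=
  PowerSeries.constantCoeff_subst_eq_zero ha f hf

theorem coeff_one_subst1 {a f : PowerSeries ℂ} (ha : PowerSeries.constantCoeff a = 0) :
    PowerSeries.coeff 1 (PowerSeries.subst a f) = PowerSeries.coeff 1 f * PowerSeries.coeff 1 a := by
  obtain ⟨g, hg⟩ : PowerSeries.X ∣ f - PowerSeries.C (PowerSeries.constantCoeff f) := by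
    rw [PowerSeries.X_dvd_iff]; simp
  rw [sub_eq_iff_eq_add] at hg
  have sa := hasSubst_one ha
  have e : PowerSeries.coeff 1 f = PowerSeries.constantCoeff g := by
    conv_lhs => rw [hg]
    rw [map_add, show (1 : ℕ) = 0 + 1 from rfl, PowerSeries.coeff_succ_X_mul]
    simp
  rw [e, hg, PowerSeries.subst_add sa, PowerSeries.subst_mul sa, subst1_X ha, subst1_C]
  obtain ⟨b, rfl⟩ := PowerSeries.X_dvd_iff.2 ha
  obtain ⟨k, hk⟩ : PowerSeries.X ∣ g - PowerSeries.C (PowerSeries.constantCoeff g) := by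
    rw [PowerSeries.X_dvd_iff]; simp
  rw [sub_eq_iff_eq_add] at hk
  rw [map_add, mul_assoc, show (1 : ℕ) = 0 + 1 from rfl, PowerSeries.coeff_succ_X_mul,
    PowerSeries.coeff_succ_X_mul]
  conv_lhs => rw [hk, PowerSeries.subst_add sa, PowerSeries.subst_mul sa, subst1_X ha, subst1_C]
  simp [mul_comm]

theorem taylor1_comp1 {u ψ : ℂ → ℂ} (hu : AnalyticAt ℂ u 0) (hψ : AnalyticAt ℂ ψ 0)
    (h0 : ψ 0 = 0) :
    taylor1 (fun s => u (ψ s)) = PowerSeries.subst (taylor1 ψ) (taylor1 u) := by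
  have hc0 : PowerSeries.constantCoeff (taylor1 ψ) = 0 := by rw [constantCoeff_taylor1, h0]
  have sψ := hasSubst_one hc0
  rw [← sub_eq_zero]
  refine eq_zero_of_X_pow_dvd fun N => ?_
  induction N generalizing u with
  | zero => simp
  | succ N ih =>
    obtain ⟨v, hv, h⟩ := exists_eq_add_mul hu
    have hvψ : AnalyticAt ℂ (fun s => v (ψ s)) 0 := AnalyticAt.fun_comp (by rwa [h0]) hψ
    have h5 : (fun s => u (ψ s)) =ᶠ[𝓝 0] fun s => u 0 + ψ s * v (ψ s) :=
      (show Tendsto ψ (𝓝 0) (𝓝 0) by simpa [h0] using hψ.continuousAt.tendsto).eventually h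
    rw [taylor1_congr h5, taylor1_add analyticAt_const (hψ.fun_mul hvψ), taylor1_mul hψ hvψ,
      taylor1_congr h, taylor1_add analyticAt_const (analyticAt_var.fun_mul hv),
      taylor1_mul analyticAt_var hv, PowerSeries.subst_add sψ, PowerSeries.subst_mul sψ,
      taylor1_id, subst1_X hc0, taylor1_const, subst1_C, add_sub_add_left_eq_sub, ← mul_sub,
      pow_succ']
    exact mul_dvd_mul (PowerSeries.X_dvd_iff.2 hc0) (ih hv)

/-- Composition of formal arcs with formal changes of parameter. -/
theorem evalArc_subst {γ : Fin 2 → PowerSeries ℂ}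
    (hγ : ∀ i, PowerSeries.constantCoeff (γ i) = 0) {τ : PowerSeries ℂ}
    (hτ : PowerSeries.constantCoeff τ = 0) (h : Series2) :
    evalArc (fun i => PowerSeries.subst τ (γ i)) h = PowerSeries.subst τ (evalArc γ h) := by
  unfold evalArc PowerSeries.subst
  rw [MvPowerSeries.subst_comp_subst_apply (hasSubst_of_zero hγ)]
  exact (hasSubst_one hτ).const

theorem subst1_subst1 {a b f : PowerSeries ℂ} (ha : PowerSeries.constantCoeff a = 0)
    (hb : PowerSeries.constantCoeff b = 0) :
    PowerSeries.subst b (PowerSeries.subst a f) = PowerSeries.subst (PowerSeries.subst b a) f :=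
  PowerSeries.subst_comp_subst_apply (hasSubst_one ha) (hasSubst_one hb) f

theorem evalArc_mapSubst {a : Fin 2 → Series2}
    (ha : ∀ i, MvPowerSeries.constantCoeff (a i) = 0) {γ : Fin 2 → PowerSeries ℂ}
    (hγ : ∀ i, PowerSeries.constantCoeff (γ i) = 0) (h : Series2) :
    evalArc γ (MvPowerSeries.subst a h) = evalArc (fun i => evalArc γ (a i)) h := by
  unfold evalArc
  rw [MvPowerSeries.subst_comp_subst_apply (hasSubst_of_zero ha) (hasSubst_of_zero (τ := Unit) hγ)]

/-- Substitution of a nonzero series is injective. -/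
theorem subst1_eq_zero_iff {τ g : PowerSeries ℂ} (hτ : PowerSeries.constantCoeff τ = 0)
    (hτ0 : τ ≠ 0) : PowerSeries.subst τ g = 0 ↔ g = 0 := by
  have sτ := hasSubst_one hτ
  constructor
  · intro h
    by_contra hg
    -- Write `g` as a power of `X` times a unit. Substitution maps the unit to a unit and the power
    -- of `X` to a power of `τ ≠ 0`.
    have h1 := PowerSeries.X_pow_order_mul_divXPowOrder (f := g)
    set u := g.divXPowOrder
    have hu : IsUnit u := by
      rw [PowerSeries.isUnit_iff_constantCoeff, isUnit_iff_ne_zero]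
      simpa [u, PowerSeries.constantCoeff_divXPowOrder_eq_zero_iff] using hg
    rw [← h1, PowerSeries.subst_mul sτ, PowerSeries.subst_pow sτ, subst1_X hτ] at h
    have hu2 : IsUnit (PowerSeries.subst τ u) := by
      rw [← PowerSeries.coe_substAlgHom sτ]; exact hu.map _
    rcases mul_eq_zero.1 h with h | h
    · exact hτ0 (eq_zero_of_pow_eq_zero h)
    · exact hu2.ne_zero h
  · rintro rfl
    rw [← PowerSeries.coe_substAlgHom sτ, map_zero]

/-! ### Linearization -/

/-- First-order expansion of `θ` at `ψ`: the part of `θ` of degree at least two contributes only to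
degree `n + 3` and above, since `ψ` has no constant term. It gives the effect of correcting one
coefficient in the linearization. -/
theorem coeff_subst1_add_monomial {θ ψ : PowerSeries ℂ} (hψ : PowerSeries.constantCoeff ψ = 0)
    (c : ℂ) (n : ℕ) :
    PowerSeries.X ^ (n + 3) ∣ PowerSeries.subst (ψ + PowerSeries.C c * PowerSeries.X ^ (n + 2)) θ -
      (PowerSeries.subst ψ θ +
        PowerSeries.C (c * PowerSeries.coeff 1 θ) * PowerSeries.X ^ (n + 2)) := by
  set a := ψ + PowerSeries.C c * PowerSeries.X ^ (n + 2) with ha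
  have ha0 : PowerSeries.constantCoeff a = 0 := by simp [ha, hψ]
  have sa := hasSubst_one ha0
  have sψ := hasSubst_one hψ
  obtain ⟨η, hη⟩ : PowerSeries.X ^ 2 ∣ θ - (PowerSeries.C (PowerSeries.constantCoeff θ) +
      PowerSeries.C (PowerSeries.coeff 1 θ) * PowerSeries.X) := by
    rw [PowerSeries.X_pow_dvd_iff]
    intro m hm
    interval_cases m <;> simp [PowerSeries.coeff_C]
  rw [sub_eq_iff_eq_add] at hη
  have key : ∀ b : PowerSeries ℂ, PowerSeries.constantCoeff b = 0 → PowerSeries.subst b θ =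
      b ^ 2 * PowerSeries.subst b η + (PowerSeries.C (PowerSeries.constantCoeff θ) +
      PowerSeries.C (PowerSeries.coeff 1 θ) * b) := by
    intro b hb
    have sb := hasSubst_one hb
    conv_lhs => rw [hη]
    rw [PowerSeries.subst_add sb, PowerSeries.subst_add sb, PowerSeries.subst_mul sb,
      PowerSeries.subst_mul sb, PowerSeries.subst_pow sb, subst1_X hb, subst1_C, subst1_C]
  obtain ⟨a', ha'⟩ := PowerSeries.X_dvd_iff.2 ha0
  obtain ⟨ψ', hψ'⟩ := PowerSeries.X_dvd_iff.2 hψ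
  have hd : PowerSeries.X ^ (n + 2) ∣ a - ψ := ⟨PowerSeries.C c, by rw [ha]; ring⟩
  obtain ⟨w, hw⟩ := X_pow_dvd_subst1_sub ha0 hψ hd η
  rw [sub_eq_iff_eq_add] at hw
  rw [key a ha0, key ψ hψ, hw]
  refine ⟨PowerSeries.C c * (a' + ψ') * PowerSeries.subst ψ η + PowerSeries.X * a' ^ 2 * w, ?_⟩
  have e1 : a ^ 2 = ψ ^ 2 + PowerSeries.C c * PowerSeries.X ^ (n + 3) * (a' + ψ') := by
    have : a ^ 2 = ψ ^ 2 + (a - ψ) * (a + ψ) := by ring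
    rw [this]
    conv_lhs => enter [2, 1]; rw [ha]
    rw [ha', hψ']
    ring
  have e2 : a ^ 2 * PowerSeries.X ^ (n + 2) =
      PowerSeries.X ^ (n + 3) * (PowerSeries.X * a' ^ 2) := by
    rw [ha']; ring
  rw [mul_add (a ^ 2), ← mul_assoc, e2, e1, map_mul, ha]
  ring

/-- Formal linearization of a contraction in one variable. -/
theorem exists_linearization {θ : PowerSeries ℂ} {lam : ℂ}
    (h0 : PowerSeries.constantCoeff θ = 0) (h1 : PowerSeries.coeff 1 θ = lam)
    (hlam : lam ≠ 0) (hlam1 : ‖lam‖ < 1) :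
    ∃ φ : PowerSeries ℂ, PowerSeries.constantCoeff φ = 0 ∧ PowerSeries.coeff 1 φ = 1 ∧
      PowerSeries.subst φ θ = PowerSeries.rescale lam φ := by
  let E : PowerSeries ℂ → PowerSeries ℂ := fun φ =>
    PowerSeries.subst φ θ - PowerSeries.rescale lam φ
  -- Adding `c X ^ (n + 2)` to `φ` adds `c (lam - lam ^ (n + 2))` to the coefficient of degree `n +
  -- 2` of the defect `E φ`, so this `c` cancels it.
  let c : ℕ → PowerSeries ℂ → ℂ := fun n φ =>
    PowerSeries.coeff (n + 2) (E φ) / (lam ^ (n + 2) - lam)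
  let φ : ℕ → PowerSeries ℂ := fun n => Nat.rec PowerSeries.X
    (fun n f => f + PowerSeries.C (c n f) * PowerSeries.X ^ (n + 2)) n
  have hφs : ∀ n, φ (n + 1) = φ n + PowerSeries.C (c n (φ n)) * PowerSeries.X ^ (n + 2) :=
    fun n => rfl
  have hc0 : ∀ n, PowerSeries.constantCoeff (φ n) = 0 := by
    intro n
    induction n with
    | zero => exact PowerSeries.constantCoeff_X
    | succ n ih => rw [hφs]; simp [ih]
  -- Only non-vanishing matters here: the linearization is formal, and convergence is obtained later
  -- for the arc itself.
  have hne : ∀ n, lam ^ (n + 2) - lam ≠ 0 := by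
    intro n h
    have h2 : lam * (lam ^ (n + 1) - 1) = 0 := by rw [← h]; ring
    rcases mul_eq_zero.1 h2 with h | h
    · exact hlam h
    · have h3 : ‖lam ^ (n + 1)‖ = 1 := by rw [sub_eq_zero.1 h, norm_one]
      rw [norm_pow] at h3
      exact absurd h3 (pow_lt_one₀ (norm_nonneg _) hlam1 (Nat.succ_ne_zero n)).ne
  have hE : ∀ n, PowerSeries.X ^ (n + 2) ∣ E (φ n) := by
    intro n
    induction n with
    | zero =>
      rw [PowerSeries.X_pow_dvd_iff]
      intro m hm
      change PowerSeries.coeff m (PowerSeries.subst PowerSeries.X θ -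
        PowerSeries.rescale lam PowerSeries.X) = 0
      interval_cases m
      · simp [PowerSeries.X_subst, h0]
      · simp [PowerSeries.X_subst, h1]
    | succ n ih =>
      have h2 := coeff_subst1_add_monomial (θ := θ) (hc0 n) (c n (φ n)) n
      rw [← hφs, h1] at h2
      have h3 : E (φ (n + 1)) = (PowerSeries.subst (φ (n + 1)) θ - (PowerSeries.subst (φ n) θ +
          PowerSeries.C (c n (φ n) * lam) * PowerSeries.X ^ (n + 2))) +
          (E (φ n) - PowerSeries.C (c n (φ n) * (lam ^ (n + 2) - lam)) *
            PowerSeries.X ^ (n + 2)) := by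
        have : PowerSeries.rescale lam (φ (n + 1)) = PowerSeries.rescale lam (φ n) +
            PowerSeries.C (c n (φ n) * lam ^ (n + 2)) * PowerSeries.X ^ (n + 2) := by
          ext m
          simp only [hφs, map_add, PowerSeries.coeff_rescale, PowerSeries.coeff_C_mul,
            PowerSeries.coeff_X_pow]
          split_ifs with h
          · subst h; ring
          · ring
        simp only [E, this, mul_sub, map_sub]
        ring
      rw [h3]
      refine dvd_add h2 ?_
      rw [PowerSeries.X_pow_dvd_iff]
      intro m hm
      rw [map_sub, PowerSeries.coeff_C_mul, PowerSeries.coeff_X_pow]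
      rcases (Nat.lt_succ_iff.1 hm).lt_or_eq with hm | rfl
      · rw [PowerSeries.X_pow_dvd_iff.1 ih m hm, if_neg hm.ne]; ring
      · rw [if_pos rfl]
        simp only [c]
        rw [div_mul_cancel₀ _ (hne n)]; ring
  -- The passage from `φ n` to `φ (n + 1)` touches only degree `n + 2`, so the coefficient of degree
  -- `k` is final from `φ (k - 1)` on, and the coefficientwise limit `Φ` makes sense.
  have hstab : ∀ k n, k ≤ n + 1 → PowerSeries.coeff k (φ n) = PowerSeries.coeff k (φ k) := by
    intro k
    have : ∀ j, PowerSeries.coeff k (φ (k - 1 + j)) = PowerSeries.coeff k (φ (k - 1)) := by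
      intro j
      induction j with
      | zero => rfl
      | succ j ih =>
        rw [← add_assoc, hφs, map_add, ih, PowerSeries.coeff_C_mul, PowerSeries.coeff_X_pow,
          if_neg (by omega)]
        ring
    intro n hn
    rw [show n = k - 1 + (n - (k - 1)) by omega, this]
    conv_rhs => rw [show k = k - 1 + (k - (k - 1)) by omega]
    rw [← this (k - (k - 1))]
    congr 2
    omega
  let Φ : PowerSeries ℂ := PowerSeries.mk fun k => PowerSeries.coeff k (φ k)
  have hΦ : ∀ n, PowerSeries.X ^ (n + 2) ∣ Φ - φ n := by
    intro n
    rw [PowerSeries.X_pow_dvd_iff]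
    intro m hm
    rw [map_sub, PowerSeries.coeff_mk, hstab m n (by omega), sub_self]
  have hΦ0 : PowerSeries.constantCoeff Φ = 0 := by
    rw [← PowerSeries.coeff_zero_eq_constantCoeff_apply, PowerSeries.coeff_mk,
      PowerSeries.coeff_zero_eq_constantCoeff_apply, hc0]
  refine ⟨Φ, hΦ0, ?_, ?_⟩
  · rw [PowerSeries.coeff_mk, ← hstab 1 0 (by omega)]
    exact PowerSeries.coeff_one_X
  · rw [← sub_eq_zero]
    refine eq_zero_of_X_pow_dvd fun N => (pow_dvd_pow _ (Nat.le_add_right N 2)).trans ?_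
    have h3 : PowerSeries.subst Φ θ - PowerSeries.rescale lam Φ =
        (PowerSeries.subst Φ θ - PowerSeries.subst (φ N) θ) + E (φ N) -
          PowerSeries.rescale lam (Φ - φ N) := by
      simp only [E, map_sub]; ring
    rw [h3]
    refine dvd_sub (dvd_add (X_pow_dvd_subst1_sub hΦ0 (hc0 N) (hΦ N) θ) (hE N)) ?_
    rw [PowerSeries.X_pow_dvd_iff]
    intro m hm
    rw [PowerSeries.coeff_rescale, PowerSeries.X_pow_dvd_iff.1 (hΦ N) m hm, mul_zero]

/-! ### Primitive arcs -/

/-- A formal arc that is not a reparametrization, by a series of order at least two, of another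
one. -/
def IsPrimitiveArc (a : Fin 2 → PowerSeries ℂ) : Prop :=
  ∀ (σ : Fin 2 → PowerSeries ℂ) (τ : PowerSeries ℂ),
    (∀ i, PowerSeries.constantCoeff (σ i) = 0) → PowerSeries.constantCoeff τ = 0 →
    (∀ i, a i = PowerSeries.subst τ (σ i)) → PowerSeries.coeff 1 τ ≠ 0

/-- If `γ = σ ∘ τ` with `τ ≠ 0`, then `γ` and `σ` have the same equations, because substitution of
`τ` is injective; so `σ` is automatically a parametrization of `Γ`. Primitivity no longer mentions
`Γ`. -/
theorem IsIrreducibleParametrization.isPrimitiveArc {Γ : Ideal Series2}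
    {γ : Fin 2 → PowerSeries ℂ} (h : IsIrreducibleParametrization Γ γ) : IsPrimitiveArc γ := by
  obtain ⟨⟨hne, h0, hker⟩, hirr⟩ := h
  intro σ τ hσ hτ he
  have hτ0 : τ ≠ 0 := by
    rintro rfl
    refine hne (funext fun i => ?_)
    rw [he, PowerSeries.subst_zero_of_constantCoeff_zero (hσ i)]; rfl
  refine hirr σ τ ⟨?_, hσ, ?_⟩ hτ he
  · rintro rfl
    refine hne (funext fun i => ?_)
    rw [he]
    exact (subst1_eq_zero_iff hτ hτ0).2 rfl
  · intro f
    rw [hker, funext he, evalArc_subst hσ hτ, subst1_eq_zero_iff hτ hτ0]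

/-- From `b = σ ∘ τ` one gets `a = σ ∘ (τ ∘ χ)`, and the linear coefficient of `τ ∘ χ` has that of
`τ` as a factor. -/
theorem IsPrimitiveArc.of_subst {a b : Fin 2 → PowerSeries ℂ} {χ : PowerSeries ℂ}
    (h : IsPrimitiveArc a) (hχ : PowerSeries.constantCoeff χ = 0)
    (hab : ∀ i, a i = PowerSeries.subst χ (b i)) : IsPrimitiveArc b := by
  intro σ τ hσ hτ he h1
  refine h σ (PowerSeries.subst χ τ) hσ (constantCoeff_subst1 hχ hτ) (fun i => ?_) ?_
  · rw [hab, he, subst1_subst1 hτ hχ]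
  · rw [coeff_one_subst1 hχ, h1, zero_mul]

/-! ### Convergence of invariant arcs -/

theorem IsDiffeoGerm.exists_inverse {F : ℂ × ℂ → ℂ × ℂ} (hF : IsDiffeoGerm F) :
    ∃ G : ℂ × ℂ → ℂ × ℂ, AnalyticAt ℂ G 0 ∧ G 0 = 0 ∧
      (∀ᶠ p in 𝓝 0, G (F p) = p) ∧ ∀ᶠ p in 𝓝 0, F (G p) = p := by
  obtain ⟨hF1, hF0, hF2⟩ := hF
  let i : (ℂ × ℂ) ≃L[ℂ] (ℂ × ℂ) := ContinuousLinearEquiv.ofBijective (fderiv ℂ F 0)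
    (LinearMap.ker_eq_bot.2 hF2.1) (LinearMap.range_eq_top.2 hF2.2)
  have hi : (i : ℂ × ℂ →L[ℂ] ℂ × ℂ) = fderiv ℂ F 0 :=
    ContinuousLinearEquiv.coe_ofBijective _ _ _
  have hs : HasStrictFDerivAt F (i : ℂ × ℂ →L[ℂ] ℂ × ℂ) 0 := by
    rw [hi]; exact hF1.hasStrictFDerivAt
  refine ⟨hs.localInverse F i 0, ?_, ?_, hs.eventually_left_inverse, ?_⟩
  · have h := (hs.toOpenPartialHomeomorph F).analyticAt_symm' (a := 0) (i := i)
      hs.mem_toOpenPartialHomeomorph_source hF1 hi.symm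
    have e : (hs.toOpenPartialHomeomorph F) 0 = 0 := hF0
    rwa [e] at h
  · have := hs.localInverse_apply_image
    rwa [hF0] at this
  · have := hs.eventually_right_inverse
    rwa [hF0] at this

theorem exists_bound_of_X_pow_dvd {u : ℂ → ℂ} (hu : AnalyticAt ℂ u 0) {N : ℕ}
    (h : PowerSeries.X ^ N ∣ taylor1 u) : ∃ C : ℝ, ∀ᶠ s in 𝓝 0, ‖u s‖ ≤ C * ‖s‖ ^ N := by
  obtain ⟨v, hv, h⟩ := (X_pow_dvd_taylor1_iff hu N).1 h
  refine ⟨‖v 0‖ + 1, ?_⟩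
  have h2 : ∀ᶠ s in 𝓝 0, ‖v s‖ < ‖v 0‖ + 1 :=
    hv.continuousAt.norm.eventually_lt_const (lt_add_one _)
  filter_upwards [h, h2] with s hs hs2
  rw [hs, norm_mul, norm_pow, mul_comm]
  gcongr

/-- After division by `s ^ k` with `k < N` the quotient is still `O(|s| ^ (N - k))`, so it vanishes
at `0` and one more factor `s` splits off. -/
theorem X_pow_dvd_of_bound {u : ℂ → ℂ} (hu : AnalyticAt ℂ u 0) {N : ℕ} {C : ℝ}
    (h : ∀ᶠ s in 𝓝 0, ‖u s‖ ≤ C * ‖s‖ ^ N) : PowerSeries.X ^ N ∣ taylor1 u := by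
  suffices ∀ k ≤ N, PowerSeries.X ^ k ∣ taylor1 u from this N le_rfl
  intro k
  induction k with
  | zero => simp
  | succ k ih =>
    intro hk
    obtain ⟨v, hv, h2⟩ := (X_pow_dvd_taylor1_iff hu k).1 (ih (by omega))
    have h3 : ∀ᶠ s in 𝓝[≠] (0 : ℂ), ‖v s‖ ≤ C * ‖s‖ ^ (N - k) := by
      filter_upwards [h.filter_mono nhdsWithin_le_nhds, h2.filter_mono nhdsWithin_le_nhds,
        self_mem_nhdsWithin] with s hs hs2 hs0
      have hpos : 0 < ‖s‖ ^ k := pow_pos (norm_pos_iff.2 hs0) k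
      rw [hs2, norm_mul, norm_pow, show N = k + (N - k) by omega, pow_add,
        mul_left_comm] at hs
      exact le_of_mul_le_mul_left hs hpos
    have h4 : Tendsto (fun s : ℂ => C * ‖s‖ ^ (N - k)) (𝓝[≠] 0) (𝓝 0) := by
      have : ContinuousAt (fun s : ℂ => C * ‖s‖ ^ (N - k)) 0 := by fun_prop
      have h5 := this.tendsto
      simp only [norm_zero] at h5
      rw [zero_pow (by omega), mul_zero] at h5
      exact h5.mono_left nhdsWithin_le_nhds
    have h6 : Tendsto v (𝓝[≠] 0) (𝓝 0) := squeeze_zero_norm' h3 h4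
    have h7 : v 0 = 0 :=
      tendsto_nhds_unique (hv.continuousAt.tendsto.mono_left nhdsWithin_le_nhds) h6
    obtain ⟨w, hw, h8⟩ := exists_eq_add_mul hv
    refine (X_pow_dvd_taylor1_iff hu (k + 1)).2 ⟨w, hw, ?_⟩
    filter_upwards [h2, h8] with s hs hs2
    rw [hs, hs2, h7]; ring

theorem exists_ball_of_eventually {E : Type*} [NormedAddCommGroup E] {P : E → Prop}
    (h : ∀ᶠ p in 𝓝 (0 : E), P p) : ∃ ε > 0, ∀ p, ‖p‖ < ε → P p := by
  obtain ⟨ε, hε, h⟩ := Metric.eventually_nhds_iff.1 h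
  exact ⟨ε, hε, fun p hp => h (by rwa [dist_zero_right])⟩

theorem eventually_mul_left {P : ℂ → Prop} (h : ∀ᶠ s in 𝓝 (0 : ℂ), P s) (lam : ℂ) :
    ∀ᶠ s in 𝓝 (0 : ℂ), P (lam * s) := by
  have : Tendsto (fun s : ℂ => lam * s) (𝓝 0) (𝓝 0) := by
    have : ContinuousAt (fun s : ℂ => lam * s) 0 := by fun_prop
    simpa using this.tendsto
  exact this.eventually h

/-- The invariant arc as a limit of graph transforms of an approximate solution. -/
theorem exists_analytic_fixed {G : ℂ × ℂ → ℂ × ℂ} (hG : AnalyticAt ℂ G 0) {L : ℝ} (hL : 0 ≤ L)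
    (hLip : ∀ᶠ q in 𝓝 (0 : (ℂ × ℂ) × (ℂ × ℂ)), ‖G q.1 - G q.2‖ ≤ L * ‖q.1 - q.2‖)
    {lam : ℂ} (hlam : ‖lam‖ < 1) {N : ℕ} (hN : N ≠ 0) (hq : L * ‖lam‖ ^ N < 1)
    {P : ℂ → ℂ × ℂ} (hP : AnalyticAt ℂ P 0) (hP0 : P 0 = 0) {C : ℝ}
    (hE : ∀ᶠ s in 𝓝 0, ‖G (P (lam * s)) - P s‖ ≤ C * ‖s‖ ^ N) :
    ∃ u : ℂ → ℂ × ℂ, AnalyticAt ℂ u 0 ∧ u 0 = 0 ∧ (∀ᶠ s in 𝓝 0, u s = G (u (lam * s))) ∧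
      ∃ C' : ℝ, ∀ᶠ s in 𝓝 0, ‖u s - P s‖ ≤ C' * ‖s‖ ^ N := by
  wlog hC : 0 ≤ C generalizing C
  · refine this (C := 0) (hE.mono fun s hs => hs.trans ?_) le_rfl
    gcongr
    exact (not_le.1 hC).le
  set q := L * ‖lam‖ ^ N with hqdef
  have hq0 : 0 ≤ q := by positivity
  -- The fixed point of `R ↦ q R + C`: with this radius the tube `‖u - P‖ ≤ C' |s| ^ N` is mapped
  -- into itself by the operator `u ↦ G(u(lam ·))`.
  set C' := C / (1 - q) with hC'
  have h1q : 0 < 1 - q := sub_pos.2 hq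
  have hC'0 : 0 ≤ C' := by positivity
  have hC'q : q * C' + C = C' := by rw [hC']; field_simp; ring
  have hLip' : ∃ ε > 0, ∀ a b, ‖a‖ < ε → ‖b‖ < ε → ‖G a - G b‖ ≤ L * ‖a - b‖ := by
    obtain ⟨ε, hε, h⟩ := exists_ball_of_eventually hLip
    exact ⟨ε, hε, fun a b ha hb => h (a, b) (by simp [Prod.norm_def] at *; tauto)⟩
  obtain ⟨ε₁, hε₁, hL1⟩ := hLip'
  obtain ⟨ε₂, hε₂, hGd⟩ := exists_ball_of_eventually hG.eventually_analyticAt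
  set ε := min ε₁ ε₂ with hεdef
  have hε : 0 < ε := lt_min hε₁ hε₂
  have hsmall : ∀ᶠ s in 𝓝 (0 : ℂ), ‖P s‖ + C' * ‖s‖ ^ N < ε := by
    have hcont : ContinuousAt (fun s : ℂ => ‖P s‖ + C' * ‖s‖ ^ N) 0 :=
      hP.continuousAt.norm.add (by fun_prop)
    refine hcont.eventually_lt_const ?_
    simpa [hP0, hN] using hε
  obtain ⟨r, hr, hall⟩ := exists_ball_of_eventually
    (hsmall.and (hE.and hP.eventually_analyticAt))
  have hlams : ∀ s : ℂ, ‖s‖ < r → ‖lam * s‖ < r := fun s hs => by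
    rw [norm_mul]
    exact lt_of_le_of_lt (mul_le_of_le_one_left (norm_nonneg _) hlam.le) hs
  let u : ℕ → ℂ → ℂ × ℂ := fun n => Nat.rec P (fun _ f s => G (f (lam * s))) n
  have hus : ∀ n s, u (n + 1) s = G (u n (lam * s)) := fun _ _ => rfl
  have hbd : ∀ (v : ℂ × ℂ) (s : ℂ), ‖s‖ < r → ‖v - P s‖ ≤ C' * ‖s‖ ^ N → ‖v‖ < ε := by
    intro v s hs hv
    calc ‖v‖ = ‖P s + (v - P s)‖ := by congr 1; abel
      _ ≤ ‖P s‖ + ‖v - P s‖ := norm_add_le _ _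
      _ ≤ ‖P s‖ + C' * ‖s‖ ^ N := by gcongr
      _ < ε := (hall s hs).1
  have hstep : ∀ (v : ℂ × ℂ) (s : ℂ), ‖s‖ < r → ‖v - P (lam * s)‖ ≤ C' * ‖lam * s‖ ^ N →
      ‖G v - P s‖ ≤ C' * ‖s‖ ^ N := by
    intro v s hs hv
    have hv1 : ‖v‖ < ε₁ := (hbd v _ (hlams s hs) hv).trans_le (min_le_left _ _)
    have hv2 : ‖P (lam * s)‖ < ε₁ :=
      (hbd _ _ (hlams s hs) (by rw [sub_self, norm_zero]; positivity)).trans_le (min_le_left _ _)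
    calc ‖G v - P s‖ = ‖(G v - G (P (lam * s))) + (G (P (lam * s)) - P s)‖ := by congr 1; abel
      _ ≤ ‖G v - G (P (lam * s))‖ + ‖G (P (lam * s)) - P s‖ := norm_add_le _ _
      _ ≤ L * (C' * ‖lam * s‖ ^ N) + C * ‖s‖ ^ N := by
        refine add_le_add ((hL1 _ _ hv1 hv2).trans ?_) (hall s hs).2.1
        gcongr
      _ = (q * C' + C) * ‖s‖ ^ N := by rw [norm_mul, mul_pow, hqdef]; ring
      _ = C' * ‖s‖ ^ N := by rw [hC'q]
  have h1 : ∀ n s, ‖s‖ < r → ‖u n s - P s‖ ≤ C' * ‖s‖ ^ N := by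
    intro n
    induction n with
    | zero =>
      intro s hs
      change ‖P s - P s‖ ≤ _
      rw [sub_self, norm_zero]; positivity
    | succ n ih => exact fun s hs => hstep _ s hs (ih _ (hlams s hs))
  have hball : ∀ s : ℂ, s ∈ Metric.ball (0 : ℂ) r ↔ ‖s‖ < r := fun s => by simp
  have h2 : ∀ n, DifferentiableOn ℂ (u n) (Metric.ball 0 r) := by
    intro n
    induction n with
    | zero =>
      exact fun s hs => (hall s ((hball s).1 hs)).2.2.differentiableAt.differentiableWithinAt
    | succ n ih =>
      intro s hs
      have hs' := (hball s).1 hs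
      have hmem : lam * s ∈ Metric.ball (0 : ℂ) r := (hball _).2 (hlams s hs')
      have hd : DifferentiableAt ℂ (u n) (lam * s) :=
        (ih _ hmem).differentiableAt (Metric.isOpen_ball.mem_nhds hmem)
      have hGs : DifferentiableAt ℂ G (u n (lam * s)) :=
        (hGd _ ((hbd _ _ (hlams s hs') (h1 n _ (hlams s hs'))).trans_le
          (min_le_right _ _))).differentiableAt
      have hm : DifferentiableAt ℂ (fun s : ℂ => lam * s) s := by fun_prop
      exact (DifferentiableAt.comp s hGs (DifferentiableAt.comp s hd hm)).differentiableWithinAt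
  -- Each iteration costs the factor `L` from `G` and gains `|lam| ^ N` from evaluation at `lam s`.
  -- The telescoping series therefore converges normally and its sum is holomorphic.
  have h3 : ∀ n s, ‖s‖ < r → ‖u (n + 1) s - u n s‖ ≤ C * q ^ n * ‖s‖ ^ N := by
    intro n
    induction n with
    | zero =>
      intro s hs
      rw [pow_zero, mul_one]
      exact (hall s hs).2.1
    | succ n ih =>
      intro s hs
      have hs' := hlams s hs
      have hv1 : ∀ n, ‖u n (lam * s)‖ < ε₁ := fun n =>
        (hbd _ _ hs' (h1 n _ hs')).trans_le (min_le_left _ _)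
      calc ‖u (n + 2) s - u (n + 1) s‖ ≤ L * ‖u (n + 1) (lam * s) - u n (lam * s)‖ :=
            hL1 _ _ (hv1 (n + 1)) (hv1 n)
        _ ≤ L * (C * q ^ n * ‖lam * s‖ ^ N) := by gcongr; exact ih _ hs'
        _ = C * q ^ (n + 1) * ‖s‖ ^ N := by rw [norm_mul, mul_pow, pow_succ, hqdef]; ring
  have hsum : Summable fun n => C * q ^ n * r ^ N :=
    ((summable_geometric_of_lt_one hq0 hq).mul_left C).mul_right _
  have h3' : ∀ n, ∀ s ∈ Metric.ball (0 : ℂ) r, ‖u (n + 1) s - u n s‖ ≤ C * q ^ n * r ^ N := by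
    intro n s hs
    refine (h3 n s ((hball s).1 hs)).trans ?_
    gcongr
    exact ((hball s).1 hs).le
  let U : ℂ → ℂ × ℂ := fun s => P s + ∑' n, (u (n + 1) s - u n s)
  have hUd : DifferentiableOn ℂ U (Metric.ball 0 r) :=
    (h2 0).add (Complex.differentiableOn_tsum_of_summable_norm hsum
      (fun n => (h2 (n + 1)).sub (h2 n)) Metric.isOpen_ball h3')
  have hlim : ∀ s, ‖s‖ < r → Tendsto (fun n => u n s) atTop (𝓝 (U s)) := by
    intro s hs
    have hS : Summable fun n => u (n + 1) s - u n s :=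
      Summable.of_norm_bounded hsum fun n => h3' n s ((hball s).2 hs)
    have h4 := hS.hasSum.tendsto_sum_nat
    simp only [Finset.sum_range_sub (fun n => u n s)] at h4
    have h5 := h4.const_add (P s)
    refine h5.congr fun n => ?_
    change P s + (u n s - P s) = u n s
    abel
  have hU1 : ∀ s, ‖s‖ < r → ‖U s - P s‖ ≤ C' * ‖s‖ ^ N := fun s hs =>
    le_of_tendsto ((hlim s hs).sub_const (P s)).norm (Eventually.of_forall fun n => h1 n s hs)
  have hr0 : ‖(0 : ℂ)‖ < r := by rwa [norm_zero]
  have hev : ∀ᶠ s : ℂ in 𝓝 0, ‖s‖ < r := continuousAt_id.norm.eventually_lt_const hr0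
  refine ⟨U, hUd.analyticAt (Metric.ball_mem_nhds _ hr), ?_, ?_, C', hev.mono hU1⟩
  · have := hU1 0 hr0
    rw [hP0, norm_zero, zero_pow hN, mul_zero, sub_zero] at this
    exact norm_le_zero_iff.1 this
  · refine hev.mono fun s hs => ?_
    have hs' := hlams s hs
    have hc : ContinuousAt G (U (lam * s)) :=
      (hGd _ ((hbd _ _ hs' (hU1 _ hs')).trans_le (min_le_right _ _))).continuousAt
    exact tendsto_nhds_unique ((tendsto_add_atTop_iff_nat 1).2 (hlim s hs))
      (hc.tendsto.comp (hlim _ hs'))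

/-- Iterating the functional equation `n` times bounds the difference of two solutions by `(L |lam|
^ N) ^ n` times the initial bound, which tends to `0`. It is used to identify solutions built from
different truncations. -/
theorem eventually_eq_of_fixed {G : ℂ × ℂ → ℂ × ℂ} {L : ℝ} (hL : 0 ≤ L)
    (hLip : ∀ᶠ q in 𝓝 (0 : (ℂ × ℂ) × (ℂ × ℂ)), ‖G q.1 - G q.2‖ ≤ L * ‖q.1 - q.2‖)
    {lam : ℂ} (hlam : ‖lam‖ < 1) {N : ℕ} (hq : L * ‖lam‖ ^ N < 1)
    {u v : ℂ → ℂ × ℂ} (hu : ContinuousAt u 0) (hu0 : u 0 = 0) (hv : ContinuousAt v 0)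
    (hv0 : v 0 = 0) (hfu : ∀ᶠ s in 𝓝 0, u s = G (u (lam * s)))
    (hfv : ∀ᶠ s in 𝓝 0, v s = G (v (lam * s))) {C : ℝ}
    (h : ∀ᶠ s in 𝓝 0, ‖u s - v s‖ ≤ C * ‖s‖ ^ N) : ∀ᶠ s in 𝓝 0, u s = v s := by
  have huv : Tendsto (fun s => (u s, v s)) (𝓝 0) (𝓝 (0 : (ℂ × ℂ) × (ℂ × ℂ))) := by
    have := hu.tendsto.prodMk_nhds hv.tendsto
    rwa [hu0, hv0] at this
  have hstep : ∀ᶠ s in 𝓝 (0 : ℂ), ‖u s - v s‖ ≤ L * ‖u (lam * s) - v (lam * s)‖ := by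
    filter_upwards [hfu, hfv, eventually_mul_left (huv.eventually hLip) lam] with s h1 h2 h3
    rw [h1, h2]
    exact h3
  obtain ⟨r, hr, hall⟩ := exists_ball_of_eventually (hstep.and h)
  have hit : ∀ n s, ‖s‖ < r → ‖u s - v s‖ ≤ (L * ‖lam‖ ^ N) ^ n * (C * ‖s‖ ^ N) := by
    intro n
    induction n with
    | zero => intro s hs; simpa using (hall s hs).2
    | succ n ih =>
      intro s hs
      have hs' : ‖lam * s‖ < r := by
        rw [norm_mul]
        exact lt_of_le_of_lt (mul_le_of_le_one_left (norm_nonneg _) hlam.le) hs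
      calc ‖u s - v s‖ ≤ L * ‖u (lam * s) - v (lam * s)‖ := (hall s hs).1
        _ ≤ L * ((L * ‖lam‖ ^ N) ^ n * (C * ‖lam * s‖ ^ N)) := by gcongr; exact ih _ hs'
        _ = (L * ‖lam‖ ^ N) ^ (n + 1) * (C * ‖s‖ ^ N) := by
          rw [norm_mul, mul_pow, pow_succ]; ring
  have hev : ∀ᶠ s : ℂ in 𝓝 0, ‖s‖ < r :=
    continuousAt_id.norm.eventually_lt_const (by simpa using hr)
  refine hev.mono fun s hs => ?_
  have hlim : Tendsto (fun n => (L * ‖lam‖ ^ N) ^ n * (C * ‖s‖ ^ N)) atTop (𝓝 0) := by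
    have := (tendsto_pow_atTop_nhds_zero_of_lt_one (by positivity) hq).mul_const (C * ‖s‖ ^ N)
    rwa [zero_mul] at this
  have := ge_of_tendsto' hlim fun n => hit n s hs
  exact sub_eq_zero.1 (norm_le_zero_iff.1 this)

theorem taylor1_polynomial (p : Polynomial ℂ) :
    taylor1 (fun s => p.eval s) = (p : PowerSeries ℂ) := by
  induction p using Polynomial.induction_on' with
  | add p q hp hq =>
    simp only [Polynomial.eval_add, Polynomial.coe_add]
    rw [taylor1_add (AnalyticOnNhd.eval_polynomial p 0 trivial)
      (AnalyticOnNhd.eval_polynomial q 0 trivial), hp, hq]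
  | monomial n c =>
    simp only [Polynomial.eval_monomial, Polynomial.coe_monomial]
    rw [taylor1_const_mul (analyticAt_var.fun_pow n), taylor1_id_pow]
    ext m
    simp [PowerSeries.coeff_X_pow, PowerSeries.coeff_monomial]

theorem taylor1_mul_left {u : ℂ → ℂ} (hu : AnalyticAt ℂ u 0) (lam : ℂ) :
    taylor1 (fun s => u (lam * s)) = PowerSeries.rescale lam (taylor1 u) := by
  rw [taylor1_comp1 hu (analyticAt_const.fun_mul analyticAt_var) (mul_zero _),
    taylor1_const_mul analyticAt_var, taylor1_id, PowerSeries.rescale_eq_subst,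
    PowerSeries.smul_eq_C_mul]

theorem exists_eventually_lipschitz {G : ℂ × ℂ → ℂ × ℂ} (hG : AnalyticAt ℂ G 0) :
    ∃ L : ℝ, 0 ≤ L ∧
      ∀ᶠ q in 𝓝 (0 : (ℂ × ℂ) × (ℂ × ℂ)), ‖G q.1 - G q.2‖ ≤ L * ‖q.1 - q.2‖ := by
  obtain ⟨K, s, hs, hK⟩ := hG.hasStrictFDerivAt.exists_lipschitzOnWith
  refine ⟨K, K.2, ?_⟩
  have : ∀ᶠ q in 𝓝 (0 : (ℂ × ℂ) × (ℂ × ℂ)), q.1 ∈ s ∧ q.2 ∈ s :=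
    Filter.inter_mem (continuous_fst.tendsto (0 : (ℂ × ℂ) × (ℂ × ℂ)) hs)
      (continuous_snd.tendsto (0 : (ℂ × ℂ) × (ℂ × ℂ)) hs)
  filter_upwards [this] with q hq
  have := hK.dist_le_mul _ hq.1 _ hq.2
  rwa [dist_eq_norm, dist_eq_norm] at this

theorem analyticAt_arc_fst {γ : ℂ → ℂ × ℂ} {s : ℂ} (h : AnalyticAt ℂ γ s) :
    AnalyticAt ℂ (fun s => (γ s).1) s := analyticAt_fst.comp h

theorem analyticAt_arc_snd {γ : ℂ → ℂ × ℂ} {s : ℂ} (h : AnalyticAt ℂ γ s) :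
    AnalyticAt ℂ (fun s => (γ s).2) s := analyticAt_snd.comp h

theorem bound_of_X_pow_dvd_taylorArc {u : ℂ → ℂ × ℂ} (hu : AnalyticAt ℂ u 0) {N : ℕ}
    (h : ∀ i, PowerSeries.X ^ N ∣ taylorArc u i) :
    ∃ C : ℝ, ∀ᶠ s in 𝓝 0, ‖u s‖ ≤ C * ‖s‖ ^ N := by
  obtain ⟨C₁, h1⟩ := exists_bound_of_X_pow_dvd (analyticAt_arc_fst hu) (h 0)
  obtain ⟨C₂, h2⟩ := exists_bound_of_X_pow_dvd (analyticAt_arc_snd hu) (h 1)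
  refine ⟨max C₁ C₂, ?_⟩
  filter_upwards [h1, h2] with s h1 h2
  refine max_le (h1.trans ?_) (h2.trans ?_)
  · gcongr; exact le_max_left _ _
  · gcongr; exact le_max_right _ _

theorem X_pow_dvd_taylorArc_of_bound {u : ℂ → ℂ × ℂ} (hu : AnalyticAt ℂ u 0) {N : ℕ} {C : ℝ}
    (h : ∀ᶠ s in 𝓝 0, ‖u s‖ ≤ C * ‖s‖ ^ N) (i : Fin 2) : PowerSeries.X ^ N ∣ taylorArc u i := by
  fin_cases i
  · exact X_pow_dvd_of_bound (analyticAt_arc_fst hu) (h.mono fun s hs => (norm_fst_le _).trans hs)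
  · exact X_pow_dvd_of_bound (analyticAt_arc_snd hu) (h.mono fun s hs => (norm_snd_le _).trans hs)

theorem taylorArc_sub {u v : ℂ → ℂ × ℂ} (hu : AnalyticAt ℂ u 0) (hv : AnalyticAt ℂ v 0)
    (i : Fin 2) : taylorArc (fun s => u s - v s) i = taylorArc u i - taylorArc v i := by
  fin_cases i
  · exact taylor1_sub (analyticAt_arc_fst hu) (analyticAt_arc_fst hv)
  · exact taylor1_sub (analyticAt_arc_snd hu) (analyticAt_arc_snd hv)

/-- A formal arc on which an analytic diffeomorphism acts as a linear contraction of the parameter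
is convergent. -/
theorem IsDiffeoGerm.exists_taylorArc_eq {F : ℂ × ℂ → ℂ × ℂ} (hF : IsDiffeoGerm F) {lam : ℂ}
    (hlam : ‖lam‖ < 1) {g : Fin 2 → PowerSeries ℂ}
    (hg0 : ∀ i, PowerSeries.constantCoeff (g i) = 0)
    (hg : ∀ i, evalArc g (taylorMap F i) = PowerSeries.rescale lam (g i)) :
    ∃ γ : ℂ → ℂ × ℂ, AnalyticAt ℂ γ 0 ∧ γ 0 = 0 ∧ taylorArc γ = g := by
  obtain ⟨G, hG, hG0, hGF, -⟩ := hF.exists_inverse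
  obtain ⟨L, hL, hLip⟩ := exists_eventually_lipschitz hG
  obtain ⟨N₀, hN₀⟩ : ∃ N₀ : ℕ, ∀ N ≥ N₀, L * ‖lam‖ ^ N < 1 := by
    have h := (tendsto_pow_atTop_nhds_zero_of_lt_one (norm_nonneg lam) hlam).const_mul L
    rw [mul_zero] at h
    exact eventually_atTop.1 (h.eventually_lt_const one_pos)
  let P : ℕ → ℂ → ℂ × ℂ := fun N s =>
    ((PowerSeries.trunc N (g 0)).eval s, (PowerSeries.trunc N (g 1)).eval s)
  have hPT : ∀ N i, taylorArc (P N) i = (PowerSeries.trunc N (g i) : PowerSeries ℂ) := by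
    intro N i
    fin_cases i <;> exact taylor1_polynomial _
  have hPa : ∀ N, AnalyticAt ℂ (P N) 0 := fun N =>
    (AnalyticOnNhd.eval_polynomial _ 0 trivial).prod (AnalyticOnNhd.eval_polynomial _ 0 trivial)
  have hPd : ∀ N i, PowerSeries.X ^ N ∣ taylorArc (P N) i - g i := by
    intro N i
    rw [hPT, PowerSeries.X_pow_dvd_iff]
    intro m hm
    rw [map_sub, Polynomial.coeff_coe, PowerSeries.coeff_trunc, if_pos hm, sub_self]
  have hPc : ∀ N i, PowerSeries.constantCoeff (taylorArc (P N) i) = 0 := by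
    intro N i
    rw [hPT, ← PowerSeries.coeff_zero_eq_constantCoeff_apply, Polynomial.coeff_coe,
      PowerSeries.coeff_trunc, PowerSeries.coeff_zero_eq_constantCoeff_apply, hg0, ite_self]
  have hP0 : ∀ N, P N 0 = 0 := by
    intro N
    have h1 := hPc N 0
    have h2 := hPc N 1
    simp only [taylorArc, Matrix.cons_val_zero, Matrix.cons_val_one, constantCoeff_taylor1]
      at h1 h2
    exact Prod.ext h1 h2
  have hPt : ∀ N, Tendsto (P N) (𝓝 0) (𝓝 0) := fun N => by
    simpa [hP0] using (hPa N).continuousAt.tendsto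
  -- Since `g` solves the equation exactly, its truncation satisfies `F(P(s)) - P(lam s) = O(s ^
  -- N)`; applying the Lipschitz map `G` and `G ∘ F = id` gives the error of the fixed point
  -- equation.
  have hE : ∀ N, ∃ C : ℝ, ∀ᶠ s in 𝓝 0, ‖G (P N (lam * s)) - P N s‖ ≤ C * ‖s‖ ^ N := by
    intro N
    have hFP : AnalyticAt ℂ (fun s => F (P N s)) 0 :=
      AnalyticAt.fun_comp (by rw [hP0]; exact hF.1) (hPa N)
    have hm : AnalyticAt ℂ (fun s : ℂ => lam * s) 0 := analyticAt_const.fun_mul analyticAt_var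
    have hPl : AnalyticAt ℂ (fun s => P N (lam * s)) 0 :=
      AnalyticAt.fun_comp (by rw [mul_zero]; exact hPa N) hm
    have hd : ∀ i, PowerSeries.X ^ N ∣ taylorArc (fun s => F (P N s) - P N (lam * s)) i := by
      intro i
      have e1 : taylorArc (fun s => F (P N s)) i = evalArc (taylorArc (P N)) (taylorMap F i) := by
        fin_cases i
        · exact taylor1_comp (f := fun p => (F p).1) (analyticAt_fst.comp hF.1) (hPa N) (hP0 N)
        · exact taylor1_comp (f := fun p => (F p).2) (analyticAt_snd.comp hF.1) (hPa N) (hP0 N)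
      have e2 : taylorArc (fun s => P N (lam * s)) i =
          PowerSeries.rescale lam (taylorArc (P N) i) := by
        fin_cases i
        · exact taylor1_mul_left (analyticAt_arc_fst (hPa N)) lam
        · exact taylor1_mul_left (analyticAt_arc_snd (hPa N)) lam
      rw [taylorArc_sub hFP hPl, e1, e2]
      have e3 : evalArc (taylorArc (P N)) (taylorMap F i) -
          PowerSeries.rescale lam (taylorArc (P N) i) =
          (evalArc (taylorArc (P N)) (taylorMap F i) - evalArc g (taylorMap F i)) -
            PowerSeries.rescale lam (taylorArc (P N) i - g i) := by
        rw [hg, map_sub]; ring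
      rw [e3]
      refine dvd_sub (X_pow_dvd_evalArc_sub (hPc N) hg0 (hPd N) _) ?_
      rw [PowerSeries.X_pow_dvd_iff]
      intro m hm
      rw [PowerSeries.coeff_rescale, PowerSeries.X_pow_dvd_iff.1 (hPd N i) m hm, mul_zero]
    obtain ⟨C, hC⟩ := bound_of_X_pow_dvd_taylorArc (hFP.fun_sub hPl) hd
    refine ⟨L * C, ?_⟩
    have hFPt : Tendsto (fun s => F (P N s)) (𝓝 0) (𝓝 0) := by
      simpa [hP0, hF.2.1] using hFP.continuousAt.tendsto
    have hPlt : Tendsto (fun s => P N (lam * s)) (𝓝 0) (𝓝 0) := by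
      simpa [hP0] using hPl.continuousAt.tendsto
    filter_upwards [hC, (hPlt.prodMk_nhds hFPt).eventually hLip, (hPt N).eventually hGF]
      with s h1 h2 h3
    simp only [h3] at h2
    refine h2.trans ?_
    rw [mul_assoc, norm_sub_rev]
    gcongr
  choose C hC using hE
  -- Starting from `N₀ + 1` makes the exponent positive, which forces the solution to vanish at `0`.
  have hex := fun N (hN : N ≥ N₀ + 1) => exists_analytic_fixed hG hL hLip hlam (N := N) (by omega)
    (hN₀ N (by omega)) (hPa N) (hP0 N) (hC N)
  obtain ⟨u, hu, hu0, hfu, C', hC'⟩ := hex (N₀ + 1) le_rfl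
  refine ⟨u, hu, hu0, funext fun i => ?_⟩
  rw [← sub_eq_zero]
  refine eq_zero_of_X_pow_dvd fun M => ?_
  -- The solution `v` built from a longer truncation agrees with `g` to order `N`. It agrees with
  -- `u` to order `N₀ + 1`, hence equals `u`; so `u` agrees with `g` to every order.
  obtain ⟨N, hN1, hMN⟩ : ∃ N, N ≥ N₀ + 1 ∧ M ≤ N := ⟨max (N₀ + 1) M, le_max_left _ _, le_max_right _ _⟩
  refine (pow_dvd_pow _ hMN).trans ?_
  obtain ⟨v, hv, hv0, hfv, D', hD'⟩ := hex N hN1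
  have hvd : ∀ i, PowerSeries.X ^ N ∣ taylorArc v i - g i := by
    intro i
    have h1 := X_pow_dvd_taylorArc_of_bound (hv.fun_sub (hPa N)) hD' i
    rw [taylorArc_sub hv (hPa N)] at h1
    have := dvd_add h1 (hPd N i)
    rwa [sub_add_sub_cancel] at this
  have hud : ∀ i, PowerSeries.X ^ (N₀ + 1) ∣ taylorArc u i - g i := by
    intro i
    have h1 := X_pow_dvd_taylorArc_of_bound (hu.fun_sub (hPa _)) hC' i
    rw [taylorArc_sub hu (hPa _)] at h1
    have := dvd_add h1 (hPd _ i)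
    rwa [sub_add_sub_cancel] at this
  obtain ⟨K, hK⟩ := bound_of_X_pow_dvd_taylorArc (hu.fun_sub hv) (N := N₀ + 1) fun i => by
    rw [taylorArc_sub hu hv]
    have := dvd_sub (hud i) ((pow_dvd_pow _ hN1).trans (hvd i))
    rwa [sub_sub_sub_cancel_right] at this
  have heq := eventually_eq_of_fixed hL hLip hlam (hN₀ (N₀ + 1) (by omega)) hu.continuousAt hu0
    hv.continuousAt hv0 hfu hfv hK
  have : taylorArc u i = taylorArc v i := by
    fin_cases i
    · exact taylor1_congr (heq.mono fun s hs => by simp only [hs])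
    · exact taylor1_congr (heq.mono fun s hs => by simp only [hs])
  rw [this]
  exact hvd i

/-! ### Formal equations of Puiseux arcs -/

/-- A series in one variable as a series in `x`. -/
def inclX (r : PowerSeries ℂ) : Series2 := PowerSeries.subst X₀ r

theorem coeff_inclX (r : PowerSeries ℂ) (n : Fin 2 →₀ ℕ) :
    MvPowerSeries.coeff n (inclX r) = if n 1 = 0 then PowerSeries.coeff (n 0) r else 0 := by
  rw [inclX, X₀, PowerSeries.coeff_subst_single]
  have : n = Finsupp.single 0 (n 0) ↔ n 1 = 0 := by
    rw [Finsupp.ext_iff]; simp [Fin.forall_fin_two]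
  simp only [this]

theorem hasSubst_X₀ : PowerSeries.HasSubst X₀ := PowerSeries.HasSubst.X 0

theorem subst_inclX {τ : Type*} {a : Fin 2 → MvPowerSeries τ ℂ} (ha : MvPowerSeries.HasSubst a)
    (r : PowerSeries ℂ) : MvPowerSeries.subst a (inclX r) = PowerSeries.subst (a 0) r := by
  unfold inclX PowerSeries.subst
  rw [MvPowerSeries.subst_comp_subst_apply hasSubst_X₀.const ha, X₀, MvPowerSeries.subst_X ha]

theorem subst_X₀ {τ : Type*} {a : Fin 2 → MvPowerSeries τ ℂ} (ha : MvPowerSeries.HasSubst a) :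
    MvPowerSeries.subst a X₀ = a 0 := MvPowerSeries.subst_X ha 0

theorem subst_X₁ {τ : Type*} {a : Fin 2 → MvPowerSeries τ ℂ} (ha : MvPowerSeries.HasSubst a) :
    MvPowerSeries.subst a X₁ = a 1 := MvPowerSeries.subst_X ha 1

theorem constantCoeff_inclX {r : PowerSeries ℂ} (hr : PowerSeries.constantCoeff r = 0) :
    MvPowerSeries.constantCoeff (inclX r) = 0 := by
  rw [← MvPowerSeries.coeff_zero_eq_constantCoeff_apply, coeff_inclX]
  simpa using hr

theorem constantCoeff_pair {τ : Type*} {a b : MvPowerSeries τ ℂ}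
    (ha : MvPowerSeries.constantCoeff a = 0) (hb : MvPowerSeries.constantCoeff b = 0) (i : Fin 2) :
    MvPowerSeries.constantCoeff (![a, b] i) = 0 := by
  fin_cases i <;> simp [ha, hb]

theorem constantCoeff_X₀ : MvPowerSeries.constantCoeff X₀ = 0 := by simp [X₀]

theorem constantCoeff_X₁ : MvPowerSeries.constantCoeff X₁ = 0 := by simp [X₁]

section evalArc
variable {γ : Fin 2 → PowerSeries ℂ} (hγ : ∀ i, PowerSeries.constantCoeff (γ i) = 0)
include hγ

theorem evalArc_mul (f g : Series2) : evalArc γ (f * g) = evalArc γ f * evalArc γ g :=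
  MvPowerSeries.subst_mul (hasSubst_of_zero (τ := Unit) hγ) f g

theorem evalArc_add (f g : Series2) : evalArc γ (f + g) = evalArc γ f + evalArc γ g :=
  MvPowerSeries.subst_add (hasSubst_of_zero (τ := Unit) hγ) f g

theorem evalArc_sub (f g : Series2) : evalArc γ (f - g) = evalArc γ f - evalArc γ g :=
  MvPowerSeries.subst_sub (hasSubst_of_zero (τ := Unit) hγ) f g

theorem evalArc_X (i : Fin 2) : evalArc γ (MvPowerSeries.X i) = γ i :=
  MvPowerSeries.subst_X (hasSubst_of_zero (τ := Unit) hγ) i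

theorem evalArc_X₀ : evalArc γ X₀ = γ 0 := evalArc_X hγ 0

theorem evalArc_X₁ : evalArc γ X₁ = γ 1 := evalArc_X hγ 1

omit hγ in
theorem evalArc_C (c : ℂ) : evalArc γ (MvPowerSeries.C c) = PowerSeries.C c :=
  MvPowerSeries.subst_C c

theorem evalArc_pow (f : Series2) (k : ℕ) : evalArc γ (f ^ k) = evalArc γ f ^ k :=
  MvPowerSeries.subst_pow (hasSubst_of_zero (τ := Unit) hγ) f k

theorem evalArc_inclX (r : PowerSeries ℂ) : evalArc γ (inclX r) = PowerSeries.subst (γ 0) r :=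
  subst_inclX (hasSubst_of_zero (τ := Unit) hγ) r

theorem evalArc_prod {ι : Type*} (s : Finset ι) (f : ι → Series2) :
    evalArc γ (∏ i ∈ s, f i) = ∏ i ∈ s, evalArc γ (f i) := by
  unfold evalArc
  simp only [← MvPowerSeries.coe_substAlgHom (hasSubst_of_zero (τ := Unit) hγ)]
  exact map_prod _ _ _

end evalArc

theorem X₁_dvd_of_evalArc {g : Series2} (hg : evalArc ![PowerSeries.X, 0] g = 0) : X₁ ∣ g := by
  have hc : ∀ i, PowerSeries.constantCoeff ((![PowerSeries.X, 0] : Fin 2 → PowerSeries ℂ) i) = 0 :=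
    constantCoeff_pair (τ := Unit) PowerSeries.constantCoeff_X (map_zero _)
  set g₀ : PowerSeries ℂ := PowerSeries.mk fun k => MvPowerSeries.coeff (Finsupp.single 0 k) g
  have h1 : X₁ ∣ g - inclX g₀ := by
    rw [X₁, MvPowerSeries.X_dvd_iff]
    intro m hm
    rw [map_sub, coeff_inclX, if_pos hm, PowerSeries.coeff_mk, sub_eq_zero]
    congr 2
    rw [Finsupp.ext_iff]; simp [Fin.forall_fin_two, hm]
  obtain ⟨q, hq⟩ := h1
  rw [sub_eq_iff_eq_add] at hq
  rw [hq, evalArc_add hc, evalArc_mul hc, evalArc_inclX hc, X₁, evalArc_X hc] at hg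
  simp only [Matrix.cons_val_one, Matrix.cons_val_zero, zero_mul, zero_add,
    PowerSeries.X_subst] at hg
  refine ⟨q, ?_⟩
  rw [hq, show g₀ = 0 from hg, inclX, ← PowerSeries.coe_substAlgHom hasSubst_X₀, map_zero, add_zero]

/-- The factor theorem for power series. -/
theorem X₁_sub_dvd_of_evalArc {r : PowerSeries ℂ} (hr : PowerSeries.constantCoeff r = 0)
    {f : Series2} (hf : evalArc ![PowerSeries.X, r] f = 0) : X₁ - inclX r ∣ f := by
  have hr' := constantCoeff_inclX hr
  have ha0 := constantCoeff_pair (a := X₀) (b := X₁ + inclX r) constantCoeff_X₀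
    (by rw [map_add, constantCoeff_X₁, hr', add_zero])
  have hb0 := constantCoeff_pair (a := X₀) (b := X₁ - inclX r) constantCoeff_X₀
    (by rw [map_sub, constantCoeff_X₁, hr', sub_zero])
  have ha := hasSubst_of_zero ha0
  have hb := hasSubst_of_zero hb0
  have hc : ∀ i, PowerSeries.constantCoeff ((![PowerSeries.X, 0] : Fin 2 → PowerSeries ℂ) i) = 0 :=
    constantCoeff_pair (τ := Unit) PowerSeries.constantCoeff_X (map_zero _)
  -- The shears `y ↦ y ± r(x)` are inverse to each other and reduce the claim to divisibility by
  -- `y`.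
  have hBA : MvPowerSeries.subst ![X₀, X₁ - inclX r]
      (MvPowerSeries.subst ![X₀, X₁ + inclX r] f) = f := by
    rw [MvPowerSeries.subst_comp_subst_apply ha hb]
    have : (fun i => MvPowerSeries.subst ![X₀, X₁ - inclX r] (![X₀, X₁ + inclX r] i)) =
        MvPowerSeries.X := by
      funext i
      fin_cases i
      · exact subst_X₀ hb
      · simp only [Fin.mk_one, Matrix.cons_val_one, Matrix.cons_val_zero]
        rw [MvPowerSeries.subst_add hb, subst_inclX hb, subst_X₁ hb]
        exact sub_add_cancel X₁ (inclX r)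
    rw [this, MvPowerSeries.subst_self]; rfl
  have h1 : evalArc ![PowerSeries.X, 0] (MvPowerSeries.subst ![X₀, X₁ + inclX r] f) = 0 := by
    rw [evalArc_mapSubst ha0 hc]
    refine Eq.trans (congrArg (fun γ => evalArc γ f) ?_) hf
    funext i
    fin_cases i
    · simp only [Fin.zero_eta, Matrix.cons_val_zero]
      exact evalArc_X₀ hc
    · simp only [Fin.mk_one, Matrix.cons_val_one, Matrix.cons_val_zero]
      rw [evalArc_add hc, evalArc_inclX hc, evalArc_X₁ hc]
      simp [PowerSeries.X_subst]
  obtain ⟨q, hq⟩ := X₁_dvd_of_evalArc h1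
  rw [← hBA, hq, MvPowerSeries.subst_mul hb, subst_X₁ hb]
  exact Dvd.intro _ rfl

theorem constantCoeff_X_pair {r : PowerSeries ℂ} (hr : PowerSeries.constantCoeff r = 0)
    (i : Fin 2) :
    PowerSeries.constantCoeff ((![PowerSeries.X, r] : Fin 2 → PowerSeries ℂ) i) = 0 :=
  constantCoeff_pair (τ := Unit) PowerSeries.constantCoeff_X hr i

theorem evalArc_X₁_sub {r r' : PowerSeries ℂ} (hr : PowerSeries.constantCoeff r = 0) :
    evalArc ![PowerSeries.X, r] (X₁ - inclX r') = r - r' := by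
  have hc := constantCoeff_X_pair hr
  rw [evalArc_sub hc, evalArc_inclX hc, X₁, evalArc_X hc]
  simp [PowerSeries.X_subst]

/-- On the arc `(s, r i)` the factors already split off restrict to the nonzero series `r i - r j`,
so it is the remaining quotient that vanishes there. -/
theorem prod_X₁_sub_dvd {ι : Type*} (s : Finset ι) {r : ι → PowerSeries ℂ}
    (hr : ∀ i, PowerSeries.constantCoeff (r i) = 0) (hinj : Set.InjOn r s) {f : Series2}
    (hf : ∀ i ∈ s, evalArc ![PowerSeries.X, r i] f = 0) : ∏ i ∈ s, (X₁ - inclX (r i)) ∣ f := by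
  classical
  induction s using Finset.induction_on with
  | empty => simp
  | insert i s hi ih =>
    obtain ⟨q, hq⟩ := ih (hinj.mono (by simp)) fun j hj => hf j (Finset.mem_insert_of_mem hj)
    have hc := constantCoeff_X_pair (hr i)
    have h1 := hf i (Finset.mem_insert_self _ _)
    rw [hq, evalArc_mul hc, evalArc_prod hc] at h1
    rcases mul_eq_zero.1 h1 with h1 | h1
    · obtain ⟨j, hj, h2⟩ := Finset.prod_eq_zero_iff.1 h1
      rw [evalArc_X₁_sub (hr i), sub_eq_zero] at h2
      have := hinj (by simp) (by simp [hj]) h2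
      exact absurd (this ▸ hj) hi
    · obtain ⟨w, hw⟩ := X₁_sub_dvd_of_evalArc (hr i) h1
      rw [Finset.prod_insert hi, hq, hw]
      exact ⟨w, by ring⟩

theorem prod_X₁_sub_ne_zero {ι : Type*} (s : Finset ι) (r : ι → PowerSeries ℂ) :
    ∏ i ∈ s, (X₁ - inclX (r i)) ≠ 0 := by
  rw [Finset.prod_ne_zero_iff]
  intro i _ h
  have := congrArg (MvPowerSeries.coeff (Finsupp.single 1 1)) h
  rw [map_sub, coeff_inclX, X₁, MvPowerSeries.coeff_X] at this
  simp at this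

/-! ### Ramification `x ↦ x ^ ν` -/

/-- The substitution `f(x, y) ↦ f(x ^ ν, y)`. -/
def ramify (ν : ℕ) (f : Series2) : Series2 := MvPowerSeries.subst ![X₀ ^ ν, X₁] f

theorem ramify_prod (ν : ℕ) (e : Fin 2 →₀ ℕ) :
    (e.prod fun s e => (![X₀ ^ ν, X₁] : Fin 2 → Series2) s ^ e) =
      MvPowerSeries.monomial (Finsupp.single 0 (ν * e 0) + Finsupp.single 1 (e 1)) 1 := by
  rw [Finsupp.prod_fintype _ _ (by simp), Fin.prod_univ_two]
  simp only [Matrix.cons_val_zero, Matrix.cons_val_one]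
  rw [← pow_mul, X₀, X₁, MvPowerSeries.X_pow_eq, MvPowerSeries.X_pow_eq,
    MvPowerSeries.monomial_mul_monomial, one_mul]

section ramify
variable {ν : ℕ} (hν : ν ≠ 0)
include hν

theorem constantCoeff_ramify (i : Fin 2) :
    MvPowerSeries.constantCoeff ((![X₀ ^ ν, X₁] : Fin 2 → Series2) i) = 0 :=
  constantCoeff_pair (by rw [map_pow, constantCoeff_X₀, zero_pow hν]) constantCoeff_X₁ i

theorem hasSubst_ramify : MvPowerSeries.HasSubst (![X₀ ^ ν, X₁] : Fin 2 → Series2) :=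
  hasSubst_of_zero (constantCoeff_ramify hν)

theorem coeff_ramify (f : Series2) (n d : Fin 2 →₀ ℕ) (h0 : n 0 = ν * d 0) (h1 : n 1 = d 1) :
    MvPowerSeries.coeff n (ramify ν f) = MvPowerSeries.coeff d f := by
  classical
  rw [ramify, MvPowerSeries.coeff_subst (hasSubst_ramify hν), finsum_eq_single _ d]
  · have : Finsupp.single 0 (ν * d 0) + Finsupp.single 1 (d 1) = n := by
      rw [Finsupp.ext_iff]; simp [Fin.forall_fin_two, h0, h1]
    rw [ramify_prod, this, MvPowerSeries.coeff_monomial_same, smul_eq_mul, mul_one]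
  · intro e he
    rw [ramify_prod, MvPowerSeries.coeff_monomial, if_neg, smul_zero]
    intro h
    apply he
    have e0 := DFunLike.congr_fun h 0
    have e1 := DFunLike.congr_fun h 1
    simp only [Finsupp.add_apply, Finsupp.single_eq_same] at e0 e1
    rw [h0] at e0
    rw [h1] at e1
    rw [Finsupp.ext_iff, Fin.forall_fin_two]
    refine ⟨?_, ?_⟩
    · simp at e0; tauto
    · simp at e1; tauto

theorem coeff_ramify_of_not_dvd (f : Series2) (n : Fin 2 →₀ ℕ) (h : ¬ ν ∣ n 0) :
    MvPowerSeries.coeff n (ramify ν f) = 0 := by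
  classical
  rw [ramify, MvPowerSeries.coeff_subst (hasSubst_ramify hν)]
  refine finsum_eq_zero_of_forall_eq_zero fun e => ?_
  rw [ramify_prod, MvPowerSeries.coeff_monomial, if_neg, smul_zero]
  rintro rfl
  simp at h

theorem ramify_mul (f g : Series2) : ramify ν (f * g) = ramify ν f * ramify ν g :=
  MvPowerSeries.subst_mul (hasSubst_ramify hν) f g

theorem ramify_injective : Function.Injective (ramify ν) := by
  intro f g h
  ext d
  have hn : ∃ n : Fin 2 →₀ ℕ, n 0 = ν * d 0 ∧ n 1 = d 1 :=
    ⟨Finsupp.single 0 (ν * d 0) + Finsupp.single 1 (d 1), by simp, by simp⟩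
  obtain ⟨n, h0, h1⟩ := hn
  rw [← coeff_ramify hν f n d h0 h1, ← coeff_ramify hν g n d h0 h1, h]

/-- With `coeff_ramify_of_not_dvd` this describes the image of ramification, and lets a quotient of
ramified series descend. -/
theorem exists_ramify_eq {q : Series2} (hq : ∀ n, ¬ ν ∣ n 0 → MvPowerSeries.coeff n q = 0) :
    ∃ f, ramify ν f = q := by
  let f : Series2 := fun d =>
    MvPowerSeries.coeff (Finsupp.single 0 (ν * d 0) + Finsupp.single 1 (d 1)) q
  refine ⟨f, ?_⟩
  ext n
  by_cases h : ν ∣ n 0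
  · obtain ⟨k, hk⟩ := h
    rw [coeff_ramify hν _ n (Finsupp.single 0 k + Finsupp.single 1 (n 1)) (by simp [hk]) (by simp)]
    change MvPowerSeries.coeff _ q = _
    congr 2
    rw [Finsupp.ext_iff]; simp [Fin.forall_fin_two, hk]
  · rw [coeff_ramify_of_not_dvd hν _ _ h, hq n h]

end ramify

/-- The equation of the arc `(s ^ ν, y(s))`, in terms of the conjugates of `y`. -/
theorem evalArc_puiseux_eq_zero_iff {ν : ℕ} (hν : ν ≠ 0) {ζ : ℂ} (hζ : IsPrimitiveRoot ζ ν)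
    {y : PowerSeries ℂ} (hy : PowerSeries.constantCoeff y = 0)
    (hinj : Set.InjOn (fun i : ℕ => PowerSeries.rescale (ζ ^ i) y) (Finset.range ν))
    {H : Series2}
    (hH : ramify ν H = ∏ i ∈ Finset.range ν, (X₁ - inclX (PowerSeries.rescale (ζ ^ i) y)))
    (f : Series2) : evalArc ![PowerSeries.X ^ ν, y] f = 0 ↔ H ∣ f := by
  have hr : ∀ i : ℕ, PowerSeries.constantCoeff (PowerSeries.rescale (ζ ^ i) y) = 0 := by
    intro i
    rw [← PowerSeries.coeff_zero_eq_constantCoeff_apply, PowerSeries.coeff_rescale,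
      PowerSeries.coeff_zero_eq_constantCoeff_apply, hy, mul_zero]
  have hcν : ∀ {r : PowerSeries ℂ}, PowerSeries.constantCoeff r = 0 → ∀ i,
      PowerSeries.constantCoeff ((![PowerSeries.X ^ ν, r] : Fin 2 → PowerSeries ℂ) i) = 0 :=
    fun hr => constantCoeff_pair (τ := Unit) (by
      change PowerSeries.constantCoeff _ = _
      rw [map_pow, PowerSeries.constantCoeff_X, zero_pow hν]) hr
  have key : ∀ (g : Series2) {r : PowerSeries ℂ}, PowerSeries.constantCoeff r = 0 →
      evalArc ![PowerSeries.X, r] (ramify ν g) = evalArc ![PowerSeries.X ^ ν, r] g := by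
    intro g r hr
    have hc := constantCoeff_X_pair hr
    rw [ramify, evalArc_mapSubst (constantCoeff_ramify hν) hc]
    congr 1
    funext i
    fin_cases i
    · simp only [Fin.zero_eta, Matrix.cons_val_zero]
      rw [evalArc_pow hc, X₀, evalArc_X hc]; rfl
    · simp only [Fin.mk_one, Matrix.cons_val_one, Matrix.cons_val_zero]
      rw [X₁, evalArc_X hc]; rfl
  -- Rotating the parameter by `ζ ^ i` fixes `s ^ ν`, so an equation of the arc is an equation of
  -- all its conjugates.
  have hconj : ∀ i : ℕ, evalArc ![PowerSeries.X ^ ν, PowerSeries.rescale (ζ ^ i) y] f =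
      PowerSeries.rescale (ζ ^ i) (evalArc ![PowerSeries.X ^ ν, y] f) := by
    intro i
    have h0 : PowerSeries.constantCoeff (ζ ^ i • PowerSeries.X : PowerSeries ℂ) = 0 := by
      simp
    rw [PowerSeries.rescale_eq_subst, PowerSeries.rescale_eq_subst, ← evalArc_subst (hcν hy) h0]
    congr 1
    funext j
    fin_cases j
    · simp only [Fin.zero_eta, Matrix.cons_val_zero]
      rw [PowerSeries.subst_pow (hasSubst_one h0), subst1_X h0, smul_pow, ← pow_mul, mul_comm i,
        pow_mul, hζ.pow_eq_one, one_pow, one_smul]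
    · rfl
  have hH0 : ramify ν H ≠ 0 := by rw [hH]; exact prod_X₁_sub_ne_zero _ _
  constructor
  · intro hf
    have h1 : ∏ i ∈ Finset.range ν, (X₁ - inclX (PowerSeries.rescale (ζ ^ i) y)) ∣ ramify ν f := by
      refine prod_X₁_sub_dvd _ hr hinj fun i _ => ?_
      rw [key f (hr i), hconj, hf, map_zero]
    rw [← hH] at h1
    obtain ⟨q, hq⟩ := h1
    -- The rotation `x ↦ ζ x` fixes every ramified series, hence also the quotient `q` of two of
    -- them; so `q` involves only powers of `x ^ ν` and the divisibility descends to `H ∣ f`.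
    let S : Series2 →+* Series2 := MvPowerSeries.rescale ![ζ, 1]
    have hS : ∀ (g : Series2) (n : Fin 2 →₀ ℕ), MvPowerSeries.coeff n (S g) =
        ζ ^ n 0 * MvPowerSeries.coeff n g := by
      intro g n
      rw [MvPowerSeries.coeff_rescale, Finsupp.prod_fintype _ _ (by simp), Fin.prod_univ_two]
      simp
    have hSr : ∀ g, S (ramify ν g) = ramify ν g := by
      intro g
      ext n
      rw [hS]
      by_cases h : ν ∣ n 0
      · rw [(hζ.pow_eq_one_iff_dvd _).2 h, one_mul]
      · rw [coeff_ramify_of_not_dvd hν _ _ h, mul_zero]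
    have hq2 : S q = q := by
      have := congrArg S hq
      rw [map_mul, hSr, hSr, hq] at this
      exact (mul_left_cancel₀ hH0 this).symm
    obtain ⟨w, hw⟩ := exists_ramify_eq hν (q := q) (fun n hn => by
      have := hS q n
      rw [hq2] at this
      by_contra h0
      exact hn ((hζ.pow_eq_one_iff_dvd _).1 (mul_right_cancel₀ h0 (by rw [one_mul]; exact this.symm))))
    refine ⟨w, ramify_injective hν ?_⟩
    rw [ramify_mul hν, hw, hq]
  · rintro ⟨q, rfl⟩
    rw [evalArc_mul (hcν hy), ← key H hy, hH, evalArc_prod (constantCoeff_X_pair hy),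
      Finset.prod_eq_zero (Finset.mem_range.2 (Nat.pos_of_ne_zero hν)), zero_mul]
    rw [evalArc_X₁_sub hy, pow_zero, PowerSeries.rescale_one]
    simp

/-! ### Convergent equations of Puiseux arcs -/

theorem analyticAt_cpow_const {v : ℂ → ℂ} (hv : AnalyticAt ℂ v 0) (h : v 0 = 1) (c : ℂ) :
    AnalyticAt ℂ (fun s => v s ^ c) 0 :=
  hv.cpow analyticAt_const (by rw [h]; exact Complex.one_mem_slitPlane)

theorem exists_pow_eq (x : ℂ) {μ : ℕ} (hμ : μ ≠ 0) : ∃ c : ℂ, c ^ μ = x :=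
  ⟨x ^ (1 / μ : ℂ), by rw [one_div]; exact Complex.cpow_nat_inv_pow x hμ⟩

/-- A local inverse of an analytic function of one variable. -/
theorem exists_local_inverse {χ : ℂ → ℂ} (hχ : AnalyticAt ℂ χ 0) (h0 : χ 0 = 0)
    (h1 : deriv χ 0 ≠ 0) : ∃ ψ : ℂ → ℂ, AnalyticAt ℂ ψ 0 ∧ ψ 0 = 0 ∧
      (∀ᶠ s in 𝓝 0, ψ (χ s) = s) ∧ ∀ᶠ t in 𝓝 0, χ (ψ t) = t := by
  have hs := hχ.hasStrictDerivAt
  refine ⟨hs.localInverse _ _ _ h1, ?_, ?_, hs.eventually_left_inverse h1, ?_⟩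
  · have := hχ.analyticAt_localInverse h1
    rwa [h0] at this
  · have : hs.localInverse _ _ _ h1 (χ 0) = 0 := HasStrictFDerivAt.localInverse_apply_image ..
    rwa [h0] at this
  · have := hs.eventually_right_inverse h1
    rwa [h0] at this

/-- A function vanishing to order `μ` is the `μ`-th power of a local coordinate. -/
theorem exists_coordinate {v : ℂ → ℂ} (hv : AnalyticAt ℂ v 0) (hv0 : v 0 ≠ 0) {μ : ℕ}
    (hμ : μ ≠ 0) : ∃ χ : ℂ → ℂ, AnalyticAt ℂ χ 0 ∧ χ 0 = 0 ∧ deriv χ 0 ≠ 0 ∧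
      ∀ s, χ s ^ μ = s ^ μ * v s := by
  -- The root of `v 0` is taken apart so that the principal branch is applied only to `v / v 0`,
  -- which is near `1`.
  obtain ⟨c, hc⟩ := exists_pow_eq (v 0) hμ
  have hc0 : c ≠ 0 := by rintro rfl; rw [zero_pow hμ] at hc; exact hv0 hc.symm
  have hw : AnalyticAt ℂ (fun s => (v s / v 0) ^ (1 / μ : ℂ)) 0 :=
    analyticAt_cpow_const (v := fun s => v s / v 0) (hv.fun_div analyticAt_const hv0)
      (div_self hv0) _
  have hcw : AnalyticAt ℂ (fun s => c * (v s / v 0) ^ (1 / μ : ℂ)) 0 := analyticAt_const.fun_mul hw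
  refine ⟨fun s => s * (c * (v s / v 0) ^ (1 / μ : ℂ)), analyticAt_var.fun_mul hcw, by simp, ?_, ?_⟩
  · have h := (hasDerivAt_id (0 : ℂ)).mul hcw.differentiableAt.hasDerivAt
    have h2 := h.deriv
    simp only [id, one_mul, zero_mul, add_zero, div_self hv0, Complex.one_cpow, mul_one] at h2
    have : deriv (fun s => s * (c * (v s / v 0) ^ (1 / μ : ℂ))) 0 = c := h2
    rw [this]; exact hc0
  · intro s
    rw [mul_pow, mul_pow, hc, one_div, Complex.cpow_nat_inv_pow _ hμ, mul_div_cancel₀ _ hv0]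

/-- An analytic function that is invariant by rotation of order `ν` is a function of `s ^ ν`. -/
theorem exists_eq_comp_pow {e : ℂ → ℂ} (he : AnalyticAt ℂ e 0) {ν : ℕ} (hν : ν ≠ 0) {ζ : ℂ}
    (hζ : IsPrimitiveRoot ζ ν) (hinv : ∀ᶠ s in 𝓝 0, e (ζ * s) = e s) :
    ∃ a : ℂ → ℂ, AnalyticAt ℂ a 0 ∧ ∀ᶠ s in 𝓝 0, a (s ^ ν) = e s := by
  obtain ⟨r, hr, hall⟩ := exists_ball_of_eventually (hinv.and he.eventually_analyticAt)
  have hζ1 : ‖ζ‖ = 1 := hζ.norm'_eq_one hν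
  have hi : ∀ (i : ℕ) (s : ℂ), ‖s‖ < r → e (ζ ^ i * s) = e s := by
    intro i s hs
    induction i with
    | zero => simp
    | succ i ih =>
      rw [pow_succ', mul_assoc, (hall _ _).1, ih]
      rwa [norm_mul, norm_pow, hζ1, one_pow, one_mul]
  -- The discontinuity of the principal branch is harmless: two `ν`-th roots differ by a power of
  -- `ζ`, under which `e` is invariant.
  let a : ℂ → ℂ := fun x => e (x ^ (1 / ν : ℂ))
  have hroot : ∀ x : ℂ, (x ^ (1 / ν : ℂ)) ^ ν = x := fun x => by
    rw [one_div]; exact Complex.cpow_nat_inv_pow x hν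
  have hν0 : (0 : ℝ) < 1 / ν := by positivity
  have ha : ∀ s : ℂ, ‖s‖ < r → a (s ^ ν) = e s := by
    intro s hs
    rcases eq_or_ne s 0 with rfl | hs0
    · simp only [a, zero_pow hν]
      rw [Complex.zero_cpow]
      simpa using hν
    · have h1 : ((s ^ ν) ^ (1 / ν : ℂ) / s) ^ ν = 1 := by
        rw [div_pow, hroot, div_self (pow_ne_zero _ hs0)]
      have : NeZero ν := ⟨hν⟩
      obtain ⟨i, -, h2⟩ := hζ.eq_pow_of_pow_eq_one h1
      have h3 : (s ^ ν) ^ (1 / ν : ℂ) = ζ ^ i * s := by rw [h2]; field_simp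
      simp only [a]
      rw [h3, hi i s hs]
  have hev : ∀ᶠ s : ℂ in 𝓝 0, ‖s‖ < r :=
    continuousAt_id.norm.eventually_lt_const (by simpa using hr)
  have hcpow : ContinuousAt (fun x : ℂ => x ^ (1 / ν : ℂ)) 0 := by
    refine Complex.continuousAt_cpow_const_of_re_pos (Or.inl le_rfl) ?_
    rw [← Complex.ofReal_natCast, ← Complex.ofReal_one, ← Complex.ofReal_div, Complex.ofReal_re]
    exact hν0
  have h0 : (0 : ℂ) ^ (1 / ν : ℂ) = 0 := Complex.zero_cpow (by simpa using hν)
  refine ⟨a, ?_, hev.mono ha⟩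
  -- Off `0` the map `t ↦ t ^ ν` is locally biholomorphic, so `a` inherits the analyticity of `e`;
  -- at `0` continuity suffices, by removability of singularities.
  refine Complex.analyticAt_of_differentiable_on_punctured_nhds_of_continuousAt ?_ ?_
  · have h4 : ∀ᶠ x : ℂ in 𝓝 0, ‖x ^ (1 / ν : ℂ)‖ < r :=
      hcpow.norm.eventually_lt_const (by simpa only [h0, norm_zero] using hr)
    filter_upwards [h4.filter_mono nhdsWithin_le_nhds, self_mem_nhdsWithin] with x hx hx0
    set s := x ^ (1 / ν : ℂ) with hs
    have hsx : s ^ ν = x := hroot x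
    have hs0 : s ≠ 0 := by
      intro h
      rw [h, zero_pow hν] at hsx
      exact hx0 hsx.symm
    have hp : AnalyticAt ℂ (fun t : ℂ => t ^ ν) s := by fun_prop
    have hd : deriv (fun t : ℂ => t ^ ν) s ≠ 0 := by
      rw [deriv_pow_field]
      exact mul_ne_zero (by exact_mod_cast hν) (pow_ne_zero _ hs0)
    have h5 : AnalyticAt ℂ (a ∘ fun t : ℂ => t ^ ν) s := by
      refine (hall s hx).2.congr ?_
      have : ∀ᶠ t in 𝓝 s, ‖t‖ < r := continuousAt_id.norm.eventually_lt_const hx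
      exact this.mono fun t ht => (ha t ht).symm
    have h6 := (analyticAt_comp_iff_of_deriv_ne_zero hp hd).1 h5
    simp only [hsx] at h6
    exact h6.differentiableAt
  · have : ContinuousAt e ((0 : ℂ) ^ (1 / ν : ℂ)) := by rw [h0]; exact he.continuousAt
    exact ContinuousAt.comp (f := fun x : ℂ => x ^ (1 / ν : ℂ)) this hcpow

theorem prod_range_shift {M : Type*} [CommMonoid M] (f : ℕ → M) {ν : ℕ} (h : f ν = f 0) :
    ∏ i ∈ Finset.range ν, f (i + 1) = ∏ i ∈ Finset.range ν, f i := by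
  rcases ν with _ | k
  · rfl
  · rw [Finset.prod_range_succ, Finset.prod_range_succ', h]

theorem analyticAt_coeff_prod {ι : Type*} (s : Finset ι) {r : ι → ℂ → ℂ}
    (hr : ∀ i, AnalyticAt ℂ (r i) 0) (j : ℕ) :
    AnalyticAt ℂ (fun t => (∏ i ∈ s, (Polynomial.X - Polynomial.C (r i t))).coeff j) 0 := by
  classical
  induction s using Finset.induction_on generalizing j with
  | empty => simp only [Finset.prod_empty]; exact analyticAt_const
  | insert i s hi ih =>
    simp only [Finset.prod_insert hi, sub_mul, Polynomial.coeff_sub, Polynomial.coeff_C_mul]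
    refine AnalyticAt.fun_sub ?_ ((hr i).fun_mul (ih j))
    rcases j with _ | j
    · simp only [Polynomial.coeff_X_mul_zero]; exact analyticAt_const
    · simp only [Polynomial.coeff_X_mul]; exact ih j

theorem analyticAt_rotate {y : ℂ → ℂ} (hy : AnalyticAt ℂ y 0) (c : ℂ) :
    AnalyticAt ℂ (fun t => y (c * t)) 0 :=
  AnalyticAt.fun_comp (by rwa [mul_zero]) (analyticAt_const.fun_mul analyticAt_var)

/-- The product of `Y - y(ζ ^ i t)` is an analytic function of `t ^ ν` and `Y`. -/
theorem exists_analytic_prod {ν : ℕ} (hν : ν ≠ 0) {ζ : ℂ} (hζ : IsPrimitiveRoot ζ ν) {y : ℂ → ℂ}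
    (hy : AnalyticAt ℂ y 0) : ∃ h : ℂ × ℂ → ℂ, AnalyticAt ℂ h 0 ∧
      ∀ᶠ t in 𝓝 0, ∀ Y, h (t ^ ν, Y) = ∏ i ∈ Finset.range ν, (Y - y (ζ ^ i * t)) := by
  let Q : ℂ → Polynomial ℂ := fun t =>
    ∏ i ∈ Finset.range ν, (Polynomial.X - Polynomial.C (y (ζ ^ i * t)))
  -- Rotation of `t` permutes the factors cyclically, so the coefficients of `Q` are functions of `t
  -- ^ ν`.
  have hQinv : ∀ t, Q (ζ * t) = Q t := by
    intro t
    have h := prod_range_shift (fun i => Polynomial.X - Polynomial.C (y (ζ ^ i * t))) (ν := ν)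
      (by rw [hζ.pow_eq_one, pow_zero])
    refine Eq.trans (Finset.prod_congr rfl fun i _ => ?_) h
    rw [pow_succ, mul_assoc]
  have hQa : ∀ j, AnalyticAt ℂ (fun t => (Q t).coeff j) 0 := fun j =>
    analyticAt_coeff_prod (Finset.range ν) (r := fun i t => y (ζ ^ i * t))
      (fun i => analyticAt_rotate hy _) j
  choose a ha hae using fun j => exists_eq_comp_pow (hQa j) hν hζ
    (Eventually.of_forall fun s => by rw [hQinv])
  have hdeg : ∀ t, (Q t).natDegree < ν + 1 := by
    intro t
    rw [Polynomial.natDegree_prod_of_monic _ _ fun i _ => Polynomial.monic_X_sub_C _]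
    simp
  refine ⟨fun p => ∑ j ∈ Finset.range (ν + 1), a j p.1 * p.2 ^ j, ?_, ?_⟩
  · refine Finset.analyticAt_fun_sum _ fun j _ => ?_
    have h1 : AnalyticAt ℂ (fun p : ℂ × ℂ => a j p.1) 0 := (ha j).comp_of_eq analyticAt_fst rfl
    exact h1.fun_mul (analyticAt_snd.fun_pow j)
  · have : ∀ᶠ t in 𝓝 (0 : ℂ), ∀ j ∈ Finset.range (ν + 1), a j (t ^ ν) = (Q t).coeff j :=
      (Finset.eventually_all _).2 fun j _ => hae j
    filter_upwards [this] with t ht Y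
    calc ∑ j ∈ Finset.range (ν + 1), a j (t ^ ν) * Y ^ j
        = ∑ j ∈ Finset.range (ν + 1), (Q t).coeff j * Y ^ j :=
          Finset.sum_congr rfl fun j hj => by rw [ht j hj]
      _ = (Q t).eval Y := (Polynomial.eval_eq_sum_range' (hdeg t) Y).symm
      _ = _ := by simp [Q, Polynomial.eval_prod]

theorem taylor_comp_fst (u : ℂ → ℂ) :
    taylor (fun p => u p.1) = inclX (taylor1 u) := by
  ext n
  rw [coeff_taylor, coeff_inclX]
  have : sliceCoeff (fun p => u p.1) (n 1) = fun x => if n 1 = 0 then u x else 0 := by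
    ext x; simp only [sliceCoeff, taylor1_const, PowerSeries.coeff_C]
  rw [this]
  split_ifs
  · rfl
  · simp [taylor1_const]

/-- A Puiseux arc that is injective near the origin has a convergent equation that generates the
ideal of all formal equations. -/
theorem exists_puiseux_equation {ν : ℕ} (hν : ν ≠ 0) {ζ : ℂ} (hζ : IsPrimitiveRoot ζ ν) {y : ℂ → ℂ}
    (hy : AnalyticAt ℂ y 0) (hy0 : y 0 = 0)
    (hinj : ∃ U ∈ 𝓝 (0 : ℂ), Set.InjOn (fun t => (t ^ ν, y t)) U) :
    ∃ h : ℂ × ℂ → ℂ, AnalyticAt ℂ h 0 ∧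
      (∀ᶠ t in 𝓝 0, ∀ Y, h (t ^ ν, Y) = ∏ i ∈ Finset.range ν, (Y - y (ζ ^ i * t))) ∧
      taylor h ≠ 0 ∧ ∀ f, evalArc (taylorArc fun t => (t ^ ν, y t)) f = 0 ↔ taylor h ∣ f := by
  obtain ⟨h, hh, he⟩ := exists_analytic_prod hν hζ hy
  have hram : ramify ν (taylor h) =
      ∏ i ∈ Finset.range ν, (X₁ - inclX (PowerSeries.rescale (ζ ^ i) (taylor1 y))) := by
    have hG : AnalyticAt ℂ (fun p : ℂ × ℂ => (p.1 ^ ν, p.2)) 0 :=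
      (analyticAt_fst.fun_pow ν).prod analyticAt_snd
    have hG0 : (fun p : ℂ × ℂ => (p.1 ^ ν, p.2)) 0 = 0 := by simp [hν]
    have hTG : taylorMap (fun p : ℂ × ℂ => (p.1 ^ ν, p.2)) = ![X₀ ^ ν, X₁] := by
      simp only [taylorMap, taylor_pow analyticAt_fst, taylor_fst, taylor_snd]
    have h1 := taylor_comp hh hG hG0
    rw [hTG] at h1
    rw [ramify, ← h1]
    have h2 : (fun p : ℂ × ℂ => h (p.1 ^ ν, p.2)) =ᶠ[𝓝 0]
        fun p => ∏ i ∈ Finset.range ν, (p.2 - y (ζ ^ i * p.1)) :=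
      ((continuous_fst.tendsto (0 : ℂ × ℂ)).eventually he).mono fun p hp => hp p.2
    have h3 : ∀ i, AnalyticAt ℂ (fun p : ℂ × ℂ => y (ζ ^ i * p.1)) 0 := fun i =>
      (analyticAt_rotate hy (ζ ^ i)).comp_of_eq analyticAt_fst rfl
    rw [taylor_congr h2, taylor_prod _ fun i => analyticAt_snd.fun_sub (h3 i)]
    refine Finset.prod_congr rfl fun i _ => ?_
    rw [taylor_sub analyticAt_snd (h3 i), taylor_snd,
      taylor_comp_fst (fun t => y (ζ ^ i * t)), taylor1_mul_left hy]
  have hne : taylor h ≠ 0 := by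
    intro h0
    refine prod_X₁_sub_ne_zero (Finset.range ν)
      (fun i => PowerSeries.rescale (ζ ^ i) (taylor1 y)) ?_
    rw [← hram, h0, ramify, ← MvPowerSeries.coe_substAlgHom (hasSubst_ramify hν), map_zero]
  refine ⟨h, hh, he, hne, ?_⟩
  have hT : taylorArc (fun t => (t ^ ν, y t)) = ![PowerSeries.X ^ ν, taylor1 y] := by
    simp only [taylorArc, taylor1_id_pow]
  rw [hT]
  refine evalArc_puiseux_eq_zero_iff hν hζ (by rw [constantCoeff_taylor1, hy0]) ?_ hram
  · obtain ⟨U, hU, hinj⟩ := hinj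
    intro i hi j hj hij
    simp only at hij
    rw [← taylor1_mul_left hy, ← taylor1_mul_left hy,
      taylor1_inj (analyticAt_rotate hy _) (analyticAt_rotate hy _)] at hij
    have h1 := hij.and ((eventually_mul_left hU (ζ ^ i)).and (eventually_mul_left hU (ζ ^ j)))
    obtain ⟨t, ⟨ht, hti, htj⟩, ht0⟩ :=
      ((h1.filter_mono nhdsWithin_le_nhds).and (self_mem_nhdsWithin (s := {(0 : ℂ)}ᶜ))).exists
    have hp : ∀ k, (ζ ^ k * t) ^ ν = t ^ ν := fun k => by
      rw [mul_pow, ← pow_mul, mul_comm k, pow_mul, hζ.pow_eq_one, one_pow, one_mul]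
    have h2 := hinj hti htj (by simp only [hp, ht])
    exact hζ.pow_inj (by simpa using hi) (by simpa using hj) (mul_right_cancel₀ ht0 h2)

/-! ### Equations of arcs -/

/-- A bounded holomorphic function on a disc is dominated by the product of the linear factors of
zeros that it has in the disc of half the radius. -/
theorem norm_le_prod_of_zeros {ι : Type*} (s : Finset ι) {r : ι → ℂ} (hinj : Set.InjOn r s) {R : ℝ}
    (hR : 0 < R) (hr : ∀ i ∈ s, ‖r i‖ < R / 2) {u : ℂ → ℂ} {M : ℝ}
    (hu : DifferentiableOn ℂ u (Metric.ball 0 R)) (hM : ∀ z ∈ Metric.ball (0 : ℂ) R, ‖u z‖ ≤ M)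
    (hz : ∀ i ∈ s, u (r i) = 0) :
    ∀ z ∈ Metric.ball (0 : ℂ) R, ‖u z‖ ≤ M * (2 / R) ^ s.card * ∏ i ∈ s, ‖z - r i‖ := by
  classical
  induction s using Finset.induction_on generalizing u M with
  | empty => simpa using hM
  | insert i s hi ih =>
    intro z hz0
    set a := r i with ha
    have har : ‖a‖ < R / 2 := hr i (Finset.mem_insert_self _ _)
    have hua : u a = 0 := hz i (Finset.mem_insert_self _ _)
    have hamem : a ∈ Metric.ball (0 : ℂ) R := by
      rw [mem_ball_zero_iff]; linarith
    have hsub : Metric.ball a (R / 2) ⊆ Metric.ball (0 : ℂ) R := by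
      refine Metric.ball_subset_ball' ?_
      rw [dist_zero_right]; linarith
    have hw : DifferentiableOn ℂ (dslope u a) (Metric.ball 0 R) :=
      (Complex.differentiableOn_dslope (Metric.isOpen_ball.mem_nhds hamem)).2 hu
    -- Division by `z - a` multiplies the bound by `2 / R`: by the Schwarz lemma on the disc of
    -- radius `R / 2` about `a`, and because `|z - a| ≥ R / 2` outside it.
    have hwM : ∀ z ∈ Metric.ball (0 : ℂ) R, ‖dslope u a z‖ ≤ M * (2 / R) := by
      intro z hz1
      have e : M * (2 / R) = M / (R / 2) := by field_simp
      rw [e]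
      by_cases hza : z ∈ Metric.ball a (R / 2)
      · refine Complex.norm_dslope_le_div_of_mapsTo_ball (hu.mono hsub) ?_ hza
        intro w hw1
        rw [hua, mem_closedBall_zero_iff]
        exact hM w (hsub hw1)
      · rw [Metric.mem_ball, not_lt, dist_eq_norm] at hza
        have hne : z ≠ a := by
          rintro rfl
          rw [sub_self, norm_zero] at hza
          linarith
        have hpos : 0 < ‖z - a‖ := norm_pos_iff.2 (sub_ne_zero.2 hne)
        rw [dslope_of_ne _ hne, slope_def_field, hua, sub_zero, norm_div]
        exact div_le_div₀ ((norm_nonneg _).trans (hM z hz1)) (hM z hz1) (by positivity) hza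
    have h1 := ih (hinj.mono (by simp)) (fun j hj => hr j (Finset.mem_insert_of_mem hj)) hw hwM
      (fun j hj => by
        have hne : r j ≠ a := fun h =>
          hi (hinj (by simp [hj]) (by simp) h ▸ hj)
        rw [dslope_of_ne _ hne, slope_def_field, hua, hz j (Finset.mem_insert_of_mem hj)]
        simp) z hz0
    have h2 : u z = (z - a) * dslope u a z := by
      have := sub_smul_dslope u a z
      rw [hua, sub_zero, smul_eq_mul] at this
      exact this.symm
    rw [h2, norm_mul, Finset.prod_insert hi, Finset.card_insert_of_notMem hi, pow_succ]
    calc ‖z - a‖ * ‖dslope u a z‖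
        ≤ ‖z - a‖ * (M * (2 / R) * (2 / R) ^ s.card * ∏ i ∈ s, ‖z - r i‖) := by gcongr
      _ = _ := by ring

/-- `h` is a reduced equation of the arc `γ`. -/
structure IsEquation (γ : ℂ → ℂ × ℂ) (h : ℂ × ℂ → ℂ) : Prop where
  analyticAt : AnalyticAt ℂ h 0
  evalArc_eq_zero_iff : ∀ f, evalArc (taylorArc γ) f = 0 ↔ taylor h ∣ f
  exists_le : ∀ g : ℂ × ℂ → ℂ, AnalyticAt ℂ g 0 → (∀ᶠ t in 𝓝 0, g (γ t) = 0) →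
    ∃ K : ℝ, ∀ᶠ p in 𝓝 0, ‖g p‖ ≤ K * ‖h p‖
  exists_nhds : ∀ U ∈ 𝓝 (0 : ℂ × ℂ), ∀ r₀ > 0, ∃ V ⊆ U, IsOpen V ∧ (0 : ℂ × ℂ) ∈ V ∧
    ∃ r : ℝ, 0 < r ∧ r ≤ r₀ ∧ zeroSet h V = γ '' Metric.ball 0 r ∧
      ∀ t ∈ Metric.ball (0 : ℂ) r, t ≠ 0 → fderiv ℂ h (γ t) ≠ 0

theorem exists_pow_eq_of_norm_lt {x : ℂ} {r : ℝ} (hr : 0 < r) {ν : ℕ} (hν : ν ≠ 0)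
    (hx : ‖x‖ < r ^ ν) : ∃ t : ℂ, ‖t‖ < r ∧ t ^ ν = x := by
  obtain ⟨t, ht⟩ := exists_pow_eq x hν
  refine ⟨t, lt_of_pow_lt_pow_left₀ ν hr.le ?_, ht⟩
  rwa [← norm_pow, ht]

section puiseux
variable {ν : ℕ} {ζ : ℂ} {y : ℂ → ℂ} {h : ℂ × ℂ → ℂ}

theorem rotate_pow (hζ : IsPrimitiveRoot ζ ν) (k : ℕ) (t : ℂ) : (ζ ^ k * t) ^ ν = t ^ ν := by
  rw [mul_pow, ← pow_mul, mul_comm k, pow_mul, hζ.pow_eq_one, one_pow, one_mul]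

theorem norm_rotate (hν : ν ≠ 0) (hζ : IsPrimitiveRoot ζ ν) (k : ℕ) (t : ℂ) :
    ‖ζ ^ k * t‖ = ‖t‖ := by
  rw [norm_mul, norm_pow, hζ.norm'_eq_one hν, one_pow, one_mul]

theorem injOn_conjugates (hν : ν ≠ 0) (hζ : IsPrimitiveRoot ζ ν) {r : ℝ}
    (hinj : Set.InjOn (fun t => (t ^ ν, y t)) (Metric.ball 0 r)) {t : ℂ} (ht : ‖t‖ < r)
    (ht0 : t ≠ 0) : Set.InjOn (fun i : ℕ => y (ζ ^ i * t)) (Finset.range ν) := by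
  intro i hi j hj hij
  have hm : ∀ k : ℕ, ζ ^ k * t ∈ Metric.ball (0 : ℂ) r := fun k => by
    rwa [mem_ball_zero_iff, norm_rotate hν hζ]
  have h2 := hinj (hm i) (hm j) (by simp only [rotate_pow hζ] at hij ⊢; rw [hij])
  exact hζ.pow_inj (by simpa using hi) (by simpa using hj) (mul_right_cancel₀ ht0 h2)

/-- For fixed `x = t ^ ν ≠ 0` the function `g(x, ·)` vanishes at the `ν` distinct roots of `h(x,
·)`, so `norm_le_prod_of_zeros` bounds it by `h(x, ·)` with a constant that does not depend on `x`.
The line `x = 0`, where the roots collide, is reached by continuity. -/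
theorem exists_le_of_puiseux (hν : ν ≠ 0) (hζ : IsPrimitiveRoot ζ ν) (hy : AnalyticAt ℂ y 0)
    (hy0 : y 0 = 0) (hinj : ∃ U ∈ 𝓝 (0 : ℂ), Set.InjOn (fun t => (t ^ ν, y t)) U)
    (hh : AnalyticAt ℂ h 0)
    (he : ∀ᶠ t in 𝓝 0, ∀ Y, h (t ^ ν, Y) = ∏ i ∈ Finset.range ν, (Y - y (ζ ^ i * t)))
    {g : ℂ × ℂ → ℂ} (hg : AnalyticAt ℂ g 0) (hgz : ∀ᶠ t in 𝓝 0, g (t ^ ν, y t) = 0) :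
    ∃ K : ℝ, ∀ᶠ p in 𝓝 0, ‖g p‖ ≤ K * ‖h p‖ := by
  have hgb : ∀ᶠ p in 𝓝 (0 : ℂ × ℂ), ‖g p‖ < ‖g 0‖ + 1 :=
    hg.continuousAt.norm.eventually_lt_const (lt_add_one _)
  obtain ⟨R, hR, hall⟩ := exists_ball_of_eventually
    ((hgb.and hg.eventually_analyticAt).and hh.eventually_analyticAt)
  obtain ⟨U, hU, hinj⟩ := hinj
  have hyR : ∀ᶠ t in 𝓝 (0 : ℂ), ‖y t‖ < R / 2 :=
    hy.continuousAt.norm.eventually_lt_const (by simpa [hy0] using hR)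
  have htR : ∀ᶠ t : ℂ in 𝓝 (0 : ℂ), ‖t ^ ν‖ < R :=
    (show ContinuousAt (fun t : ℂ => ‖t ^ ν‖) 0 by fun_prop).eventually_lt_const
      (by simpa [hν] using hR)
  obtain ⟨r, hr, hsm⟩ := exists_ball_of_eventually
    ((he.and hgz).and ((hyR.and htR).and (show ∀ᶠ t in 𝓝 (0 : ℂ), t ∈ U from hU)))
  have hinj' : Set.InjOn (fun t => (t ^ ν, y t)) (Metric.ball 0 r) :=
    hinj.mono fun t ht => (hsm t (mem_ball_zero_iff.1 ht)).2.2
  set M := ‖g 0‖ + 1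
  set K := M * (2 / R) ^ ν
  have key : ∀ t : ℂ, ‖t‖ < r → t ≠ 0 → ∀ Y : ℂ, ‖Y‖ < R →
      ‖g (t ^ ν, Y)‖ ≤ K * ‖h (t ^ ν, Y)‖ := by
    intro t ht ht0 Y hY
    have hp : ∀ Y : ℂ, ‖Y‖ < R → ‖(t ^ ν, Y)‖ < R := fun Y hY =>
      max_lt (hsm t ht).2.1.2 hY
    have h1 := norm_le_prod_of_zeros (Finset.range ν) (r := fun i => y (ζ ^ i * t))
      (injOn_conjugates hν hζ hinj' ht ht0) hR
      (fun i _ => (hsm _ (by rwa [norm_rotate hν hζ])).2.1.1)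
      (u := fun Y => g (t ^ ν, Y)) (M := M) (fun Y hY => by
        have hA := (hall _ (hp Y (mem_ball_zero_iff.1 hY))).1.2
        have hd : DifferentiableAt ℂ (fun Y : ℂ => (t ^ ν, Y)) Y := by fun_prop
        exact (DifferentiableAt.comp Y hA.differentiableAt hd).differentiableWithinAt)
      (fun Y hY => (hall _ (hp Y (mem_ball_zero_iff.1 hY))).1.1.le)
      (fun i _ => by
        have h2 := (hsm (ζ ^ i * t) (by rwa [norm_rotate hν hζ])).1.2
        rwa [rotate_pow hζ] at h2) Y (mem_ball_zero_iff.2 hY)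
    rw [(hsm t ht).1.1 Y, norm_prod]
    rwa [Finset.card_range] at h1
  have keyx : ∀ x : ℂ, ‖x‖ < r ^ ν → x ≠ 0 → ∀ Y : ℂ, ‖Y‖ < R → ‖g (x, Y)‖ ≤ K * ‖h (x, Y)‖ := by
    intro x hx hx0 Y hY
    obtain ⟨t, ht, rfl⟩ := exists_pow_eq_of_norm_lt hr hν hx
    exact key t ht (fun h0 => hx0 (by rw [h0, zero_pow hν])) Y hY
  refine ⟨K, ?_⟩
  have hrν : 0 < r ^ ν := by positivity
  have hev : ∀ᶠ p in 𝓝 (0 : ℂ × ℂ), ‖p‖ < min (r ^ ν) R :=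
    continuousAt_id.norm.eventually_lt_const (by simpa using ⟨hrν, hR⟩)
  refine hev.mono fun p hp => ?_
  obtain ⟨hp1, hp2⟩ := lt_min_iff.1 hp
  obtain ⟨x, Y⟩ := p
  have hx : ‖x‖ < r ^ ν := (norm_fst_le _).trans_lt hp1
  have hY : ‖Y‖ < R := (norm_snd_le _).trans_lt hp2
  rcases eq_or_ne x 0 with rfl | hx0
  · have hc : Tendsto (fun x : ℂ => (x, Y)) (𝓝[≠] 0) (𝓝 (0, Y)) :=
      ((by fun_prop : Continuous fun x : ℂ => (x, Y)).tendsto 0).mono_left nhdsWithin_le_nhds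
    have hgc := (hall _ hp2).1.2.continuousAt.norm.tendsto.comp hc
    have hhc := ((hall _ hp2).2.continuousAt.norm.tendsto.comp hc).const_mul K
    refine le_of_tendsto_of_tendsto hgc hhc ?_
    have h5 : ∀ᶠ x : ℂ in 𝓝 0, ‖x‖ < r ^ ν :=
      continuousAt_id.norm.eventually_lt_const (by simpa using hrν)
    filter_upwards [h5.filter_mono nhdsWithin_le_nhds, self_mem_nhdsWithin] with x h6 h7
    exact keyx x h6 h7 Y hY
  · exact keyx x hx hx0 Y hY

/-- Over `x = t ^ ν` the zeros of `h` are the points of the arc with parameters `ζ ^ i t`, so the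
condition `|x| < r ^ ν` cuts out exactly the parameters of modulus `< r`. For `t ≠ 0` the root
`y(t)` is simple, so the derivative of `h` in `Y` is nonzero there. -/
theorem exists_nhds_of_puiseux (hν : ν ≠ 0) (hζ : IsPrimitiveRoot ζ ν) (hy : AnalyticAt ℂ y 0)
    (hy0 : y 0 = 0) (hinj : ∃ U ∈ 𝓝 (0 : ℂ), Set.InjOn (fun t => (t ^ ν, y t)) U)
    (hh : AnalyticAt ℂ h 0)
    (he : ∀ᶠ t in 𝓝 0, ∀ Y, h (t ^ ν, Y) = ∏ i ∈ Finset.range ν, (Y - y (ζ ^ i * t)))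
    {W : Set (ℂ × ℂ)} (hW : W ∈ 𝓝 (0 : ℂ × ℂ)) {r₀ : ℝ} (hr₀ : 0 < r₀) :
    ∃ V ⊆ W, IsOpen V ∧ (0 : ℂ × ℂ) ∈ V ∧ ∃ r : ℝ, 0 < r ∧ r ≤ r₀ ∧
      zeroSet h V = (fun t => (t ^ ν, y t)) '' Metric.ball 0 r ∧
      ∀ t ∈ Metric.ball (0 : ℂ) r, t ≠ 0 → fderiv ℂ h (t ^ ν, y t) ≠ 0 := by
  obtain ⟨R, hR, hall⟩ := exists_ball_of_eventually
    ((show ∀ᶠ p in 𝓝 (0 : ℂ × ℂ), p ∈ W from hW).and hh.eventually_analyticAt)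
  obtain ⟨U, hU, hinj⟩ := hinj
  have hyR : ∀ᶠ t in 𝓝 (0 : ℂ), ‖y t‖ < R :=
    hy.continuousAt.norm.eventually_lt_const (by simpa [hy0] using hR)
  have htR : ∀ᶠ t : ℂ in 𝓝 (0 : ℂ), ‖t ^ ν‖ < R :=
    (show ContinuousAt (fun t : ℂ => ‖t ^ ν‖) 0 by fun_prop).eventually_lt_const
      (by simpa [hν] using hR)
  obtain ⟨r₁, hr₁, hsm⟩ := exists_ball_of_eventually
    (he.and ((hyR.and htR).and (show ∀ᶠ t in 𝓝 (0 : ℂ), t ∈ U from hU)))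
  set r := min r₀ r₁ with hrdef
  have hr : 0 < r := lt_min hr₀ hr₁
  have hrr : ∀ {t : ℂ}, ‖t‖ < r → ‖t‖ < r₁ := fun h => h.trans_le (min_le_right _ _)
  have hinj' : Set.InjOn (fun t => (t ^ ν, y t)) (Metric.ball 0 r) :=
    hinj.mono fun t ht => (hsm t (hrr (mem_ball_zero_iff.1 ht))).2.2
  have hmemV : ∀ t : ℂ, ‖t‖ < r → ‖(t ^ ν, y t)‖ < R := fun t ht =>
    max_lt (hsm t (hrr ht)).2.1.2 (hsm t (hrr ht)).2.1.1
  refine ⟨{p | ‖p.1‖ < r ^ ν ∧ ‖p‖ < R}, fun p hp => (hall p hp.2).1, ?_, ?_, r, hr,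
    min_le_left _ _, ?_, ?_⟩
  · exact (isOpen_lt continuous_fst.norm continuous_const).inter
      (isOpen_lt continuous_norm continuous_const)
  · change ‖(0 : ℂ × ℂ).1‖ < r ^ ν ∧ ‖(0 : ℂ × ℂ)‖ < R
    rw [Prod.fst_zero, norm_zero, norm_zero]
    exact ⟨by positivity, hR⟩
  · ext ⟨x, Y⟩
    constructor
    · rintro ⟨⟨hx, -⟩, h0⟩
      obtain ⟨t, ht, rfl⟩ := exists_pow_eq_of_norm_lt hr hν hx
      rw [(hsm t (hrr ht)).1 Y, Finset.prod_eq_zero_iff] at h0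
      obtain ⟨i, -, hi⟩ := h0
      refine ⟨ζ ^ i * t, by rwa [mem_ball_zero_iff, norm_rotate hν hζ], ?_⟩
      simp only [rotate_pow hζ, sub_eq_zero.1 hi]
    · rintro ⟨t, ht, h0⟩
      rw [mem_ball_zero_iff] at ht
      simp only [Prod.mk.injEq] at h0
      obtain ⟨rfl, rfl⟩ := h0
      refine ⟨⟨?_, hmemV t ht⟩, ?_⟩
      · rw [norm_pow]; exact pow_lt_pow_left₀ ht (norm_nonneg _) hν
      · rw [(hsm t (hrr ht)).1]
        exact Finset.prod_eq_zero (Finset.mem_range.2 (Nat.pos_of_ne_zero hν)) (by simp)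
  · intro t ht ht0 hf0
    rw [mem_ball_zero_iff] at ht
    have hA := (hall _ (hmemV t ht)).2.differentiableAt.hasFDerivAt
    rw [hf0] at hA
    have hl : HasDerivAt (fun Y : ℂ => (t ^ ν, Y)) ((0 : ℂ), (1 : ℂ)) (y t) :=
      (hasDerivAt_const _ _).prodMk (hasDerivAt_id _)
    have h1 := hA.comp_hasDerivAt (y t) hl
    obtain ⟨k, rfl⟩ := Nat.exists_eq_succ_of_ne_zero hν
    -- The factors other than the one with `i = 0`: the derivative in `Y` of the full product at `y
    -- t` is `Q (y t)`.
    let Q : ℂ → ℂ := fun Y => ∏ i ∈ Finset.range k, (Y - y (ζ ^ (i + 1) * t))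
    have hQ : DifferentiableAt ℂ Q (y t) := by
      refine DifferentiableAt.fun_finsetProd fun i _ => ?_
      fun_prop
    have h2 := ((hasDerivAt_id (y t)).sub_const (y t)).mul hQ.hasDerivAt
    have h3 : (h ∘ fun Y : ℂ => (t ^ (k + 1), Y)) = ((fun Y => id Y - y t) * Q) := by
      funext Y
      simp only [Function.comp, Pi.mul_apply, (hsm t (hrr ht)).1 Y, Finset.prod_range_succ', Q]
      simp [mul_comm]
    rw [← h3] at h2
    have h4 := h1.unique h2
    simp only [id, one_mul, sub_self, zero_mul, add_zero] at h4
    have h5 : ∏ i ∈ Finset.range k, (y t - y (ζ ^ (i + 1) * t)) = 0 := h4.symm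
    obtain ⟨i, hi, hi0⟩ := Finset.prod_eq_zero_iff.1 h5
    have h6 := injOn_conjugates hν hζ hinj' ht ht0
      (show 0 ∈ (Finset.range (k + 1) : Set ℕ) by simp)
      (show i + 1 ∈ (Finset.range (k + 1) : Set ℕ) by
        simpa [Nat.succ_le_iff] using Finset.mem_range.1 hi)
      (by simpa using sub_eq_zero.1 hi0)
    omega

theorem exists_isEquation_of_puiseux (hν : ν ≠ 0) (hy : AnalyticAt ℂ y 0) (hy0 : y 0 = 0)
    (hinj : ∃ U ∈ 𝓝 (0 : ℂ), Set.InjOn (fun t => (t ^ ν, y t)) U) :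
    ∃ h, IsEquation (fun t => (t ^ ν, y t)) h := by
  have hζ := Complex.isPrimitiveRoot_exp ν hν
  obtain ⟨h, hh, he, -, hker⟩ := exists_puiseux_equation hν hζ hy hy0 hinj
  exact ⟨h, hh, hker, fun g hg hgz => exists_le_of_puiseux hν hζ hy hy0 hinj hh he hg hgz,
    fun U hU r₀ hr₀ => exists_nhds_of_puiseux hν hζ hy hy0 hinj hh he hU hr₀⟩

end puiseux

/-! ### Exchange of the coordinates -/

/-- The exchange of the variables of a series. -/
def swapSeries (f : Series2) : Series2 := MvPowerSeries.subst ![X₁, X₀] f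

theorem constantCoeff_swap (i : Fin 2) :
    MvPowerSeries.constantCoeff ((![X₁, X₀] : Fin 2 → Series2) i) = 0 :=
  constantCoeff_pair constantCoeff_X₁ constantCoeff_X₀ i

theorem swapSeries_swapSeries (f : Series2) : swapSeries (swapSeries f) = f := by
  have hs := hasSubst_of_zero constantCoeff_swap
  rw [swapSeries, swapSeries, MvPowerSeries.subst_comp_subst_apply hs hs]
  have : (fun i => MvPowerSeries.subst ![X₁, X₀] ((![X₁, X₀] : Fin 2 → Series2) i)) =
      MvPowerSeries.X := by
    funext i
    fin_cases i
    · exact subst_X₁ hs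
    · exact subst_X₀ hs
  rw [this, MvPowerSeries.subst_self]; rfl

theorem swapSeries_mul (f g : Series2) : swapSeries (f * g) = swapSeries f * swapSeries g :=
  MvPowerSeries.subst_mul (hasSubst_of_zero constantCoeff_swap) f g

theorem swapSeries_dvd_iff {f g : Series2} : swapSeries f ∣ g ↔ f ∣ swapSeries g := by
  constructor
  · rintro ⟨q, rfl⟩
    exact ⟨swapSeries q, by rw [swapSeries_mul, swapSeries_swapSeries]⟩
  · rintro ⟨q, hq⟩
    exact ⟨swapSeries q, by rw [← swapSeries_mul, ← hq, swapSeries_swapSeries]⟩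

theorem analyticAt_swap (p : ℂ × ℂ) : AnalyticAt ℂ (Prod.swap : ℂ × ℂ → ℂ × ℂ) p :=
  analyticAt_snd.prod analyticAt_fst

theorem taylor_swap {f : ℂ × ℂ → ℂ} (hf : AnalyticAt ℂ f 0) :
    taylor (fun p => f p.swap) = swapSeries (taylor f) := by
  rw [taylor_comp hf (analyticAt_swap 0) rfl, swapSeries]
  congr 1
  simp only [taylorMap, Prod.fst_swap, Prod.snd_swap, taylor_fst, taylor_snd]

theorem evalArc_swap {γ : ℂ → ℂ × ℂ} (h0 : γ 0 = 0) (f : Series2) :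
    evalArc (taylorArc fun t => (γ t).swap) f = evalArc (taylorArc γ) (swapSeries f) := by
  have hc := constantCoeff_taylorArc h0
  rw [swapSeries, evalArc_mapSubst constantCoeff_swap hc]
  congr 1
  funext i
  fin_cases i
  · exact (evalArc_X₁ hc).symm
  · exact (evalArc_X₀ hc).symm

theorem IsEquation.swap {γ : ℂ → ℂ × ℂ} (h0 : γ 0 = 0) {h : ℂ × ℂ → ℂ} (H : IsEquation γ h) :
    IsEquation (fun t => (γ t).swap) (fun p => h p.swap) := by
  have hts : Tendsto (Prod.swap : ℂ × ℂ → ℂ × ℂ) (𝓝 0) (𝓝 0) :=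
    continuous_swap.tendsto (0 : ℂ × ℂ)
  refine ⟨H.analyticAt.comp_of_eq (analyticAt_swap 0) rfl, ?_, ?_, ?_⟩
  · intro f
    rw [evalArc_swap h0, H.evalArc_eq_zero_iff, taylor_swap H.analyticAt, swapSeries_dvd_iff]
  · intro g hg hgz
    obtain ⟨K, hK⟩ := H.exists_le (fun p => g p.swap)
      (hg.comp_of_eq (analyticAt_swap 0) rfl) hgz
    exact ⟨K, (hts.eventually hK).mono fun p hp => by simpa using hp⟩
  · intro U hU r₀ hr₀
    obtain ⟨V, hVU, hV, hV0, r, hr, hrr, hz, hd⟩ :=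
      H.exists_nhds (Prod.swap ⁻¹' U) (hts hU) r₀ hr₀
    refine ⟨Prod.swap ⁻¹' V, fun p hp => by simpa using hVU hp, hV.preimage continuous_swap, hV0, r,
      hr, hrr, ?_, ?_⟩
    · ext p
      have : p ∈ zeroSet (fun p => h p.swap) (Prod.swap ⁻¹' V) ↔ p.swap ∈ zeroSet h V := Iff.rfl
      rw [this, hz]
      constructor
      · rintro ⟨t, ht, e⟩
        exact ⟨t, ht, by simp only [e, Prod.swap_swap]⟩
      · rintro ⟨t, ht, rfl⟩
        exact ⟨t, ht, by simp⟩
    · intro t ht ht0 hf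
      refine hd t ht ht0 ?_
      let e : (ℂ × ℂ) ≃L[ℂ] (ℂ × ℂ) := ContinuousLinearEquiv.prodComm ℂ ℂ ℂ
      have h1 : fderiv ℂ (h ∘ e) ((γ t).swap) = 0 := hf
      rw [ContinuousLinearEquiv.comp_right_fderiv] at h1
      have h2 : e ((γ t).swap) = γ t := Prod.swap_swap _
      rw [h2] at h1
      ext
      · have := DFunLike.congr_fun h1 (0, 1)
        simpa [e] using this
      · have := DFunLike.congr_fun h1 (1, 0)
        simpa [e] using this

/-! ### Analytic arcs -/

theorem not_eventually_eq_zero : ¬ ∀ᶠ s : ℂ in 𝓝 0, s = 0 := by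
  intro h
  have h2 : ∀ᶠ s : ℂ in 𝓝[≠] 0, s = 0 := h.filter_mono nhdsWithin_le_nhds
  obtain ⟨s, hs, hs2⟩ := (h2.and self_mem_nhdsWithin).exists
  exact hs2 hs

/-- `χ` and `ψ` represent mutually inverse germs of diffeomorphisms of `(ℂ, 0)`. -/
structure IsReparam (χ ψ : ℂ → ℂ) : Prop where
  analyticAt : AnalyticAt ℂ χ 0
  analyticAt' : AnalyticAt ℂ ψ 0
  map_zero : χ 0 = 0
  map_zero' : ψ 0 = 0
  left_inv : ∀ᶠ s in 𝓝 0, ψ (χ s) = s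
  right_inv : ∀ᶠ t in 𝓝 0, χ (ψ t) = t

namespace IsReparam
variable {χ ψ : ℂ → ℂ} (R : IsReparam χ ψ)
include R

theorem symm : IsReparam ψ χ :=
  ⟨R.analyticAt', R.analyticAt, R.map_zero', R.map_zero, R.right_inv, R.left_inv⟩

theorem tendsto : Tendsto χ (𝓝 0) (𝓝 0) := by
  simpa [R.map_zero] using R.analyticAt.continuousAt.tendsto

theorem constantCoeff_taylor1 : PowerSeries.constantCoeff (taylor1 χ) = 0 := by
  rw [FormalCurve.constantCoeff_taylor1, R.map_zero]

theorem taylor1_ne_zero : taylor1 χ ≠ 0 := by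
  intro h
  rw [taylor1_eq_zero_iff R.analyticAt] at h
  refine not_eventually_eq_zero ?_
  filter_upwards [h, R.left_inv] with s hs hs2
  rw [← hs2, hs, R.map_zero']

end IsReparam

theorem taylorArc_comp {γ : ℂ → ℂ × ℂ} (hγ : AnalyticAt ℂ γ 0) {ψ : ℂ → ℂ}
    (hψ : AnalyticAt ℂ ψ 0) (h0 : ψ 0 = 0) (i : Fin 2) :
    taylorArc (fun t => γ (ψ t)) i = PowerSeries.subst (taylor1 ψ) (taylorArc γ i) := by
  fin_cases i
  · exact taylor1_comp1 (analyticAt_arc_fst hγ) hψ h0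
  · exact taylor1_comp1 (analyticAt_arc_snd hγ) hψ h0

theorem taylorArc_congr {γ δ : ℂ → ℂ × ℂ} (h : ∀ᶠ t in 𝓝 0, γ t = δ t) :
    taylorArc γ = taylorArc δ := by
  have h1 : taylor1 (fun t => (γ t).1) = taylor1 fun t => (δ t).1 :=
    taylor1_congr (h.mono fun t ht => by simp only [ht])
  have h2 : taylor1 (fun t => (γ t).2) = taylor1 fun t => (δ t).2 :=
    taylor1_congr (h.mono fun t ht => by simp only [ht])
  simp only [taylorArc, h1, h2]

theorem evalArc_comp_eq_zero_iff {γ : ℂ → ℂ × ℂ} (hγ : AnalyticAt ℂ γ 0) (h0 : γ 0 = 0)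
    {χ ψ : ℂ → ℂ} (R : IsReparam χ ψ) (f : Series2) :
    evalArc (taylorArc fun t => γ (χ t)) f = 0 ↔ evalArc (taylorArc γ) f = 0 := by
  rw [funext (taylorArc_comp hγ R.analyticAt R.map_zero),
    evalArc_subst (constantCoeff_taylorArc h0) R.constantCoeff_taylor1,
    subst1_eq_zero_iff R.constantCoeff_taylor1 R.taylor1_ne_zero]

/-- The leading term of an arc. -/
theorem exists_eq_pow_smul {γ : ℂ → ℂ × ℂ} (hγ : AnalyticAt ℂ γ 0) (h0 : γ 0 = 0)
    (hne : ¬ ∀ᶠ s in 𝓝 0, γ s = 0) : ∃ (μ : ℕ) (v : ℂ → ℂ × ℂ), μ ≠ 0 ∧ AnalyticAt ℂ v 0 ∧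
      v 0 ≠ 0 ∧ ∀ᶠ s in 𝓝 0, γ s = s ^ μ • v s := by
  obtain ⟨μ, v, hv, hv0, he⟩ := hγ.exists_eventuallyEq_pow_smul_nonzero_iff.2 hne
  simp only [sub_zero] at he
  refine ⟨μ, v, ?_, hv, hv0, he⟩
  rintro rfl
  have := he.self_of_nhds
  rw [h0, pow_zero, one_smul] at this
  exact hv0 this.symm

/-- Puiseux normalization: the first component is `s ^ μ` times a unit, hence the `μ`-th power of a
coordinate, which is taken as new parameter. -/
theorem exists_reparam {γ v : ℂ → ℂ × ℂ} {μ : ℕ} (hμ : μ ≠ 0) (hv : AnalyticAt ℂ v 0)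
    (hv0 : (v 0).1 ≠ 0) (he : ∀ᶠ s in 𝓝 0, γ s = s ^ μ • v s) :
    ∃ χ ψ : ℂ → ℂ, IsReparam χ ψ ∧ ∀ᶠ t in 𝓝 0, (γ (ψ t)).1 = t ^ μ := by
  obtain ⟨χ, hχ, hχ0, hχ1, hpow⟩ := exists_coordinate (analyticAt_arc_fst hv) hv0 hμ
  obtain ⟨ψ, hψ, hψ0, hl, hr⟩ := exists_local_inverse hχ hχ0 hχ1
  have R : IsReparam χ ψ := ⟨hχ, hψ, hχ0, hψ0, hl, hr⟩
  refine ⟨χ, ψ, R, ?_⟩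
  filter_upwards [R.symm.tendsto.eventually he, hr] with t ht hr
  rw [ht, Prod.smul_fst, smul_eq_mul, ← hpow, hr]

/-- An analytic arc through the origin that is injective near the origin. -/
structure IsArc (γ : ℂ → ℂ × ℂ) : Prop where
  analyticAt : AnalyticAt ℂ γ 0
  map_zero : γ 0 = 0
  injOn : ∃ U ∈ 𝓝 (0 : ℂ), Set.InjOn γ U

namespace IsArc
variable {γ : ℂ → ℂ × ℂ} (hγ : IsArc γ)
include hγ

theorem tendsto : Tendsto γ (𝓝 0) (𝓝 0) := by
  simpa [hγ.map_zero] using hγ.analyticAt.continuousAt.tendsto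

theorem not_eventually_zero : ¬ ∀ᶠ s in 𝓝 0, γ s = 0 := by
  intro h
  obtain ⟨U, hU, hinj⟩ := hγ.injOn
  refine not_eventually_eq_zero ?_
  filter_upwards [h, hU] with s hs hsU
  exact hinj hsU (mem_of_mem_nhds hU) (hs.trans hγ.map_zero.symm)

theorem comp {χ ψ : ℂ → ℂ} (R : IsReparam χ ψ) : IsArc fun t => γ (χ t) := by
  obtain ⟨U, hU, hinj⟩ := hγ.injOn
  refine ⟨hγ.analyticAt.comp_of_eq R.analyticAt R.map_zero, by rw [R.map_zero, hγ.map_zero],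
    {t | χ t ∈ U ∧ ψ (χ t) = t}, Filter.Eventually.and (R.tendsto hU) R.left_inv, ?_⟩
  rintro s ⟨hs, hs'⟩ t ⟨ht, ht'⟩ h
  rw [← hs', ← ht', hinj hs ht h]

theorem congr {δ : ℂ → ℂ × ℂ} (h : ∀ᶠ t in 𝓝 0, δ t = γ t) : IsArc δ := by
  obtain ⟨U, hU, hinj⟩ := hγ.injOn
  refine ⟨hγ.analyticAt.congr (h.mono fun t ht => ht.symm), h.self_of_nhds.trans hγ.map_zero,
    {t | t ∈ U ∧ δ t = γ t}, Filter.Eventually.and hU h, ?_⟩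
  rintro s ⟨hs, hs'⟩ t ⟨ht, ht'⟩ h
  exact hinj hs ht (hs'.symm.trans (h.trans ht'))

theorem swap : IsArc fun t => (γ t).swap := by
  obtain ⟨U, hU, hinj⟩ := hγ.injOn
  refine ⟨(analyticAt_swap _).comp hγ.analyticAt, by rw [hγ.map_zero]; rfl, U, hU, ?_⟩
  intro s hs t ht h
  exact hinj hs ht (Prod.swap_injective h)

end IsArc

/-- A Puiseux parametrization that is primitive is injective. -/
theorem IsPrimitiveArc.exists_injOn {ν : ℕ} (hν : ν ≠ 0) {y : ℂ → ℂ} (hy : AnalyticAt ℂ y 0)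
    (hy0 : y 0 = 0) (h : IsPrimitiveArc (taylorArc fun t => (t ^ ν, y t))) :
    ∃ U ∈ 𝓝 (0 : ℂ), Set.InjOn (fun t => (t ^ ν, y t)) U := by
  have hζ := Complex.isPrimitiveRoot_exp ν hν
  set ζ := Complex.exp (2 * Real.pi * Complex.I / ν)
  -- By the identity principle the alternative is `y(ζ ^ i t) = y(t)` near `0`. Then `y` is a
  -- function of `t ^ d`, where `d > 1` is the order of `ζ ^ i`; as `d ∣ ν`, the whole arc factors
  -- through `t ^ d`, against primitivity.
  have key : ∀ i ∈ Finset.Ioo 0 ν, ∀ᶠ t in 𝓝[≠] 0, y (ζ ^ i * t) ≠ y t := by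
    intro i hi
    rw [Finset.mem_Ioo] at hi
    refine ((analyticAt_rotate hy (ζ ^ i)).eventually_eq_or_eventually_ne hy).resolve_left ?_
    intro heq
    set d := orderOf (ζ ^ i)
    have hd := IsPrimitiveRoot.orderOf (ζ ^ i)
    have hdν : d ∣ ν := orderOf_dvd_of_pow_eq_one (by rw [← pow_mul, mul_comm, pow_mul,
      hζ.pow_eq_one, one_pow])
    have hd0 : d ≠ 0 := fun h0 => hν (Nat.eq_zero_of_zero_dvd (h0 ▸ hdν))
    have hd1 : d ≠ 1 := fun h1 =>
      hζ.pow_ne_one_of_pos_of_lt hi.1.ne' hi.2 (orderOf_eq_one_iff.1 h1)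
    obtain ⟨a, ha, hae⟩ := exists_eq_comp_pow hy hd0 hd heq
    have ha0 : a 0 = 0 := by
      have := hae.self_of_nhds
      rwa [zero_pow hd0, hy0] at this
    have hX : PowerSeries.constantCoeff (PowerSeries.X ^ d : PowerSeries ℂ) = 0 := by simp [hd0]
    refine h ![PowerSeries.X ^ (ν / d), taylor1 a] (PowerSeries.X ^ d) ?_ hX ?_ ?_
    · intro j
      fin_cases j
      · have : ν / d ≠ 0 := (Nat.div_pos (Nat.le_of_dvd (Nat.pos_of_ne_zero hν) hdν)
          (Nat.pos_of_ne_zero hd0)).ne'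
        simp [this]
      · simp [constantCoeff_taylor1, ha0]
    · intro j
      fin_cases j
      · simp only [taylorArc, taylor1_id_pow, Fin.zero_eta, Matrix.cons_val_zero]
        rw [PowerSeries.subst_pow (hasSubst_one hX), subst1_X hX, ← pow_mul,
          Nat.mul_div_cancel' hdν]
      · have := taylor1_comp1 ha (analyticAt_var.fun_pow d) (zero_pow hd0)
        rw [taylor1_congr hae, taylor1_id_pow] at this
        exact this
    · rw [PowerSeries.coeff_X_pow, if_neg (Ne.symm hd1)]
  have key2 : ∀ᶠ t in 𝓝[≠] 0, ∀ i ∈ Finset.Ioo 0 ν, y (ζ ^ i * t) ≠ y t :=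
    (Finset.eventually_all _).2 key
  rw [eventually_nhdsWithin_iff] at key2
  refine ⟨_, key2, ?_⟩
  intro s hs t ht hst
  simp only [Prod.mk.injEq] at hst
  by_cases hs0 : s = 0
  · rw [hs0, zero_pow hν] at hst
    rw [hs0, eq_zero_of_pow_eq_zero hst.1.symm]
  have h1 : (t / s) ^ ν = 1 := by
    rw [div_pow, hst.1, div_self]
    rw [← hst.1]
    exact pow_ne_zero _ hs0
  have : NeZero ν := ⟨hν⟩
  obtain ⟨i, hi, hi1⟩ := hζ.eq_pow_of_pow_eq_one h1
  have hts : t = ζ ^ i * s := by rw [hi1, div_mul_cancel₀ _ hs0]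
  rcases Nat.eq_zero_or_pos i with rfl | hpos
  · rw [hts, pow_zero, one_mul]
  · exact absurd (hts ▸ hst.2.symm) (hs hs0 i (Finset.mem_Ioo.2 ⟨hpos, hi⟩))

/-! ### Leading terms of arcs and tangent lines -/

theorem taylorArc_eq_pow_mul {γ v : ℂ → ℂ × ℂ} {μ : ℕ} (hv : AnalyticAt ℂ v 0)
    (he : ∀ᶠ s in 𝓝 0, γ s = s ^ μ • v s) (i : Fin 2) :
    taylorArc γ i = PowerSeries.X ^ μ * taylorArc v i := by
  rw [taylorArc_congr he]
  fin_cases i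
  · simp only [taylorArc, Prod.smul_fst, smul_eq_mul, Fin.zero_eta, Matrix.cons_val_zero]
    rw [taylor1_mul (analyticAt_var.fun_pow μ) (analyticAt_arc_fst hv), taylor1_id_pow]
  · simp only [taylorArc, Prod.smul_snd, smul_eq_mul, Fin.mk_one, Matrix.cons_val_one]
    rw [taylor1_mul (analyticAt_var.fun_pow μ) (analyticAt_arc_snd hv), taylor1_id_pow]
    rfl

/-- The lowest degree of the restriction of a series of order `N` to an arc of order `μ`. -/
theorem X_pow_dvd_evalArc {a : Fin 2 → PowerSeries ℂ} {μ N : ℕ} (hμ : μ ≠ 0)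
    (ha : ∀ i, PowerSeries.X ^ μ ∣ a i) {w : Series2}
    (hw : ∀ n : Fin 2 →₀ ℕ, n 0 + n 1 < N → MvPowerSeries.coeff n w = 0) :
    PowerSeries.X ^ (μ * N) ∣ evalArc a w := by
  have ha0 : ∀ i, PowerSeries.constantCoeff (a i) = 0 := fun i =>
    PowerSeries.X_dvd_iff.1 ((dvd_pow_self _ hμ).trans (ha i))
  have h1 : (N : ℕ∞) ≤ w.order := by
    refine MvPowerSeries.nat_le_order fun d hd => hw d ?_
    rwa [Finsupp.degree_eq_sum, Fin.sum_univ_two] at hd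
  have h2 : (μ : ℕ∞) ≤ ⨅ i, MvPowerSeries.order (σ := Unit) (a i) := by
    refine le_iInf fun i => ?_
    have := PowerSeries.X_pow_dvd_iff.1 (ha i)
    exact PowerSeries.order_eq_order (φ := a i) ▸ PowerSeries.nat_le_order _ _ this
  have h3 := (mul_le_mul' h2 h1).trans (MvPowerSeries.le_order_subst (hasSubst_of_zero ha0) w)
  rw [PowerSeries.X_pow_dvd_iff]
  intro m hm
  refine PowerSeries.coeff_of_lt_order m ?_
  refine lt_of_lt_of_le (Nat.cast_lt.2 hm) ?_
  rw [Nat.cast_mul, PowerSeries.order_eq_order]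
  exact h3

/-- The tangent line of a curve is the limit of the secants of its parametrization. -/
theorem IsTangentLine.mul_eq_mul {Γ : Ideal Series2} {m : OnePoint ℂ} (h : IsTangentLine Γ m)
    {γ v : ℂ → ℂ × ℂ} {μ : ℕ} (hμ : μ ≠ 0) (hv : AnalyticAt ℂ v 0)
    (he : ∀ᶠ s in 𝓝 0, γ s = s ^ μ • v s)
    (hΓ : ∀ f, f ∈ Γ ↔ evalArc (taylorArc γ) f = 0) :
    (v 0).1 * (lineVector m).2 = (v 0).2 * (lineVector m).1 := by
  obtain ⟨f, ν, a, b, hf, hab, hlow, hν, hm⟩ := h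
  have hf0 : evalArc (taylorArc γ) f = 0 := (hΓ f).1 (hf ▸ Ideal.mem_span_singleton_self f)
  have hc : ∀ i, PowerSeries.constantCoeff (taylorArc γ i) = 0 :=
    constantCoeff_taylorArc (by rw [he.self_of_nhds, zero_pow hμ, zero_smul])
  have hdvd : ∀ i, PowerSeries.X ^ μ ∣ taylorArc γ i := fun i =>
    ⟨_, taylorArc_eq_pow_mul hv he i⟩
  set ℓ : Series2 := MvPowerSeries.C a * X₀ + MvPowerSeries.C b * X₁ with hℓ
  have hℓo : (1 : ℕ∞) ≤ ℓ.order := by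
    rw [MvPowerSeries.one_le_order_iff_constCoeff_eq_zero]
    simp [hℓ, constantCoeff_X₀, constantCoeff_X₁]
  -- On the arc, `f - ℓ ^ ν` has order at least `μ (ν + 1)`, `f` vanishes, and `ℓ ^ ν` is `s ^ (μ
  -- ν)` times the `ν`-th power of `a v₁ + b v₂`. Hence `a v₁ + b v₂` vanishes at `s = 0`, and `v 0`
  -- and `lineVector m` lie on the same line.
  have hw : ∀ n : Fin 2 →₀ ℕ, n 0 + n 1 < ν + 1 →
      MvPowerSeries.coeff n (f - ℓ ^ ν) = 0 := by
    intro n hn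
    rw [map_sub]
    rcases Nat.lt_succ_iff_lt_or_eq.1 hn with h1 | h1
    · rw [hlow n h1, zero_sub, neg_eq_zero]
      refine MvPowerSeries.coeff_of_lt_order ?_
      refine lt_of_lt_of_le ?_ (MvPowerSeries.le_order_pow_of_constantCoeff_eq_zero ν
        (MvPowerSeries.one_le_order_iff_constCoeff_eq_zero.1 hℓo))
      rw [Finsupp.degree_eq_sum, Fin.sum_univ_two]
      exact_mod_cast h1
    · rw [hν n h1, sub_self]
  have h1 := X_pow_dvd_evalArc hμ hdvd hw
  have h2 : evalArc (taylorArc γ) ℓ = PowerSeries.X ^ μ *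
      (PowerSeries.C a * taylorArc v 0 + PowerSeries.C b * taylorArc v 1) := by
    rw [hℓ, evalArc_add hc, evalArc_mul hc, evalArc_mul hc, evalArc_C, evalArc_C,
      evalArc_X₀ hc, evalArc_X₁ hc, taylorArc_eq_pow_mul hv he, taylorArc_eq_pow_mul hv he]
    ring
  rw [evalArc_sub hc, hf0, zero_sub, dvd_neg, evalArc_pow hc, h2, mul_pow, ← pow_mul,
    Nat.mul_succ, pow_add,
    mul_dvd_mul_iff_left (pow_ne_zero _ PowerSeries.X_ne_zero)] at h1
  have h3 := PowerSeries.X_dvd_iff.1 ((dvd_pow_self _ hμ).trans h1)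
  rw [map_pow] at h3
  have h4 := eq_zero_of_pow_eq_zero h3
  have h5 : a * (v 0).1 + b * (v 0).2 = 0 := by
    simpa [taylorArc, constantCoeff_taylor1] using h4
  have hab' : a ≠ 0 ∨ b ≠ 0 := by
    by_contra hcon
    push Not at hcon
    exact hab (Prod.ext hcon.1 hcon.2)
  rcases hab' with ha | hb
  · refine mul_left_cancel₀ ha ?_
    linear_combination (lineVector m).2 * h5 - (v 0).2 * hm
  · refine mul_left_cancel₀ hb ?_
    linear_combination (v 0).1 * hm - (lineVector m).1 * h5

/-! ### Strict transforms -/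

theorem taylorMap_blowUpChart (m : OnePoint ℂ) : taylorMap (blowUpChart m) = blowUpSeries m := by
  induction m using OnePoint.rec with
  | infty =>
    have := taylor_mul (f := fun p : ℂ × ℂ => p.1) (g := fun p => p.2) analyticAt_fst analyticAt_snd
    rw [taylor_fst, taylor_snd] at this
    change ![taylor fun p : ℂ × ℂ => p.1 * p.2, taylor fun p : ℂ × ℂ => p.2] = ![X₀ * X₁, X₁]
    rw [this, taylor_snd]
  | coe c =>
    have := taylor_mul (f := fun p : ℂ × ℂ => p.1) (g := fun p => p.2 + c) analyticAt_fst
      (analyticAt_snd.fun_add analyticAt_const)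
    rw [taylor_fst, taylor_add analyticAt_snd analyticAt_const, taylor_snd, taylor_const] at this
    change ![taylor fun p : ℂ × ℂ => p.1, taylor fun p : ℂ × ℂ => p.1 * (p.2 + c)] =
      ![X₀, X₀ * (X₁ + MvPowerSeries.C c)]
    rw [this, taylor_fst]

theorem analyticAt_blowUpChart (m : OnePoint ℂ) (p : ℂ × ℂ) : AnalyticAt ℂ (blowUpChart m) p := by
  induction m using OnePoint.rec with
  | infty => exact (analyticAt_fst.fun_mul analyticAt_snd).prod analyticAt_snd
  | coe c =>
    exact analyticAt_fst.prod (analyticAt_fst.fun_mul (analyticAt_snd.fun_add analyticAt_const))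

theorem blowUpChart_zero (m : OnePoint ℂ) : blowUpChart m 0 = 0 := by
  induction m using OnePoint.rec with
  | infty => exact Prod.ext (mul_zero _) rfl
  | coe c => exact Prod.ext rfl (zero_mul _)

/-- The coordinate that vanishes on the exceptional divisor, in the chart centred at `m`. -/
def exceptionalCoord : OnePoint ℂ → ℂ × ℂ → ℂ
  | none => Prod.snd
  | some _ => Prod.fst

theorem analyticAt_exceptionalCoord (m : OnePoint ℂ) (p : ℂ × ℂ) :
    AnalyticAt ℂ (exceptionalCoord m) p := by
  induction m using OnePoint.rec with
  | infty => exact analyticAt_snd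
  | coe c => exact analyticAt_fst

theorem taylor_exceptionalCoord (m : OnePoint ℂ) :
    taylor (exceptionalCoord m) = exceptionalEquation m := by
  induction m using OnePoint.rec with
  | infty => exact taylor_snd
  | coe c => exact taylor_fst

theorem blowUpChart_infty_swap (p : ℂ × ℂ) :
    blowUpChart ((0 : ℂ) : OnePoint ℂ) p.swap = (blowUpChart OnePoint.infty p).swap := by
  refine Prod.ext rfl ?_
  change p.2 * (p.1 + 0) = p.1 * p.2
  ring

/-- The properties of a lift `γ'` of an arc `γ` in the chart centred at `m`, and of convergent
equations of both arcs. -/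
structure IsLift (m : OnePoint ℂ) (γ γ' : ℂ → ℂ × ℂ) (h h' : ℂ × ℂ → ℂ) : Prop where
  isArc : IsArc γ'
  chart_eq : ∀ᶠ s in 𝓝 0, blowUpChart m (γ' s) = γ s
  analyticAt : AnalyticAt ℂ h 0
  analyticAt' : AnalyticAt ℂ h' 0
  ker : ∀ f, evalArc (taylorArc γ) f = 0 ↔ taylor h ∣ f
  ker' : ∀ f, evalArc (taylorArc γ') f = 0 ↔ taylor h' ∣ f
  ne_zero : taylor h' ≠ 0
  comp_eq : ∃ k, ∀ᶠ p in 𝓝 0, h (blowUpChart m p) = exceptionalCoord m p ^ k * h' p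

/-- The lift `(γ₁, γ₂ / γ₁ - c)` has the same first component, so one change of parameter normalizes
both arcs, with `y = t ^ μ (y' + c)`. Substituting `Y = x (Y' + c)` in the product of the `Y - y(ζ ^
i t)` then takes out one factor `x = t ^ μ` from each of the `μ` terms. -/
theorem exists_isLift_coe {γ v : ℂ → ℂ × ℂ} (hγ : IsArc γ) {μ : ℕ} (hμ : μ ≠ 0)
    (hv : AnalyticAt ℂ v 0) (he : ∀ᶠ s in 𝓝 0, γ s = s ^ μ • v s) (hv0 : (v 0).1 ≠ 0) (c : ℂ)
    (hc : (v 0).2 = c * (v 0).1) : ∃ γ' h h', IsLift (c : OnePoint ℂ) γ γ' h h' := by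
  let γ' : ℂ → ℂ × ℂ := fun s => ((γ s).1, (v s).2 / (v s).1 - c)
  have hγ'a : AnalyticAt ℂ γ' 0 := (analyticAt_arc_fst hγ.analyticAt).prod
    (((analyticAt_arc_snd hv).fun_div (analyticAt_arc_fst hv) hv0).fun_sub analyticAt_const)
  have hγ'0 : γ' 0 = 0 := by
    refine Prod.ext (by simp [γ', hγ.map_zero]) ?_
    simp only [γ', hc, mul_div_cancel_right₀ _ hv0, sub_self, Prod.snd_zero]
  have hchart : ∀ᶠ s in 𝓝 0, blowUpChart (c : OnePoint ℂ) (γ' s) = γ s := by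
    filter_upwards [he, (analyticAt_arc_fst hv).continuousAt.eventually_ne hv0] with s hs hs1
    refine Prod.ext rfl ?_
    change (γ s).1 * ((v s).2 / (v s).1 - c + c) = (γ s).2
    rw [hs, Prod.smul_fst, Prod.smul_snd, smul_eq_mul, smul_eq_mul]
    field_simp
    ring
  have hγ' : IsArc γ' := by
    obtain ⟨U, hU, hinj⟩ := hγ.injOn
    refine ⟨hγ'a, hγ'0, _, Filter.Eventually.and hU hchart, ?_⟩
    rintro s ⟨hs, hs'⟩ t ⟨ht, ht'⟩ hst
    exact hinj hs ht (by rw [← hs', ← ht', hst])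
  obtain ⟨χ, ψ, R, hψ⟩ := exists_reparam hμ hv hv0 he
  let y : ℂ → ℂ := fun t => (γ (ψ t)).2
  let y' : ℂ → ℂ := fun t => (γ' (ψ t)).2
  have e1 : ∀ᶠ t in 𝓝 0, (t ^ μ, y t) = γ (ψ t) := hψ.mono fun t ht => Prod.ext ht.symm rfl
  have e2 : ∀ᶠ t in 𝓝 0, (t ^ μ, y' t) = γ' (ψ t) := hψ.mono fun t ht => Prod.ext ht.symm rfl
  have e3 : ∀ᶠ t in 𝓝 0, y t = t ^ μ * (y' t + c) := by
    filter_upwards [hψ, R.symm.tendsto.eventually hchart] with t ht ht2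
    have h3 : (γ (ψ t)).1 * ((γ' (ψ t)).2 + c) = (γ (ψ t)).2 := congrArg Prod.snd ht2
    rw [ht] at h3
    exact h3.symm
  have a1 := (hγ.comp R.symm).congr e1
  have a2 := (hγ'.comp R.symm).congr e2
  have hζ := Complex.isPrimitiveRoot_exp μ hμ
  set ζ := Complex.exp (2 * Real.pi * Complex.I / μ)
  obtain ⟨h, hh, hprod, -, hker⟩ := exists_puiseux_equation hμ hζ
    (y := y) (analyticAt_arc_snd a1.analyticAt :) (congrArg Prod.snd a1.map_zero) a1.injOn
  obtain ⟨h', hh', hprod', hne', hker'⟩ := exists_puiseux_equation hμ hζ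
    (y := y') (analyticAt_arc_snd a2.analyticAt :) (congrArg Prod.snd a2.map_zero) a2.injOn
  refine ⟨γ', h, h', hγ', hchart, hh, hh', fun f => ?_, fun f => ?_, hne', μ, ?_⟩
  · rw [← hker, taylorArc_congr e1, evalArc_comp_eq_zero_iff hγ.analyticAt hγ.map_zero R.symm]
  · rw [← hker', taylorArc_congr e2, evalArc_comp_eq_zero_iff hγ'a hγ'0 R.symm]
  have e4 : ∀ᶠ t in 𝓝 0, ∀ i ∈ Finset.range μ,
      y (ζ ^ i * t) = t ^ μ * (y' (ζ ^ i * t) + c) := by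
    refine (Finset.eventually_all _).2 fun i _ => ?_
    have ht : Tendsto (fun t : ℂ => ζ ^ i * t) (𝓝 0) (𝓝 0) := by
      simpa using (continuous_const_mul (ζ ^ i)).tendsto (0 : ℂ)
    filter_upwards [ht.eventually e3] with t ht
    rwa [rotate_pow hζ] at ht
  obtain ⟨r, hr, hall⟩ := exists_ball_of_eventually (hprod.and (hprod'.and e4))
  have hlt : ∀ᶠ p : ℂ × ℂ in 𝓝 0, ‖p.1‖ < r ^ μ := by
    refine (continuous_fst.norm.tendsto (0 : ℂ × ℂ)).eventually_lt_const ?_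
    simpa using pow_pos hr μ
  filter_upwards [hlt] with p hp
  obtain ⟨t, htr, htp⟩ := exists_pow_eq_of_norm_lt hr hμ hp
  obtain ⟨h1, h2, h3⟩ := hall t htr
  change h (p.1, p.1 * (p.2 + c)) = p.1 ^ μ * h' (p.1, p.2)
  rw [← htp, h1, h2]
  have h4 : (t ^ μ) ^ μ = ∏ _i ∈ Finset.range μ, t ^ μ := by
    rw [Finset.prod_const, Finset.card_range]
  rw [h4, ← Finset.prod_mul_distrib]
  refine Finset.prod_congr rfl fun i hi => ?_
  rw [h3 i hi]
  ring

/-- The chart at `∞` is the chart at `0` after exchange of the coordinates, upstairs and downstairs.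
-/
theorem exists_isLift {m : OnePoint ℂ} {γ v : ℂ → ℂ × ℂ} (hγ : IsArc γ) {μ : ℕ} (hμ : μ ≠ 0)
    (hv : AnalyticAt ℂ v 0) (he : ∀ᶠ s in 𝓝 0, γ s = s ^ μ • v s) (hv0 : v 0 ≠ 0)
    (hm : (v 0).1 * (lineVector m).2 = (v 0).2 * (lineVector m).1) :
    ∃ γ' h h', IsLift m γ γ' h h' := by
  induction m using OnePoint.rec with
  | infty =>
    have hm : (v 0).1 * 1 = (v 0).2 * 0 := hm
    rw [mul_one, mul_zero] at hm
    have h2 : (v 0).2 ≠ 0 := fun h => hv0 (Prod.ext hm h)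
    have hts : Tendsto (Prod.swap : ℂ × ℂ → ℂ × ℂ) (𝓝 0) (𝓝 0) :=
      continuous_swap.tendsto (0 : ℂ × ℂ)
    obtain ⟨γ', h, h', L⟩ := exists_isLift_coe hγ.swap hμ ((analyticAt_swap _).comp hv)
      (he.mono fun s hs => by rw [hs]; rfl) h2 0 (by rw [zero_mul]; exact hm)
    refine ⟨fun s => (γ' s).swap, fun p => h p.swap, fun p => h' p.swap, L.isArc.swap, ?_,
      L.analyticAt.comp_of_eq (analyticAt_swap 0) rfl,
      L.analyticAt'.comp_of_eq (analyticAt_swap 0) rfl, fun f => ?_, fun f => ?_, ?_, ?_⟩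
    · filter_upwards [L.chart_eq] with s hs
      have := blowUpChart_infty_swap (γ' s).swap
      rw [Prod.swap_swap, hs] at this
      exact (Prod.swap_injective this).symm
    · have h1 := L.ker (swapSeries f)
      rw [evalArc_swap hγ.map_zero, swapSeries_swapSeries] at h1
      rw [h1, taylor_swap L.analyticAt, swapSeries_dvd_iff]
    · rw [evalArc_swap L.isArc.map_zero, L.ker', taylor_swap L.analyticAt', swapSeries_dvd_iff]
    · rw [taylor_swap L.analyticAt']
      intro h0
      refine L.ne_zero ?_
      have h1 := swapSeries_swapSeries (taylor h')
      rw [h0] at h1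
      have h2 := swapSeries_mul 0 (taylor h')
      rwa [zero_mul, h0, mul_zero, h1] at h2
    · obtain ⟨k, hk⟩ := L.comp_eq
      refine ⟨k, (hts.eventually hk).mono fun p hp => ?_⟩
      rw [blowUpChart_infty_swap] at hp
      exact hp
  | coe c =>
    have hm : (v 0).1 * c = (v 0).2 * 1 := hm
    rw [mul_one] at hm
    refine exists_isLift_coe hγ hμ hv he (fun h => hv0 (Prod.ext h ?_)) c (by rw [← hm, mul_comm])
    rw [← hm, h, zero_mul]; rfl

theorem irreducible_X (i : Fin 2) : Irreducible (MvPowerSeries.X i : Series2) := by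
  refine ⟨fun h => ?_, fun f g h => ?_⟩
  · rw [MvPowerSeries.isUnit_iff_constantCoeff] at h
    simp at h
  · by_contra! hcon
    rw [MvPowerSeries.isUnit_iff_constantCoeff, MvPowerSeries.isUnit_iff_constantCoeff,
      isUnit_iff_ne_zero, isUnit_iff_ne_zero, not_not, not_not,
      ← MvPowerSeries.one_le_order_iff_constCoeff_eq_zero,
      ← MvPowerSeries.one_le_order_iff_constCoeff_eq_zero] at hcon
    have h1 := add_le_add hcon.1 hcon.2
    rw [← MvPowerSeries.order_mul, ← h, MvPowerSeries.X_def,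
      MvPowerSeries.order_monomial_of_ne_zero one_ne_zero, Finsupp.degree_single] at h1
    exact absurd h1 (by decide)

/-- A prime generator `q` of `Γ'` divides the exceptional equation to the power `k` times `g`, and
is not associated to the exceptional equation, so `q ∣ g`. Since `g` generates the kernel of
evaluation on `a`, it divides `q` or the cofactor, and the latter would make `q` a unit. So `Γ'` is
that kernel. -/
theorem IsStrictTransform.mem_iff {Γ Γ' : Ideal Series2} {m : OnePoint ℂ}
    (h : IsStrictTransform Γ m Γ') {a : Fin 2 → PowerSeries ℂ}
    (ha : ∀ i, PowerSeries.constantCoeff (a i) = 0) {f g : Series2} {k : ℕ} (hf : f ∈ Γ)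
    (hfg : MvPowerSeries.subst (blowUpSeries m) f = exceptionalEquation m ^ k * g) (hg : g ≠ 0)
    (hker : ∀ w, evalArc a w = 0 ↔ g ∣ w) (w : Series2) : w ∈ Γ' ↔ evalArc a w = 0 := by
  have : IsDomain Series2 := NoZeroDivisors.to_isDomain _
  obtain ⟨⟨q, hq, rfl⟩, hne, hmem⟩ := h
  have h1 := Ideal.mem_span_singleton.1 (hfg ▸ hmem f hf)
  have hirr : Irreducible (exceptionalEquation m) := by
    induction m using OnePoint.rec with
    | infty => exact irreducible_X 1
    | coe c => exact irreducible_X 0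
  have hqg : q ∣ g := by
    refine (hq.dvd_or_dvd h1).resolve_left fun h2 => hne ?_
    rw [Ideal.span_singleton_eq_span_singleton]
    exact (hq.irreducible.associated_of_dvd hirr (hq.dvd_of_dvd_pow h2))
  obtain ⟨u, hu⟩ := hqg
  have h2 : evalArc a q * evalArc a u = 0 := by
    rw [← evalArc_mul ha, ← hu, hker]
  have h3 : g ∣ q := by
    rcases mul_eq_zero.1 h2 with h3 | h3
    · exact (hker q).1 h3
    · obtain ⟨w, hw⟩ := (hker u).1 h3
      refine absurd (IsUnit.of_mul_eq_one w ?_) hq.not_isUnit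
      refine mul_left_cancel₀ hg ?_
      calc g * (q * w) = q * (g * w) := by ring
        _ = g * 1 := by rw [← hw, ← hu, mul_one]
  rw [Ideal.mem_span_singleton, hker]
  exact ⟨h3.trans, (Dvd.intro u hu.symm).trans⟩

/-- The strict transform of a curve is parametrized by the lift of an arc. -/
theorem IsStrictTransform.exists_arc {Γ Γ' : Ideal Series2} {m : OnePoint ℂ}
    (h : IsStrictTransform Γ m Γ') (ht : IsTangentLine Γ m) {γ : ℂ → ℂ × ℂ} (hγ : IsArc γ)
    (hΓ : ∀ f, f ∈ Γ ↔ evalArc (taylorArc γ) f = 0) :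
    ∃ γ', IsArc γ' ∧ (∀ f, f ∈ Γ' ↔ evalArc (taylorArc γ') f = 0) ∧
      ∀ᶠ s in 𝓝 0, blowUpChart m (γ' s) = γ s := by
  obtain ⟨μ, v, hμ, hv, hv0, he⟩ := exists_eq_pow_smul hγ.analyticAt hγ.map_zero
    hγ.not_eventually_zero
  obtain ⟨γ', f, f', L⟩ := exists_isLift hγ hμ hv he hv0 (ht.mul_eq_mul hμ hv he hΓ)
  refine ⟨γ', L.isArc, ?_, L.chart_eq⟩
  obtain ⟨k, hk⟩ := L.comp_eq
  refine h.mem_iff (k := k) (constantCoeff_taylorArc L.isArc.map_zero)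
    ((hΓ (taylor f)).2 ((L.ker _).2 dvd_rfl)) ?_ L.ne_zero L.ker'
  rw [← taylorMap_blowUpChart, ← taylor_comp L.analyticAt (analyticAt_blowUpChart m 0)
    (blowUpChart_zero m), taylor_congr hk,
    taylor_mul ((analyticAt_exceptionalCoord m 0).fun_pow k) L.analyticAt',
    taylor_pow (analyticAt_exceptionalCoord m 0), taylor_exceptionalCoord]

/-! ### Lifts of maps and orbits to a blow-up -/

/-- The vector on the line of the projection of `p`, in the chart centred at `m`. -/
def chartVector : OnePoint ℂ → ℂ × ℂ → ℂ × ℂ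
  | none => fun p => (p.1, 1)
  | some c => fun p => (1, p.2 + c)

theorem blowUpChart_eq_smul (m : OnePoint ℂ) (p : ℂ × ℂ) :
    blowUpChart m p = exceptionalCoord m p • chartVector m p := by
  induction m using OnePoint.rec with
  | infty => exact Prod.ext (mul_comm _ _) (mul_one _).symm
  | coe c => exact Prod.ext (mul_one _).symm rfl

theorem analyticAt_chartVector (m : OnePoint ℂ) (p : ℂ × ℂ) :
    AnalyticAt ℂ (chartVector m) p := by
  induction m using OnePoint.rec with
  | infty => exact analyticAt_fst.prod analyticAt_const
  | coe c => exact analyticAt_const.prod (analyticAt_snd.fun_add analyticAt_const)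

theorem exceptionalCoord_zero (m : OnePoint ℂ) : exceptionalCoord m 0 = 0 := by
  induction m using OnePoint.rec with
  | infty => rfl
  | coe c => rfl

theorem blowUpChart_injective {m : OnePoint ℂ} {p q : ℂ × ℂ} (hp : exceptionalCoord m p ≠ 0)
    (h : blowUpChart m p = blowUpChart m q) : p = q := by
  induction m using OnePoint.rec with
  | infty =>
    have h1 : p.1 * p.2 = q.1 * q.2 := congrArg Prod.fst h
    have h2 : p.2 = q.2 := (Prod.ext_iff.1 h).2
    rw [← h2] at h1
    exact Prod.ext (mul_right_cancel₀ hp h1) h2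
  | coe c =>
    have h1 : p.1 = q.1 := (Prod.ext_iff.1 h).1
    have h2 : p.1 * (p.2 + c) = q.1 * (q.2 + c) := congrArg Prod.snd h
    rw [← h1] at h2
    exact Prod.ext h1 (add_right_cancel (mul_left_cancel₀ hp h2))

/-- By Hadamard's lemma `f = x f₁ + y f₂`, and both components of the blow-up map are divisible by
the exceptional coordinate. -/
theorem exists_eq_exceptionalCoord_mul (m : OnePoint ℂ) {f : ℂ × ℂ → ℂ} (hf : AnalyticAt ℂ f 0)
    (h0 : f 0 = 0) : ∃ g, AnalyticAt ℂ g 0 ∧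
      ∀ᶠ p in 𝓝 0, f (blowUpChart m p) = exceptionalCoord m p * g p := by
  obtain ⟨f₁, f₂, h₁, h₂, h⟩ := exists_eq_add_fst_mul_add_snd_mul hf
  have hc := analyticAt_blowUpChart m 0
  have hc0 := blowUpChart_zero m
  have hv := analyticAt_chartVector m 0
  refine ⟨fun p => (chartVector m p).1 * f₁ (blowUpChart m p) +
    (chartVector m p).2 * f₂ (blowUpChart m p), ?_, ?_⟩
  · exact ((analyticAt_fst.comp hv).fun_mul (h₁.comp_of_eq hc hc0)).fun_add
      ((analyticAt_snd.comp hv).fun_mul (h₂.comp_of_eq hc hc0))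
  · have ht : Tendsto (blowUpChart m) (𝓝 0) (𝓝 0) := by
      simpa [hc0] using hc.continuousAt.tendsto
    filter_upwards [ht.eventually h] with p hp
    rw [hp, h0, zero_add, blowUpChart_eq_smul]
    simp only [Prod.smul_fst, Prod.smul_snd, smul_eq_mul]
    ring

/-- The factor of the exceptional divisor in the lift of an arc. -/
theorem exists_exceptionalCoord_arc {m : OnePoint ℂ} {γ γ' : ℂ → ℂ × ℂ} (hγ : IsArc γ)
    (hγ' : IsArc γ') (hc : ∀ᶠ s in 𝓝 0, blowUpChart m (γ' s) = γ s) :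
    ∃ (μ : ℕ) (k : ℂ → ℂ), μ ≠ 0 ∧ AnalyticAt ℂ k 0 ∧ k 0 ≠ 0 ∧
      ∀ᶠ s in 𝓝 0, exceptionalCoord m (γ' s) = s ^ μ * k s := by
  have ha : AnalyticAt ℂ (fun s => exceptionalCoord m (γ' s)) 0 :=
    (analyticAt_exceptionalCoord m _).comp hγ'.analyticAt
  obtain ⟨μ, k, hk, hk0, he⟩ := ha.exists_eventuallyEq_pow_smul_nonzero_iff.2 fun h =>
    hγ.not_eventually_zero <| by
      filter_upwards [h, hc] with s hs hs'
      rw [← hs', blowUpChart_eq_smul, hs, zero_smul]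
  simp only [sub_zero, smul_eq_mul] at he
  refine ⟨μ, k, ?_, hk, hk0, he⟩
  rintro rfl
  have := he.self_of_nhds
  rw [hγ'.map_zero, exceptionalCoord_zero, pow_zero, one_mul] at this
  exact hk0 this.symm

theorem exists_eq_mul_of_map_zero {θ : ℂ → ℂ} (hθ : AnalyticAt ℂ θ 0) (h0 : θ 0 = 0) :
    ∃ t, AnalyticAt ℂ t 0 ∧ t 0 = deriv θ 0 ∧ ∀ᶠ s in 𝓝 0, θ s = s * t s := by
  obtain ⟨t, ht, h⟩ := exists_eq_add_mul hθ
  simp only [h0, zero_add] at h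
  refine ⟨t, ht, ?_, h⟩
  have h1 := taylor1_congr h
  rw [taylor1_mul analyticAt_var ht, taylor1_id] at h1
  rw [← coeff_one_taylor1, h1, ← zero_add 1, PowerSeries.coeff_succ_X_mul,
    PowerSeries.coeff_zero_eq_constantCoeff, constantCoeff_taylor1]

theorem eventually_nhdsNE_of_conj {θ : ℂ → ℂ} (hθ : AnalyticAt ℂ θ 0) (h0 : θ 0 = 0)
    (h1 : deriv θ 0 ≠ 0) : ∀ᶠ s in 𝓝[≠] 0, θ s ≠ 0 := by
  obtain ⟨t, ht, ht0, h⟩ := exists_eq_mul_of_map_zero hθ h0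
  rw [← ht0] at h1
  filter_upwards [h.filter_mono nhdsWithin_le_nhds, self_mem_nhdsWithin,
    (ht.continuousAt.eventually_ne h1).filter_mono nhdsWithin_le_nhds] with s hs hs0 ht
  rw [hs]
  exact mul_ne_zero hs0 ht

/-- The lift of `F` in the chart centred at the tangent of an invariant arc. -/
theorem exists_lift_map {m : OnePoint ℂ} {F : ℂ × ℂ → ℂ × ℂ} (hF : AnalyticAt ℂ F 0)
    (hF0 : F 0 = 0) {γ γ' : ℂ → ℂ × ℂ} (hγ : IsArc γ) (hγ' : IsArc γ')
    (hc : ∀ᶠ s in 𝓝 0, blowUpChart m (γ' s) = γ s) {θ : ℂ → ℂ} (hθ : AnalyticAt ℂ θ 0)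
    (hθ0 : θ 0 = 0) (hθ1 : deriv θ 0 ≠ 0) (hconj : ∀ᶠ s in 𝓝 0, F (γ s) = γ (θ s)) :
    ∃ (F' : ℂ × ℂ → ℂ × ℂ) (U : ℂ × ℂ → ℂ) (μ : ℕ), μ ≠ 0 ∧ AnalyticAt ℂ F' 0 ∧ F' 0 = 0 ∧
      AnalyticAt ℂ U 0 ∧ U 0 = deriv θ 0 ^ μ ∧
      (∀ᶠ p in 𝓝 0, blowUpChart m (F' p) = F (blowUpChart m p)) ∧
      (∀ᶠ p in 𝓝 0, exceptionalCoord m (F' p) = exceptionalCoord m p * U p) ∧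
      ∀ᶠ s in 𝓝 0, F' (γ' s) = γ' (θ s) := by
  obtain ⟨μ, k, hμ, hk, hk0, hek⟩ := exists_exceptionalCoord_arc hγ hγ' hc
  obtain ⟨t, ht, ht0, hθt⟩ := exists_eq_mul_of_map_zero hθ hθ0
  obtain ⟨W₁, hW₁, hF₁⟩ := exists_eq_exceptionalCoord_mul m (analyticAt_fst.comp hF)
    (f := fun p => (F p).1) (by rw [hF0]; rfl)
  obtain ⟨W₂, hW₂, hF₂⟩ := exists_eq_exceptionalCoord_mul m (analyticAt_snd.comp hF)
    (f := fun p => (F p).2) (by rw [hF0]; rfl)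
  have hθt0 : Tendsto θ (𝓝 0) (𝓝 0) := by simpa [hθ0] using hθ.continuousAt.tendsto
  have hW : ∀ᶠ p in 𝓝 0, F (blowUpChart m p) = exceptionalCoord m p • (W₁ p, W₂ p) := by
    filter_upwards [hF₁, hF₂] with p h1 h2 using Prod.ext h1 h2
  -- Computed along the arc: the exceptional coordinate is `s ^ μ k(s)` at `γ' s` and `θ(s) ^ μ k(θ
  -- s)` at `γ' (θ s)`; divide `F(γ(s)) = γ(θ(s))` by `s ^ μ` and let `s → 0`. So the lift fixes the
  -- centre of the chart, and the multiplier of the exceptional coordinate there is `θ'(0) ^ μ`.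
  have hW0 : (W₁ 0, W₂ 0) = deriv θ 0 ^ μ • chartVector m 0 := by
    have hev : ∀ᶠ s in 𝓝[≠] 0, k s • (W₁ (γ' s), W₂ (γ' s)) =
        (t s ^ μ * k (θ s)) • chartVector m (γ' (θ s)) := by
      filter_upwards [self_mem_nhdsWithin, hc.filter_mono nhdsWithin_le_nhds,
        (hθt0.eventually hc).filter_mono nhdsWithin_le_nhds,
        hek.filter_mono nhdsWithin_le_nhds, hθt.filter_mono nhdsWithin_le_nhds,
        (hθt0.eventually hek).filter_mono nhdsWithin_le_nhds,
        (hγ'.tendsto.eventually hW).filter_mono nhdsWithin_le_nhds,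
        hconj.filter_mono nhdsWithin_le_nhds] with s h0 h1 h2 h3 h4 h5 h6 h7
      have h8 : exceptionalCoord m (γ' s) • (W₁ (γ' s), W₂ (γ' s)) =
          exceptionalCoord m (γ' (θ s)) • chartVector m (γ' (θ s)) := by
        rw [← h6, h1, h7, ← h2, blowUpChart_eq_smul]
      rw [h3, h5, h4] at h8
      refine smul_right_injective _ (pow_ne_zero μ h0) ?_
      simp only
      rw [smul_smul, h8, smul_smul, mul_pow, h4]
      ring_nf
    have c1 : ContinuousAt (fun s => k s • (W₁ (γ' s), W₂ (γ' s))) 0 :=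
      hk.continuousAt.smul
        ((hW₁.comp_of_eq hγ'.analyticAt hγ'.map_zero).continuousAt.prodMk
          (hW₂.comp_of_eq hγ'.analyticAt hγ'.map_zero).continuousAt)
    have a2 : AnalyticAt ℂ (fun s => γ' (θ s)) 0 := hγ'.analyticAt.comp_of_eq hθ hθ0
    have c2 : ContinuousAt (fun s => (t s ^ μ * k (θ s)) • chartVector m (γ' (θ s))) 0 :=
      ((ht.fun_pow μ).fun_mul (hk.comp_of_eq hθ hθ0)).continuousAt.smul
        ((analyticAt_chartVector m _).comp a2).continuousAt
    have := tendsto_nhds_unique_of_eventuallyEq (c1.tendsto.mono_left nhdsWithin_le_nhds)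
      (c2.tendsto.mono_left nhdsWithin_le_nhds) hev
    simp only [hγ'.map_zero, hθ0, ht0] at this
    rw [mul_comm, ← smul_smul] at this
    exact smul_right_injective _ hk0 this
  have hkey : ∃ (F' : ℂ × ℂ → ℂ × ℂ) (U : ℂ × ℂ → ℂ), AnalyticAt ℂ F' 0 ∧ F' 0 = 0 ∧
      AnalyticAt ℂ U 0 ∧ U 0 = deriv θ 0 ^ μ ∧
      (∀ᶠ p in 𝓝 0, blowUpChart m (F' p) = F (blowUpChart m p)) ∧
      (∀ᶠ p in 𝓝 0, exceptionalCoord m (F' p) = exceptionalCoord m p * U p) := by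
    induction m using OnePoint.rec with
    | infty =>
      have e1 : W₁ 0 = 0 := (congrArg Prod.fst hW0).trans (mul_zero _)
      have e2 : W₂ 0 = deriv θ 0 ^ μ := (congrArg Prod.snd hW0).trans (mul_one _)
      have hne : W₂ 0 ≠ 0 := e2 ▸ pow_ne_zero _ hθ1
      refine ⟨fun p => (W₁ p / W₂ p, p.2 * W₂ p), W₂,
        (hW₁.fun_div hW₂ hne).prod (analyticAt_snd.fun_mul hW₂), ?_, hW₂, e2, ?_,
        Eventually.of_forall fun p => rfl⟩
      · simp only [e1, zero_div, Prod.snd_zero, zero_mul]; rfl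
      · filter_upwards [hW, hW₂.continuousAt.eventually_ne hne] with p hp hp2
        rw [hp]
        refine Prod.ext ?_ rfl
        change W₁ p / W₂ p * (p.2 * W₂ p) = p.2 * W₁ p
        field_simp
    | coe c =>
      have e1 : W₁ 0 = deriv θ 0 ^ μ := (congrArg Prod.fst hW0).trans (mul_one _)
      have e2 : W₂ 0 = deriv θ 0 ^ μ * (0 + c) := congrArg Prod.snd hW0
      have hne : W₁ 0 ≠ 0 := e1 ▸ pow_ne_zero _ hθ1
      refine ⟨fun p => (p.1 * W₁ p, W₂ p / W₁ p - c), W₁,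
        (analyticAt_fst.fun_mul hW₁).prod ((hW₂.fun_div hW₁ hne).fun_sub analyticAt_const),
        ?_, hW₁, e1, ?_, Eventually.of_forall fun p => rfl⟩
      · simp only [e2, ← e1, zero_add, mul_div_cancel_left₀ _ hne, sub_self, Prod.fst_zero, zero_mul]; rfl
      · filter_upwards [hW, hW₁.continuousAt.eventually_ne hne] with p hp hp2
        rw [hp]
        refine Prod.ext rfl ?_
        change p.1 * W₁ p * (W₂ p / W₁ p - c + c) = p.1 * W₂ p
        rw [sub_add_cancel]
        field_simp
  obtain ⟨F', U, hF', hF'0, hU, hU0, hch, heU⟩ := hkey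
  refine ⟨F', U, μ, hμ, hF', hF'0, hU, hU0, hch, heU, ?_⟩
  have hne : ∀ᶠ s in 𝓝[≠] 0, exceptionalCoord m (γ' s) ≠ 0 := by
    filter_upwards [self_mem_nhdsWithin, hek.filter_mono nhdsWithin_le_nhds,
      (hk.continuousAt.eventually_ne hk0).filter_mono nhdsWithin_le_nhds] with s h0 h1 h2
    rw [h1]
    exact mul_ne_zero (pow_ne_zero _ h0) h2
  rw [eventually_nhdsWithin_iff] at hne
  have hθne := eventually_nhdsNE_of_conj hθ hθ0 hθ1
  rw [eventually_nhdsWithin_iff] at hθne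
  filter_upwards [hθt0.eventually hne, hθne, hc, hθt0.eventually hc, hγ'.tendsto.eventually hch,
    hconj] with s h1 h2 h3 h4 h5 h6
  by_cases hs : s = 0
  · rw [hs, hγ'.map_zero, hF'0, hθ0, hγ'.map_zero]
  · exact (blowUpChart_injective (h1 (h2 hs)) (by rw [h4, h5, h3, h6])).symm

/-! ### Decay along orbits with given iterated tangents -/

/-- The projective line is compact, so uniqueness of the cluster point suffices, and each cluster
point of the secants is a limit line of `S`. -/
theorem tendsto_lineThrough {S : Set (ℂ × ℂ)} {m : OnePoint ℂ} (hS : limitLines S ⊆ {m})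
    {p : ℕ → ℂ × ℂ} (hp : Tendsto p atTop (𝓝 0)) (hpS : ∀ᶠ n in atTop, p n ∈ S) :
    Tendsto (fun n => lineThrough (p n)) atTop (𝓝 m) := by
  refine le_nhds_of_unique_clusterPt fun l hl => hS ?_
  change ((0 : ℂ × ℂ), l) ∈ closure (blowUpLift S)
  rw [mem_closure_iff_nhds]
  intro A hA
  obtain ⟨B, hB, C, hC, hBC⟩ := mem_nhds_prod_iff.1 hA
  have h1 : ∃ᶠ n in atTop, lineThrough (p n) ∈ C :=
    (clusterPt_iff_frequently.1 hl C hC)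
  obtain ⟨n, hn, hnB, hnS⟩ := (h1.and_eventually (Filter.Eventually.and (hp hB) hpS)).exists
  exact ⟨(p n, lineThrough (p n)), hBC ⟨hnB, hn⟩, p n, hnS, rfl⟩

/-- The lift of a sequence that is tangent to the line `m`. -/
theorem exists_lift_seq {S : Set (ℂ × ℂ)} {m : OnePoint ℂ} (hS : limitLines S ⊆ {m})
    {p : ℕ → ℂ × ℂ} (hp : Tendsto p atTop (𝓝 0)) (hpS : ∀ᶠ n in atTop, p n ∈ S)
    (hp0 : ∀ᶠ n in atTop, p n ≠ 0) : ∃ q : ℕ → ℂ × ℂ, Tendsto q atTop (𝓝 0) ∧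
      ∀ᶠ n in atTop, blowUpChart m (q n) = p n ∧ exceptionalCoord m (q n) ≠ 0 := by
  have hl := tendsto_lineThrough hS hp hpS
  have hfst : Tendsto (fun n => (p n).1) atTop (𝓝 0) := (continuous_fst.tendsto _).comp hp
  have hsnd : Tendsto (fun n => (p n).2) atTop (𝓝 0) := (continuous_snd.tendsto _).comp hp
  induction m using OnePoint.rec with
  | infty =>
    -- Convergence to `∞` means that the slope leaves every closed disc; the product form also
    -- covers points with vanishing first coordinate.
    have hbig : ∀ R : ℝ, 0 ≤ R → ∀ᶠ n in atTop, (p n).2 ≠ 0 ∧ R * ‖(p n).1‖ ≤ ‖(p n).2‖ := by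
      intro R hR
      have hop : IsOpen ((((↑) : ℂ → OnePoint ℂ) '' Metric.closedBall 0 R)ᶜ) :=
        OnePoint.isOpen_compl_image_coe.2 ⟨Metric.isClosed_closedBall, isCompact_closedBall _ _⟩
      filter_upwards [hl (hop.mem_nhds (by simp)), hp0] with n hn h0
      by_cases h1 : (p n).1 = 0
      · refine ⟨fun h2 => h0 (Prod.ext h1 h2), ?_⟩
        rw [h1, norm_zero, mul_zero]
        exact norm_nonneg _
      · have hlt : R < ‖(p n).2 / (p n).1‖ := by
          by_contra hcon
          refine hn ⟨(p n).2 / (p n).1, ?_, ?_⟩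
          · rw [mem_closedBall_zero_iff]; exact not_lt.1 hcon
          · simp only [lineThrough, if_neg h1]
        refine ⟨fun h2 => ?_, ?_⟩
        · rw [h2, zero_div, norm_zero] at hlt
          exact absurd hR (not_le.2 hlt)
        · rw [norm_div, lt_div_iff₀ (norm_pos_iff.2 h1)] at hlt
          exact hlt.le
    have h2 : Tendsto (fun n => (p n).1 / (p n).2) atTop (𝓝 0) := by
      rw [Metric.tendsto_nhds]
      intro ε hε
      filter_upwards [hbig (2 / ε) (by positivity)] with n hn
      have h3 : 0 < ‖(p n).2‖ := norm_pos_iff.2 hn.1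
      rw [dist_zero_right, norm_div, div_lt_iff₀ h3]
      have h4 : ‖(p n).1‖ ≤ ε / 2 * ‖(p n).2‖ := by
        calc ‖(p n).1‖ = ε / 2 * (2 / ε * ‖(p n).1‖) := by field_simp
          _ ≤ _ := by gcongr; exact hn.2
      nlinarith
    refine ⟨fun n => ((p n).1 / (p n).2, (p n).2), h2.prodMk_nhds hsnd,
      (hbig 0 le_rfl).mono fun n hn => ⟨?_, hn.1⟩⟩
    exact Prod.ext (div_mul_cancel₀ _ hn.1) rfl
  | coe c =>
    have h1 : ∀ᶠ n in atTop, (p n).1 ≠ 0 := by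
      filter_upwards [hl.eventually_ne (OnePoint.coe_ne_infty c)] with n hn h
      exact hn (if_pos h)
    have h2 : Tendsto (fun n => (p n).2 / (p n).1) atTop (𝓝 c) := by
      rw [OnePoint.isOpenEmbedding_coe.tendsto_nhds_iff]
      refine hl.congr' (h1.mono fun n hn => ?_)
      exact if_neg hn
    refine ⟨fun n => ((p n).1, (p n).2 / (p n).1 - c), ?_, h1.mono fun n hn => ⟨?_, hn⟩⟩
    · have h3 := h2.sub_const c
      rw [sub_self] at h3
      exact hfst.prodMk_nhds h3
    · refine Prod.ext rfl ?_
      change (p n).1 * ((p n).2 / (p n).1 - c + c) = (p n).2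
      rw [sub_add_cancel, mul_div_cancel₀ _ hn]

/-- The definition adds the last blow-up, while the induction on decay splits off the first. -/
theorem iteratedLift_succ' (m : ℕ → OnePoint ℂ) (S : Set (ℂ × ℂ)) (n : ℕ) :
    iteratedLift m S (n + 1) = iteratedLift (fun k => m (k + 1)) (blowUpChart (m 0) ⁻¹' S) n := by
  induction n with
  | zero => rfl
  | succ n ih =>
    change blowUpChart (m (n + 1)) ⁻¹' iteratedLift m S (n + 1) = _
    rw [ih]; rfl

theorem exists_le_geometric {u : ℕ → ℝ} {ρ : ℝ} (hρ : 0 < ρ)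
    (h : ∀ᶠ n in atTop, u (n + 1) ≤ ρ * u n) : ∃ C, ∀ᶠ n in atTop, u n ≤ C * ρ ^ n := by
  obtain ⟨N, hN⟩ := eventually_atTop.1 h
  refine ⟨u N / ρ ^ N, eventually_atTop.2 ⟨N, fun n hn => ?_⟩⟩
  induction n, hn using Nat.le_induction with
  | base => rw [div_mul_cancel₀ _ (pow_pos hρ N).ne']
  | succ n hn ih =>
    calc u (n + 1) ≤ ρ * u n := hN n hn
      _ ≤ ρ * (u N / ρ ^ N * ρ ^ n) := by gcongr
      _ = _ := by rw [pow_succ]; ring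

/-- The values, along an orbit that has the same iterated tangents as an invariant curve, of a
function that vanishes on the curve decay faster than any power of the inner eigenvalue. -/
theorem exists_decay (K : ℕ) {ρ : ℝ} {lam : ℂ} (hlam0 : lam ≠ 0) (hlam : ‖lam‖ < ρ) (hρ : ρ < 1)
    {F : ℂ × ℂ → ℂ × ℂ} (hF : AnalyticAt ℂ F 0) (hF0 : F 0 = 0) {γ : ℂ → ℂ × ℂ} (hγ : IsArc γ)
    {θ : ℂ → ℂ} (hθ : AnalyticAt ℂ θ 0) (hθ0 : θ 0 = 0) (hθ1 : deriv θ 0 = lam)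
    (hconj : ∀ᶠ s in 𝓝 0, F (γ s) = γ (θ s)) {m : ℕ → OnePoint ℂ} {Γ : ℕ → Ideal Series2}
    (hΓ : ∀ f, f ∈ Γ 0 ↔ evalArc (taylorArc γ) f = 0)
    (hm : ∀ n, IsTangentLine (Γ n) (m n) ∧ IsStrictTransform (Γ n) (m n) (Γ (n + 1)))
    {S : Set (ℂ × ℂ)} (hS : ∀ n, limitLines (iteratedLift m S n) ⊆ {m n}) {p : ℕ → ℂ × ℂ}
    (hp : Tendsto p atTop (𝓝 0)) (hpS : ∀ᶠ n in atTop, p n ∈ S) (hp0 : ∀ᶠ n in atTop, p n ≠ 0)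
    (hpF : ∀ᶠ n in atTop, F (p n) = p (n + 1)) {h : ℂ × ℂ → ℂ} (hh : AnalyticAt ℂ h 0)
    (hz : ∀ᶠ s in 𝓝 0, h (γ s) = 0) :
    ∃ C : ℝ, ∀ᶠ n in atTop, ‖h (p n)‖ ≤ C * (ρ ^ n) ^ K := by
  have hρ0 : 0 < ρ := (norm_nonneg _).trans_lt hlam
  induction K generalizing F γ m Γ S p h with
  | zero =>
    have h1 : Tendsto (fun n => ‖h (p n)‖) atTop (𝓝 ‖h 0‖) := (hh.continuousAt.tendsto.comp hp).norm
    exact ⟨‖h 0‖ + 1, (h1.eventually_le_const (lt_add_one _)).mono fun n hn => by simpa using hn⟩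
  | succ K ih =>
    -- One blow-up: the data `F`, `γ`, `Γ`, `m`, `S`, `p` are replaced by their lifts, with the same
    -- `θ`, and `h` by the cofactor `g` of the exceptional coordinate. The orbit lifts only from
    -- some index on, which is why the hypotheses on `p` are eventual ones.
    obtain ⟨γ', hγ', hΓ', hc⟩ := (hm 0).2.exists_arc (hm 0).1 hγ hΓ
    obtain ⟨F', U, μ, hμ, hF', hF'0, hU, hU0, hch, heU, hconj'⟩ :=
      exists_lift_map hF hF0 hγ hγ' hc hθ hθ0 (hθ1 ▸ hlam0) hconj
    obtain ⟨q, hq, hqe⟩ := exists_lift_seq (hS 0) hp hpS hp0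
    have hqp := hqe.mono fun n hn => hn.1
    have hqne := hqe.mono fun n hn => hn.2
    have hh0 : h 0 = 0 := by
      have := hz.self_of_nhds
      rwa [hγ.map_zero] at this
    obtain ⟨g, hg, hhg⟩ := exists_eq_exceptionalCoord_mul (m 0) hh hh0
    have hgz : ∀ᶠ s in 𝓝 0, g (γ' s) = 0 := by
      obtain ⟨μ', k, -, hk, hk0, hek⟩ := exists_exceptionalCoord_arc hγ hγ' hc
      have h1 : ∀ᶠ s in 𝓝[≠] 0, g (γ' s) = 0 := by
        filter_upwards [self_mem_nhdsWithin, hek.filter_mono nhdsWithin_le_nhds,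
          (hk.continuousAt.eventually_ne hk0).filter_mono nhdsWithin_le_nhds,
          hc.filter_mono nhdsWithin_le_nhds, hz.filter_mono nhdsWithin_le_nhds,
          (hγ'.tendsto.eventually hhg).filter_mono nhdsWithin_le_nhds] with s h0 h1 h2 h3 h4 h5
        rw [h3, h4, h1] at h5
        exact (mul_eq_zero.1 h5.symm).resolve_left (mul_ne_zero (pow_ne_zero _ h0) h2)
      have a1 : AnalyticAt ℂ (fun s => g (γ' s)) 0 := hg.comp_of_eq hγ'.analyticAt hγ'.map_zero
      exact a1.frequently_zero_iff_eventually_zero.1 h1.frequently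
    have hqF : ∀ᶠ n in atTop, F' (q n) = q (n + 1) := by
      filter_upwards [hq.eventually hch, hqp, (tendsto_add_atTop_nat 1).eventually hqe, hpF]
        with n h1 h2 h3 h4
      exact (blowUpChart_injective h3.2 (by rw [h1, h2, h3.1, h4])).symm
    obtain ⟨C₁, hC₁⟩ := ih hF' hF'0 hγ' hconj' (m := fun n => m (n + 1))
      (Γ := fun n => Γ (n + 1)) hΓ' (fun n => hm (n + 1)) (S := blowUpChart (m 0) ⁻¹' S)
      (fun n => by rw [← iteratedLift_succ']; exact hS (n + 1)) hq
      (by filter_upwards [hqp, hpS] with n h1 h2; rwa [Set.mem_preimage, h1])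
      (hqne.mono fun n hn h0 => hn (by rw [h0, exceptionalCoord_zero])) hqF hg hgz
    -- The exceptional coordinate supplies the extra factor `ρ ^ n`: its multiplier at the centre is
    -- `lam ^ μ` with `μ ≥ 1`, of modulus at most `|lam| < ρ`.
    obtain ⟨C₂, hC₂⟩ := exists_le_geometric (u := fun n => ‖exceptionalCoord (m 0) (q n)‖) hρ0 (by
      have hU1 : ‖U 0‖ < ρ := by
        rw [hU0, hθ1, norm_pow]
        exact (pow_le_of_le_one (norm_nonneg _) (hlam.trans hρ).le hμ).trans_lt hlam
      filter_upwards [hqF, hq.eventually heU,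
        (hU.continuousAt.tendsto.comp hq).norm.eventually_le_const hU1] with n h1 h2 h3
      rw [← h1, h2, norm_mul, mul_comm]
      gcongr
      exact h3)
    refine ⟨C₂ * C₁, ?_⟩
    filter_upwards [hC₁, hC₂, hqp, hq.eventually hhg] with n h1 h2 h3 h4
    rw [← h3, h4, norm_mul]
    calc _ ≤ C₂ * ρ ^ n * (C₁ * (ρ ^ n) ^ K) :=
          mul_le_mul h2 h1 (norm_nonneg _) ((norm_nonneg _).trans h2)
      _ = _ := by rw [pow_succ]; ring

/-! ### The analytic arc of a hyperbolic attracting curve -/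

theorem IsPrimitiveArc.ne_zero {a : Fin 2 → PowerSeries ℂ} (h : IsPrimitiveArc a) : a ≠ 0 := by
  rintro rfl
  refine h 0 0 (fun i => rfl) (map_zero _) (fun i => ?_) (map_zero _)
  exact (PowerSeries.subst_zero_of_constantCoeff_zero (map_zero _)).symm

theorem IsPrimitiveArc.swap {γ : ℂ → ℂ × ℂ} (h : IsPrimitiveArc (taylorArc γ)) :
    IsPrimitiveArc (taylorArc fun t => (γ t).swap) := by
  intro σ τ hσ hτ he
  refine h ![σ 1, σ 0] τ (fun i => ?_) hτ (fun i => ?_)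
  · fin_cases i
    · exact hσ 1
    · exact hσ 0
  · fin_cases i
    · exact he 1
    · exact he 0

theorem IsPrimitiveArc.not_eventually_zero {γ : ℂ → ℂ × ℂ} (h : IsPrimitiveArc (taylorArc γ)) :
    ¬ ∀ᶠ s in 𝓝 0, γ s = 0 := by
  intro h0
  refine h.ne_zero ?_
  rw [taylorArc_congr h0]
  have : taylor1 (fun _ => (0 : ℂ)) = 0 := by rw [taylor1_const, map_zero]
  funext i
  fin_cases i
  · exact this
  · exact this

theorem exists_isEquation_of_fst {γ v : ℂ → ℂ × ℂ} (hγ : AnalyticAt ℂ γ 0) (h0 : γ 0 = 0)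
    (hprim : IsPrimitiveArc (taylorArc γ)) {μ : ℕ} (hμ : μ ≠ 0) (hv : AnalyticAt ℂ v 0)
    (hv0 : (v 0).1 ≠ 0) (he : ∀ᶠ s in 𝓝 0, γ s = s ^ μ • v s) :
    ∃ (χ ψ : ℂ → ℂ) (δ : ℂ → ℂ × ℂ) (h : ℂ × ℂ → ℂ), IsReparam χ ψ ∧ IsArc δ ∧
      (∀ᶠ t in 𝓝 0, δ t = γ (ψ t)) ∧ IsEquation δ h := by
  obtain ⟨χ, ψ, R, hψ⟩ := exists_reparam hμ hv hv0 he
  let y : ℂ → ℂ := fun t => (γ (ψ t)).2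
  have e1 : ∀ᶠ t in 𝓝 0, (t ^ μ, y t) = γ (ψ t) := hψ.mono fun t ht => Prod.ext ht.symm rfl
  have hy : AnalyticAt ℂ y 0 := analyticAt_arc_snd (hγ.comp_of_eq R.analyticAt' R.map_zero')
  have hy0 : y 0 = 0 := by simp only [y, R.map_zero', h0, Prod.snd_zero]
  have hδ : AnalyticAt ℂ (fun t => (t ^ μ, y t)) 0 := (analyticAt_var.fun_pow μ).prod hy
  have hprim' : IsPrimitiveArc (taylorArc fun t => (t ^ μ, y t)) := by
    refine hprim.of_subst R.constantCoeff_taylor1 fun i => ?_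
    rw [← taylorArc_comp hδ R.analyticAt R.map_zero]
    refine congrFun (taylorArc_congr ?_) i
    filter_upwards [R.tendsto.eventually e1, R.left_inv] with s h1 h2
    rw [h1, h2]
  have hinj := hprim'.exists_injOn hμ hy hy0
  obtain ⟨h, H⟩ := exists_isEquation_of_puiseux hμ hy hy0 hinj
  exact ⟨χ, ψ, _, h, R, ⟨hδ, Prod.ext (zero_pow hμ) hy0, hinj⟩, e1, H⟩

/-- A primitive analytic arc has, up to a change of parameter, a reduced equation. -/
theorem IsPrimitiveArc.exists_isEquation {γ : ℂ → ℂ × ℂ} (hγ : AnalyticAt ℂ γ 0) (h0 : γ 0 = 0)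
    (hprim : IsPrimitiveArc (taylorArc γ)) :
    ∃ (χ ψ : ℂ → ℂ) (δ : ℂ → ℂ × ℂ) (h : ℂ × ℂ → ℂ), IsReparam χ ψ ∧ IsArc δ ∧
      (∀ᶠ t in 𝓝 0, δ t = γ (ψ t)) ∧ IsEquation δ h := by
  obtain ⟨μ, v, hμ, hv, hv0, he⟩ := exists_eq_pow_smul hγ h0 hprim.not_eventually_zero
  by_cases h1 : (v 0).1 = 0
  · have h2 : (v 0).2 ≠ 0 := fun h => hv0 (Prod.ext h1 h)
    obtain ⟨χ, ψ, δ, h, R, hδ, hδγ, H⟩ := exists_isEquation_of_fst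
      (γ := fun t => (γ t).swap) (v := fun t => (v t).swap) ((analyticAt_swap _).comp hγ)
      (by rw [h0]; rfl) hprim.swap hμ ((analyticAt_swap _).comp hv) h2
      (he.mono fun s hs => by rw [hs]; rfl)
    exact ⟨χ, ψ, _, _, R, hδ.swap, hδγ.mono fun t ht => by rw [ht, Prod.swap_swap],
      H.swap hδ.map_zero⟩
  · exact exists_isEquation_of_fst hγ h0 hprim hμ hv h1 he

theorem IsReparam.deriv_mul_deriv {χ ψ : ℂ → ℂ} (R : IsReparam χ ψ) :
    deriv χ 0 * deriv ψ 0 = 1 := by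
  have h1 : HasDerivAt χ (deriv χ 0) (ψ 0) := by
    rw [R.map_zero']; exact R.analyticAt.differentiableAt.hasDerivAt
  have h2 := h1.comp 0 R.analyticAt'.differentiableAt.hasDerivAt
  exact h2.unique ((hasDerivAt_id (0 : ℂ)).congr_of_eventuallyEq R.right_inv)

/-- A hyperbolic attracting curve is the image of an analytic arc on which `F` is a contraction. -/
theorem IsDiffeoGerm.exists_arc {F : ℂ × ℂ → ℂ × ℂ} (hF : IsDiffeoGerm F) {Γ : Ideal Series2}
    {lam : ℂ} (hΓ : HasInnerEigenvalue F Γ lam) (hlam : ‖lam‖ < 1) :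
    ∃ (γ : ℂ → ℂ × ℂ) (θ : ℂ → ℂ) (h : ℂ × ℂ → ℂ), IsArc γ ∧ AnalyticAt ℂ θ 0 ∧ θ 0 = 0 ∧
      deriv θ 0 = lam ∧ (∀ᶠ s in 𝓝 0, F (γ s) = γ (θ s)) ∧
      (∀ f, f ∈ Γ ↔ evalArc (taylorArc γ) f = 0) ∧ IsEquation γ h := by
  obtain ⟨a, η, hirr, hη0, hη1, hlam0, hconj⟩ := hΓ
  have ha0 := hirr.1.2.1
  obtain ⟨φ, hφ0, hφ1, hφ⟩ := exists_linearization hη0 hη1 hlam0 hlam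
  have hφne : φ ≠ 0 := by rintro rfl; simp at hφ1
  let b : Fin 2 → PowerSeries ℂ := fun i => PowerSeries.subst φ (a i)
  have hb0 : ∀ i, PowerSeries.constantCoeff (b i) = 0 := fun i => constantCoeff_subst1 hφ0 (ha0 i)
  have hlX : PowerSeries.constantCoeff (lam • PowerSeries.X : PowerSeries ℂ) = 0 := by simp
  have hb : ∀ i, evalArc b (taylorMap F i) = PowerSeries.rescale lam (b i) := by
    intro i
    rw [evalArc_subst ha0 hφ0, hconj, subst1_subst1 hη0 hφ0, hφ, PowerSeries.rescale_eq_subst,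
      PowerSeries.rescale_eq_subst, subst1_subst1 hφ0 hlX]
  obtain ⟨γ, hγ, hγ0, hγb⟩ := hF.exists_taylorArc_eq hlam hb0 hb
  -- The linearizing series `φ` has an inverse for composition, through which `a` is a
  -- reparametrization of `b`.
  have hprim : IsPrimitiveArc (taylorArc γ) := by
    have hu : IsUnit (PowerSeries.coeff 1 φ) := by rw [hφ1]; exact isUnit_one
    rw [hγb]
    refine hirr.isPrimitiveArc.of_subst (χ := PowerSeries.substInvOfIsUnit φ hu) ?_ fun i => ?_
    · simp
    · rw [subst1_subst1 hφ0 (by simp), PowerSeries.subst_substInvOfIsUnit_right _ hφ0 hu]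
      exact (PowerSeries.X_subst (a i)).symm
  have hconj' : ∀ᶠ s in 𝓝 0, F (γ s) = γ (lam * s) := by
    have hl : AnalyticAt ℂ (fun s : ℂ => lam * s) 0 := analyticAt_const.fun_mul analyticAt_var
    have hγl : AnalyticAt ℂ (fun s => γ (lam * s)) 0 := hγ.comp_of_eq hl (mul_zero _)
    have hFγ : AnalyticAt ℂ (fun s => F (γ s)) 0 := hF.1.comp_of_eq hγ hγ0
    have h1 : ∀ᶠ s in 𝓝 0, (F (γ s)).1 = (γ (lam * s)).1 := by
      rw [← taylor1_inj (analyticAt_arc_fst hFγ) (analyticAt_arc_fst hγl),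
        taylor1_comp (f := fun p => (F p).1) (analyticAt_fst.comp hF.1) hγ hγ0, hγb,
        taylor1_mul_left (analyticAt_arc_fst hγ)]
      exact (hb 0).trans (congrArg _ (congrFun hγb 0).symm)
    have h2 : ∀ᶠ s in 𝓝 0, (F (γ s)).2 = (γ (lam * s)).2 := by
      rw [← taylor1_inj (analyticAt_arc_snd hFγ) (analyticAt_arc_snd hγl),
        taylor1_comp (f := fun p => (F p).2) (analyticAt_snd.comp hF.1) hγ hγ0, hγb,
        taylor1_mul_left (analyticAt_arc_snd hγ)]
      exact (hb 1).trans (congrArg _ (congrFun hγb 1).symm)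
    filter_upwards [h1, h2] with s h1 h2 using Prod.ext h1 h2
  obtain ⟨χ, ψ, δ, h, R, hδ, hδγ, H⟩ := hprim.exists_isEquation hγ hγ0
  have hmul : AnalyticAt ℂ (fun t => lam * ψ t) 0 := analyticAt_const.fun_mul R.analyticAt'
  have hmul0 : lam * ψ 0 = 0 := by rw [R.map_zero', mul_zero]
  have hmult : Tendsto (fun t => lam * ψ t) (𝓝 0) (𝓝 0) := by
    simpa [R.map_zero'] using hmul.continuousAt.tendsto
  have hθ : AnalyticAt ℂ (fun t => χ (lam * ψ t)) 0 := R.analyticAt.comp_of_eq hmul hmul0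
  have hθ0 : χ (lam * ψ 0) = 0 := by rw [hmul0, R.map_zero]
  -- In the Puiseux parameter the linear contraction becomes its conjugate by `χ`, with the same
  -- derivative at `0`.
  refine ⟨δ, fun t => χ (lam * ψ t), h, hδ, hθ, hθ0, ?_, ?_, fun f => ?_, H⟩
  · have h1 : HasDerivAt χ (deriv χ 0) (lam * ψ 0) := by
      rw [hmul0]; exact R.analyticAt.differentiableAt.hasDerivAt
    have h2 := h1.comp 0 (R.analyticAt'.differentiableAt.hasDerivAt.const_mul lam)
    refine h2.deriv.trans ?_
    linear_combination lam * R.deriv_mul_deriv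
  · have ht : Tendsto (fun t => χ (lam * ψ t)) (𝓝 0) (𝓝 0) := R.tendsto.comp hmult
    filter_upwards [hδγ, R.symm.tendsto.eventually hconj', ht.eventually hδγ,
      hmult.eventually R.left_inv] with t h1 h2 h3 h4
    rw [h1, h2, h3, h4]
  · rw [taylorArc_congr hδγ, evalArc_comp_eq_zero_iff hγ hγ0 R.symm, hγb, hirr.1.2.2,
      evalArc_subst ha0 hφ0, subst1_eq_zero_iff hφ0 hφne]

/-! ### The asymptotic orbits -/

/-- Geometric decrease at most, against decay faster than any geometric rate: `u n ≤ L ^ j u (n + j)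
≤ C' (L ρ ^ M) ^ j` with `C'` independent of `j`. Choose `M` with `L ρ ^ M < 1` and let `j → ∞`. -/
theorem eventually_eq_zero_of_decay {u : ℕ → ℝ} (hu : ∀ n, 0 ≤ u n) {K ρ : ℝ} (hρ0 : 0 ≤ ρ)
    (hρ : ρ < 1) (h : ∀ᶠ n in atTop, u n ≤ K * u (n + 1))
    (hd : ∀ M : ℕ, ∃ C, ∀ᶠ n in atTop, u n ≤ C * (ρ ^ n) ^ M) : ∀ᶠ n in atTop, u n = 0 := by
  set L := max K 1
  have hL : 0 < L := lt_max_of_lt_right one_pos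
  obtain ⟨M, hM⟩ := exists_pow_lt_of_lt_one (inv_pos.2 hL) hρ
  have hLM : L * ρ ^ M < 1 := by
    calc L * ρ ^ M < L * L⁻¹ := by gcongr
      _ = 1 := mul_inv_cancel₀ hL.ne'
  obtain ⟨C, hC⟩ := hd M
  obtain ⟨N, hN⟩ := eventually_atTop.1 (h.and hC)
  refine eventually_atTop.2 ⟨N, fun n hn => le_antisymm ?_ (hu n)⟩
  have h1 : ∀ j, u n ≤ L ^ j * u (n + j) := by
    intro j
    induction j with
    | zero => simp
    | succ j ih =>
      refine ih.trans ?_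
      have h2 : u (n + j) ≤ L * u (n + j + 1) := ((hN (n + j) (by omega)).1).trans
        (mul_le_mul_of_nonneg_right (le_max_left _ _) (hu _))
      calc L ^ j * u (n + j) ≤ L ^ j * (L * u (n + j + 1)) := by gcongr
        _ = L ^ (j + 1) * u (n + (j + 1)) := by rw [pow_succ, mul_assoc]; rfl
  have h3 : ∀ j, u n ≤ C * (ρ ^ n) ^ M * (L * ρ ^ M) ^ j := by
    intro j
    refine (h1 j).trans ?_
    calc L ^ j * u (n + j) ≤ L ^ j * (C * (ρ ^ (n + j)) ^ M) := by
          gcongr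
          exact (hN (n + j) (by omega)).2
      _ = _ := by rw [mul_pow, pow_add, mul_pow, ← pow_mul ρ j M, ← pow_mul ρ M j, mul_comm j M]; ring
  have h4 := (tendsto_pow_atTop_nhds_zero_of_lt_one (by positivity) hLM).const_mul
    (C * (ρ ^ n) ^ M)
  rw [mul_zero] at h4
  exact ge_of_tendsto' h4 h3

theorem IsEquation.eventually_eq_zero {γ : ℂ → ℂ × ℂ} {h : ℂ × ℂ → ℂ} (H : IsEquation γ h)
    (hγ : AnalyticAt ℂ γ 0) (h0 : γ 0 = 0) : ∀ᶠ s in 𝓝 0, h (γ s) = 0 := by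
  have ha : AnalyticAt ℂ (fun s => h (γ s)) 0 := H.analyticAt.comp_of_eq hγ h0
  rw [← taylor1_eq_zero_iff ha, taylor1_comp H.analyticAt hγ h0, H.evalArc_eq_zero_iff]

/-- The equation of an invariant arc does not decrease too fast along orbits. -/
theorem IsEquation.exists_le_comp {F : ℂ × ℂ → ℂ × ℂ} (hF : IsDiffeoGerm F) {γ : ℂ → ℂ × ℂ}
    (hγ : IsArc γ) {θ : ℂ → ℂ} (hθ : AnalyticAt ℂ θ 0) (hθ0 : θ 0 = 0) (hθ1 : deriv θ 0 ≠ 0)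
    (hconj : ∀ᶠ s in 𝓝 0, F (γ s) = γ (θ s)) {h : ℂ × ℂ → ℂ} (H : IsEquation γ h) :
    ∃ K : ℝ, ∀ᶠ p in 𝓝 0, ‖h p‖ ≤ K * ‖h (F p)‖ := by
  obtain ⟨G, hG, hG0, hGF, -⟩ := hF.exists_inverse
  obtain ⟨ψ, hψ, hψ0, -, hr⟩ := exists_local_inverse hθ hθ0 hθ1
  have hψt : Tendsto ψ (𝓝 0) (𝓝 0) := by simpa [hψ0] using hψ.continuousAt.tendsto
  have hFt : Tendsto F (𝓝 0) (𝓝 0) := by simpa [hF.2.1] using hF.1.continuousAt.tendsto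
  -- `G` maps the arc into itself, through the local inverse `ψ` of `θ`, so `h ∘ G` vanishes on it
  -- and is `O(h)`; evaluation at `F p` gives the claim.
  obtain ⟨K, hK⟩ := H.exists_le (fun p => h (G p)) (H.analyticAt.comp_of_eq hG hG0) (by
    filter_upwards [hψt.eventually hconj, hr, (hγ.tendsto.comp hψt).eventually hGF,
      hψt.eventually (H.eventually_eq_zero hγ.analyticAt hγ.map_zero)] with t h1 h2 h3 h4
    rw [h2] at h1
    rw [← h1]
    exact (congrArg h h3).trans h4)
  refine ⟨K, ?_⟩
  filter_upwards [hFt.eventually hK, hGF] with p h1 h2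
  rwa [h2] at h1

/-- Conflict of the two rates: `exists_le_comp` bounds the decrease of `h` along the orbit from
below, `exists_decay` from above. -/
theorem IsEquation.eventually_eq_zero_of_isAsymptoticOrbit {F : ℂ × ℂ → ℂ × ℂ}
    (hF : IsDiffeoGerm F) {Γ : Ideal Series2} {γ : ℂ → ℂ × ℂ} (hγ : IsArc γ)
    (hΓ : ∀ f, f ∈ Γ ↔ evalArc (taylorArc γ) f = 0) {θ : ℂ → ℂ} (hθ : AnalyticAt ℂ θ 0)
    (hθ0 : θ 0 = 0) (hθ1 : deriv θ 0 ≠ 0) (hθ2 : ‖deriv θ 0‖ < 1)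
    (hconj : ∀ᶠ s in 𝓝 0, F (γ s) = γ (θ s)) {h : ℂ × ℂ → ℂ} (H : IsEquation γ h) {p : ℂ × ℂ}
    (hp : IsAsymptoticOrbit F Γ p) : ∀ᶠ n : ℕ in atTop, h (F^[n] p) = 0 := by
  obtain ⟨hp0, hS0, m, hm, G, hG0, hG⟩ := hp
  obtain ⟨K, hK⟩ := H.exists_le_comp hF hγ hθ hθ0 hθ1 hconj
  obtain ⟨ρ, hρ1, hρ2⟩ := exists_between hθ2
  have := eventually_eq_zero_of_decay (u := fun n => ‖h (F^[n] p)‖) (fun n => norm_nonneg _)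
    (K := K) ((norm_nonneg _).trans hρ1.le) hρ2 (by
      filter_upwards [hp0.eventually hK] with n hn
      rwa [Function.iterate_succ_apply'])
    (fun M => exists_decay M hθ1 hρ1 hρ2 hF.1 hF.2.1 hγ hθ hθ0 rfl hconj (hG0 ▸ hΓ) hG
      (fun n => (hm n).subset) hp0 (Eventually.of_forall fun n => ⟨n, rfl⟩)
      (Eventually.of_forall fun n hn => hS0 ⟨n, hn⟩)
      (Eventually.of_forall fun n => (Function.iterate_succ_apply' F n p).symm) H.analyticAt
      (H.eventually_eq_zero hγ.analyticAt hγ.map_zero))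
  exact this.mono fun n hn => norm_eq_zero.1 hn

/-! ### The stable set of a hyperbolic attracting curve -/

/-- A function whose Taylor series generates a non-singular curve is a submersion. -/
theorem IsNonsingular.fderiv_ne_zero {h : ℂ × ℂ → ℂ} (hh : AnalyticAt ℂ h 0)
    (hΓ : IsNonsingular (Ideal.span {taylor h})) : fderiv ℂ h 0 ≠ 0 := by
  obtain ⟨f, hf, hf0, i, hi⟩ := hΓ
  intro hd
  have hfd : taylor h ∣ f := by
    rw [← Ideal.mem_span_singleton, hf]
    exact Ideal.mem_span_singleton_self f
  have hdf : f ∣ taylor h := by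
    rw [← Ideal.mem_span_singleton, ← hf]
    exact Ideal.mem_span_singleton_self _
  have h0 : MvPowerSeries.constantCoeff (taylor h) = 0 := by
    obtain ⟨w, hw⟩ := hdf
    rw [hw, map_mul, hf0, zero_mul]
  have hfd1 : HasFDerivAt h (0 : ℂ × ℂ →L[ℂ] ℂ) ((0 : ℂ), (0 : ℂ)) :=
    hd ▸ hh.differentiableAt.hasFDerivAt
  have hx : MvPowerSeries.coeff (Finsupp.single 0 1) (taylor h) = 0 := by
    have h1 : HasDerivAt (fun x : ℂ => h (x, 0)) 0 0 :=
      hfd1.comp_hasDerivAt (f := fun x : ℂ => (x, (0 : ℂ))) (0 : ℂ)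
        ((hasDerivAt_id (0 : ℂ)).prodMk (hasDerivAt_const (0 : ℂ) (0 : ℂ)))
    change taylor h (Finsupp.single 0 1) = 0
    simp [taylor, iteratedDeriv_one, h1.deriv]
  have hy : MvPowerSeries.coeff (Finsupp.single 1 1) (taylor h) = 0 := by
    have h1 : HasDerivAt (fun y : ℂ => h (0, y)) 0 0 :=
      hfd1.comp_hasDerivAt (f := fun y : ℂ => ((0 : ℂ), y)) (0 : ℂ)
        ((hasDerivAt_const (0 : ℂ) (0 : ℂ)).prodMk (hasDerivAt_id (0 : ℂ)))
    change taylor h (Finsupp.single 1 1) = 0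
    simp [taylor, iteratedDeriv_one, h1.deriv]
  -- If the differential vanished, `taylor h` and so its multiple `f` would have no linear part.
  have ho : ((2 : ℕ) : ℕ∞) ≤ (taylor h).order := by
    refine MvPowerSeries.nat_le_order fun d hd => ?_
    rw [Finsupp.degree_eq_sum, Fin.sum_univ_two] at hd
    have h3 : d = 0 ∨ d = Finsupp.single 0 1 ∨ d = Finsupp.single 1 1 := by
      rcases (by omega : (d 0 = 0 ∧ d 1 = 0) ∨ (d 0 = 1 ∧ d 1 = 0) ∨ (d 0 = 0 ∧ d 1 = 1))
        with ⟨h1, h2⟩ | ⟨h1, h2⟩ | ⟨h1, h2⟩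
      · left; ext j; fin_cases j <;> simp [h1, h2]
      · right; left; ext j; fin_cases j <;> simp [h1, h2]
      · right; right; ext j; fin_cases j <;> simp [h1, h2]
    rcases h3 with rfl | rfl | rfl
    · rwa [MvPowerSeries.coeff_zero_eq_constantCoeff]
    · exact hx
    · exact hy
  obtain ⟨w, rfl⟩ := hfd
  refine hi (MvPowerSeries.coeff_of_lt_order ?_)
  have h4 := (le_self_add.trans' ho).trans (MvPowerSeries.le_order_mul (f := taylor h) (g := w))
  refine lt_of_lt_of_le ?_ h4
  rw [Finsupp.degree_single]
  exact_mod_cast one_lt_two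

theorem iterate_arc {F : ℂ × ℂ → ℂ × ℂ} {γ : ℂ → ℂ × ℂ} {θ : ℂ → ℂ} {r c : ℝ} (hc0 : 0 ≤ c)
    (hc : c < 1) (hθ : ∀ t, ‖t‖ < r → ‖θ t‖ ≤ c * ‖t‖)
    (hconj : ∀ t, ‖t‖ < r → F (γ t) = γ (θ t)) {t : ℂ} (ht : ‖t‖ < r) (n : ℕ) :
    ‖θ^[n] t‖ ≤ c ^ n * ‖t‖ ∧ F^[n] (γ t) = γ (θ^[n] t) := by
  induction n with
  | zero => simp
  | succ n ih =>
    have h1 : ‖θ^[n] t‖ < r := by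
      refine (ih.1.trans ?_).trans_lt ht
      exact mul_le_of_le_one_left (norm_nonneg _) (pow_le_one₀ hc0 hc.le)
    rw [Function.iterate_succ_apply', Function.iterate_succ_apply', ih.2, hconj _ h1]
    refine ⟨(hθ _ h1).trans ?_, rfl⟩
    calc c * ‖θ^[n] t‖ ≤ c * (c ^ n * ‖t‖) := by gcongr; exact ih.1
      _ = _ := by rw [pow_succ']; ring

theorem IsStableSet.of_subset {F : ℂ × ℂ → ℂ × ℂ} {V B C : Set (ℂ × ℂ)} (hB : IsStableSet F V B)
    (hC : C ⊆ B) (hF : Set.MapsTo F C C) : IsStableSet F V C :=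
  ⟨hB.1, hB.2.1, hB.2.2.1, hC.trans hB.2.2.2.1, hF, fun p hp => hB.2.2.2.2.2 p (hC hp)⟩

end FormalCurve

end

/-! ### The main theorem -/

theorem mainTheorem5 (F : ℂ × ℂ → ℂ × ℂ) (hF : FormalCurve.IsDiffeoGerm F)
    (Γ : Ideal FormalCurve.Series2) (hΓ : FormalCurve.IsFormalCurve Γ)
    (hinv : FormalCurve.IsInvariant F Γ) (hatt : FormalCurve.IsHyperbolicAttracting F Γ) :
    ∃ h : ℂ × ℂ → ℂ, AnalyticAt ℂ h 0 ∧ Γ = Ideal.span {FormalCurve.taylor h} ∧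
      ∀ U ∈ 𝓝 (0 : ℂ × ℂ), ∃ V ⊆ U, IsOpen V ∧ (0 : ℂ × ℂ) ∈ V ∧ AnalyticOnNhd ℂ h V ∧
        FormalCurve.IsStableSet F V (FormalCurve.zeroSet h V) ∧
        FormalCurve.IsStableCurve F V (FormalCurve.zeroSet h V \ {0}) ∧
        (FormalCurve.IsNonsingular Γ →
          FormalCurve.IsStableCurve F V (FormalCurve.zeroSet h V)) ∧
        ∀ p : ℂ × ℂ, FormalCurve.IsAsymptoticOrbit F Γ p →
          ∀ᶠ n : ℕ in atTop, F^[n] p ∈ FormalCurve.zeroSet h V := by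
  obtain ⟨lam, hlam, hlam1⟩ := hatt
  have hlam0 : lam ≠ 0 := by
    obtain ⟨-, -, -, -, -, h, -⟩ := hlam
    exact h
  obtain ⟨γ, θ, h, hγ, hθ, hθ0, rfl, hconj, hker, H⟩ := hF.exists_arc hlam hlam1
  have hspan : Γ = Ideal.span {FormalCurve.taylor h} := by
    ext f
    rw [hker, H.evalArc_eq_zero_iff, Ideal.mem_span_singleton]
  refine ⟨h, H.analyticAt, hspan, fun U hU => ?_⟩
  obtain ⟨c, hc1, hc2⟩ := exists_between hlam1
  have hc0 : 0 ≤ c := (norm_nonneg _).trans hc1.le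
  obtain ⟨k, hk, hk0, hθk⟩ := FormalCurve.exists_eq_mul_of_map_zero hθ hθ0
  -- Small discs are mapped into themselves by `θ`, which makes the curve invariant; no other point
  -- is sent to `0`, which keeps the curve without the origin invariant.
  have hsmall : ∀ᶠ t in 𝓝 0, ‖θ t‖ ≤ c * ‖t‖ ∧ (t ≠ 0 → θ t ≠ 0) := by
    rw [← hk0] at hc1 hlam0
    filter_upwards [hθk, hk.continuousAt.norm.eventually_le_const hc1,
      hk.continuousAt.eventually_ne hlam0] with t h1 h2 h3
    rw [h1, norm_mul, mul_comm]
    exact ⟨mul_le_mul_of_nonneg_right h2 (norm_nonneg _), fun h => mul_ne_zero h h3⟩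
  obtain ⟨W, hW, hinj⟩ := hγ.injOn
  obtain ⟨r₀, hr₀, hall⟩ := FormalCurve.exists_ball_of_eventually (hsmall.and (hconj.and hW))
  -- The bound `r ≤ r₀` ensures that the conjugation, the contraction and the injectivity of `γ`
  -- hold on the whole disc that parametrizes the zero set.
  obtain ⟨V, hVU, hV, hV0, r, hr, hrr, hz, hd⟩ := H.exists_nhds _
    (inter_mem hU (hF.1.eventually_analyticAt.and H.analyticAt.eventually_analyticAt)) r₀ hr₀
  have hFV : AnalyticOnNhd ℂ F V := fun p hp => (hVU hp).2.1
  have hhV : AnalyticOnNhd ℂ h V := fun p hp => (hVU hp).2.2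
  have hne : ∀ t, ‖t‖ < r₀ → t ≠ 0 → γ t ≠ 0 := fun t ht ht0 h0 =>
    ht0 (hinj (hall t ht).2.2 (mem_of_mem_nhds hW) (h0.trans hγ.map_zero.symm))
  have hlt : ∀ t, ‖t‖ < r → ‖θ t‖ < r := fun t ht =>
    ((hall t (ht.trans_le hrr)).1.1.trans
      (mul_le_of_le_one_left (norm_nonneg _) hc2.le)).trans_lt ht
  have hstable : FormalCurve.IsStableSet F V (FormalCurve.zeroSet h V) := by
    refine ⟨hV, hV0, hFV, fun p hp => hp.1, ?_, ?_⟩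
    · rw [hz]
      rintro _ ⟨t, ht, rfl⟩
      rw [mem_ball_zero_iff] at ht
      exact ⟨θ t, mem_ball_zero_iff.2 (hlt t ht), ((hall t (ht.trans_le hrr)).2.1).symm⟩
    · rw [hz]
      rintro _ ⟨t, ht, rfl⟩
      have hit := FormalCurve.iterate_arc (F := F) (γ := γ) (θ := θ) hc0 hc2 (fun t ht => (hall t ht).1.1)
        (fun t ht => (hall t ht).2.1) ((mem_ball_zero_iff.1 ht).trans_le hrr)
      have h1 : Tendsto (fun n => θ^[n] t) atTop (𝓝 0) := by
        refine squeeze_zero_norm (fun n => (hit n).1) ?_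
        simpa using (tendsto_pow_atTop_nhds_zero_of_lt_one hc0 hc2).mul_const ‖t‖
      exact (hγ.tendsto.comp h1).congr fun n => ((hit n).2).symm
  have hfd : ∀ p ∈ FormalCurve.zeroSet h V, p ≠ 0 → fderiv ℂ h p ≠ 0 := by
    rw [hz]
    rintro _ ⟨t, ht, rfl⟩ hp
    exact hd t ht fun h0 => hp (by rw [h0, hγ.map_zero])
  refine ⟨V, fun p hp => (hVU hp).1, hV, hV0, hhV, hstable, ⟨hstable.of_subset Set.sdiff_subset ?_,
    ?_⟩, fun hns => ⟨hstable, ?_⟩, fun p hp => ?_⟩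
  · rintro p ⟨hp, hp0⟩
    refine ⟨hstable.2.2.2.2.1 hp, ?_⟩
    rw [hz] at hp
    obtain ⟨t, ht, rfl⟩ := hp
    have ht' := mem_ball_zero_iff.1 ht
    have ht0 : t ≠ 0 := fun h0 => hp0 (by rw [h0, hγ.map_zero]; rfl)
    obtain ⟨⟨-, h1⟩, h2, -⟩ := hall t (ht'.trans_le hrr)
    rw [h2]
    exact hne _ ((hlt t ht').trans_le hrr) (h1 ht0)
  · rintro p ⟨hp, hp0⟩
    -- The global equation `h` serves at every point, as its differential is nonzero along the curve
    -- off the origin.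
    refine ⟨V \ {0}, h, hV.sdiff isClosed_singleton, ⟨hp.1, hp0⟩, hhV.mono Set.sdiff_subset,
      hfd p hp hp0, ?_⟩
    ext q
    constructor
    · rintro ⟨⟨h1, -⟩, h2⟩
      exact ⟨h1.2, h2⟩
    · rintro ⟨h1, h2⟩
      exact ⟨⟨⟨h2.1, h1⟩, h2.2⟩, h2⟩
  · intro p hp
    refine ⟨V, h, hV, hp.1, hhV, ?_, ?_⟩
    · by_cases hp0 : p = 0
      · rw [hp0]
        exact FormalCurve.IsNonsingular.fderiv_ne_zero H.analyticAt (hspan ▸ hns)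
      · exact hfd p hp hp0
    · ext q
      constructor
      · rintro ⟨h1, h2⟩
        exact ⟨h1.2, h2⟩
      · rintro ⟨h1, h2⟩
        exact ⟨⟨h2, h1⟩, h2⟩
  · filter_upwards [hp.1.eventually (hV.mem_nhds hV0), H.eventually_eq_zero_of_isAsymptoticOrbit
      hF hγ hker hθ hθ0 hlam0 hlam1 hconj hp] with n h1 h2
    exact ⟨h1, h2⟩
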